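/- Let $(M,g)$ be a closed (compact, without boundary) orientable smooth Riemannian surface, let $\theta$ be a smooth $1$-form on $M$, and let $\kappa>0$. Put $L(p,v)=\tfrac12|v|_p^2+\theta_p(v)$ for $v\in T_pM$, and $\mathbb T=\mathbb R/\mathbb Z$. Let $H^1(\mathbb T,M)$ be the Hilbert manifold of absolutely continuous loops $x:\mathbb T\to M$ with square integrable derivative, and let $\mathcal M=H^1(\mathbb T,M)\times(0,+\infty)$, where $(x,T)\in\mathcal M$ is identified with the closed curve $\gamma(t)=x(t/T)$, $0\le t\le T$. The free-period action functional $S_\kappa:\mathcal M\to\mathbb R$ is $$S_\kappa(x,T)=T\int_{\mathbb T}\Bigl(L\bigl(x(s),x'(s)/T\bigr)+\kappa\Bigr)\,ds .$$ An element $\alpha=(x,T)\in\mathcal M$ is a local minimizer of $S_\kappa$ if $S_\kappa\ge S_\kappa(\alpha)$ on a neighborhood of $\alpha$ in $\mathcal M$; it is a strict local minimizer if its orbit $\mathbb T\cdot\alpha=\{(x(\sigma+\cdot),T):\sigma\in\mathbb T\}$ has a neighborhood $\mathcal U$ in $\mathcal M$ such that $S_\kappa(\gamma)>S_\kappa(\alpha)$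 for all $\gamma\in\mathcal U\setminus\mathbb T\cdot\alpha$. For $n\ge1$ the $n$-th iterate of $\alpha$ is $\alpha^n=(x(n\,\cdot),nT)$, that is, the closed curve $\alpha^n:[0,nT]\to M$ that runs $n$ times through $\alpha$. If $\alpha\in\mathcal M$ is a local minimizer (resp. a strict local minimizer) of $S_\kappa$ on $\mathcal M$, then for every $n\ge1$ its $n$-th iterate $\alpha^n$ is also a local minimizer (resp. a strict local minimizer) of $S_\kappa$ on $\mathcal M$. -/

import Mathlib

open Set Filter Topology MeasureTheory
open scoped Manifold ContDiff

noncomputable section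

namespace MagneticFlow

/-- The model plane `ℝ²`. -/
abbrev Plane : Type := EuclideanSpace ℝ (Fin 2)

section Surface

variable (M : Type*) [TopologicalSpace M] [ChartedSpace Plane M]

/-- The smooth surface `M` is orientable: it is covered by a family of charts of its smooth
structure all of whose transition maps have positive Jacobian determinant. -/
def IsOrientable : Prop :=
  ∃ A : Set (OpenPartialHomeomorph M Plane),
    A ⊆ IsManifold.maximalAtlas (𝓡 2) ∞ M ∧
    (∀ p : M, ∃ e ∈ A, p ∈ e.source) ∧
    ∀ e ∈ A, ∀ e' ∈ A, ∀ y ∈ (e.symm.trans e').source,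
      0 < (fderiv ℝ (e.symm.trans e') y).det

/-- Smooth real-valued functions on `M`. -/
abbrev SmoothFun : Type _ := C^∞⟮𝓡 2, M; 𝓘(ℝ, ℝ), ℝ⟯

/-- Smooth Riemannian metrics on `M`. -/
abbrev SmoothMetric [IsManifold (𝓡 2) ∞ M] : Type _ :=
  Bundle.ContMDiffRiemannianMetric (𝓡 2) ∞ Plane (fun p : M ↦ TangentSpace (𝓡 2) p)

/-- Smooth `1`-forms on `M`: smooth sections of the cotangent bundle. -/
abbrev SmoothOneForm [IsManifold (𝓡 2) ∞ M] : Type _ :=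
  ContMDiffSection (𝓡 2) (Plane →L[ℝ] ℝ) ∞
    (fun p : M ↦ TangentSpace (𝓡 2) p →L[ℝ] Bundle.Trivial M ℝ p)

/-- The set underlying `H¹(𝕋, M)`, `𝕋 = ℝ/ℤ`: loops, written as `1`-periodic maps `ℝ → M`, that are
absolutely continuous with square integrable derivative.

On a closed manifold both conditions can be read off from the compositions with smooth functions
`f : M → ℝ`: finitely many such functions are the components of an embedding of `M` in a Euclidean
space, and finitely many of them contain local coordinates at every point of `M`. -/
structure H1Loop where
  /-- The underlying periodic map. -/
  toFun : ℝ → M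
  periodic' : Function.Periodic toFun 1
  absCont' : ∀ (f : SmoothFun M) (a b : ℝ),
    AbsolutelyContinuousOnInterval (fun s ↦ f (toFun s)) a b
  memLp_deriv' : ∀ (f : SmoothFun M) (a b : ℝ),
    MemLp (deriv fun s ↦ f (toFun s)) 2 (volume.restrict (Icc a b))

instance : CoeFun (H1Loop M) (fun _ ↦ ℝ → M) := ⟨H1Loop.toFun⟩

end Surface

section Loops

variable {M : Type*} [TopologicalSpace M] [ChartedSpace Plane M]

theorem H1Loop.memLp (x : H1Loop M) (f : SmoothFun M) :
    MemLp (fun s ↦ f (x s)) 2 (volume.restrict (Icc (0 : ℝ) 1)) := by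
  have h : ContinuousOn (fun s ↦ f (x s)) (Icc (0 : ℝ) 1) := by
    have := (x.absCont' f 0 1).continuousOn
    rwa [uIcc_of_le zero_le_one] at this
  obtain ⟨C, hC⟩ := isCompact_Icc.exists_bound_of_continuousOn h
  exact MemLp.of_bound (h.aestronglyMeasurable measurableSet_Icc) C
    ((ae_restrict_iff' measurableSet_Icc).2 (Eventually.of_forall hC))

/-- The class of `f ∘ x` in `H¹(𝕋, ℝ)`, recorded as the pair of the function and its derivative in
`L² × L²`; the product topology on these pairs is the one of the `H¹`-norm. -/
def H1Loop.jet (f : SmoothFun M) (x : H1Loop M) :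
    Lp ℝ 2 (volume.restrict (Icc (0 : ℝ) 1)) × Lp ℝ 2 (volume.restrict (Icc (0 : ℝ) 1)) :=
  ((x.memLp f).toLp _, (x.memLp_deriv' f 0 1).toLp _)

/-- The topology of `H¹(𝕋, M)`: the coarsest one for which `x ↦ f ∘ x ∈ H¹(𝕋, ℝ)` is continuous for
every smooth `f : M → ℝ`. For a closed manifold embedded in `ℝᴺ` this is the topology
induced by the inclusion `H¹(𝕋, M) ⊆ H¹(𝕋, ℝᴺ)`, that is, the one of the Hilbert manifold. -/
instance : TopologicalSpace (H1Loop M) :=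
  ⨅ f : SmoothFun M, TopologicalSpace.induced (H1Loop.jet f) inferInstance

variable (M) in
/-- The space `H¹(𝕋, M) × (0, ∞)`. The pair `(x, T)` stands for the closed curve
`γ(t) = x(t / T)`, `0 ≤ t ≤ T`. -/
abbrev CurveSpace : Type _ := H1Loop M × Ioi (0 : ℝ)

/-- The velocity `x'(s)` (the zero vector at the null set of `s` where `x` has no derivative). -/
def H1Loop.velocity (x : H1Loop M) (s : ℝ) : TangentSpace (𝓡 2) (x s) :=
  mfderiv 𝓘(ℝ, ℝ) (𝓡 2) x.toFun s (1 : ℝ)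

/-- The magnetic Lagrangian `L(p, v) = |v|² / 2 + θ_p(v)`. -/
def lagrangian [IsManifold (𝓡 2) ∞ M] (g : SmoothMetric M) (θ : SmoothOneForm M)
    (p : M) (v : TangentSpace (𝓡 2) p) : ℝ :=
  g.inner p v v / 2 + θ p v

/-- The free-period action functional `S_κ(x, T) = T ∫_𝕋 (L(x, x' / T) + κ) ds`. -/
def action [IsManifold (𝓡 2) ∞ M] (g : SmoothMetric M) (θ : SmoothOneForm M) (κ : ℝ)
    (α : CurveSpace M) : ℝ :=
  (α.2 : ℝ) * ∫ s in (0 : ℝ)..1,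
    (lagrangian g θ (α.1 s) ((α.2 : ℝ)⁻¹ • α.1.velocity s) + κ)

/-- The orbit `𝕋 · α = {(x(σ + ·), T) | σ ∈ 𝕋}` of `α = (x, T)`. -/
def orbit (α : CurveSpace M) : Set (CurveSpace M) :=
  {β | β.2 = α.2 ∧ ∃ σ : ℝ, ∀ s : ℝ, β.1 s = α.1 (σ + s)}

/-- `α` is a strict local minimizer of `S`: its orbit `𝕋 · α` has a neighbourhood `U` with
`S γ > S α` for all `γ ∈ U \ 𝕋 · α`. -/
def IsStrictLocalMinimizer (S : CurveSpace M → ℝ) (α : CurveSpace M) : Prop :=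
  ∃ U ∈ 𝓝ˢ (orbit α), ∀ γ ∈ U \ orbit α, S α < S γ

theorem absolutelyContinuous_comp_mul {u : ℝ → ℝ} {c : ℝ} (hc : 0 < c) {a b : ℝ}
    (hu : AbsolutelyContinuousOnInterval u (c * a) (c * b)) :
    AbsolutelyContinuousOnInterval (fun s ↦ u (c * s)) a b := by
  rw [absolutelyContinuousOnInterval_iff] at hu ⊢
  intro ε hε
  obtain ⟨δ, hδ, h⟩ := hu ε hε
  refine ⟨δ / c, by positivity, fun E hE hlen ↦ ?_⟩
  refine h (E.1, fun i ↦ (c * (E.2 i).1, c * (E.2 i).2)) ⟨fun i hi ↦ ?_, ?_⟩ ?_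
  · have hm : ∀ t ∈ uIcc a b, c * t ∈ uIcc (c * a) (c * b) := by
      intro t ht
      rw [mem_uIcc] at ht ⊢
      simpa [mul_le_mul_iff_right₀ hc] using ht
    exact ⟨hm _ (hE.1 i hi).1, hm _ (hE.1 i hi).2⟩
  · intro i hi j hj hij
    have hd := hE.2 hi hj hij
    simp only [Function.onFun] at hd ⊢
    rw [Set.disjoint_left] at hd ⊢
    have hs : ∀ p q y : ℝ, y ∈ uIoc (c * p) (c * q) → y / c ∈ uIoc p q := by
      intro p q y hy
      rw [mem_uIoc] at hy ⊢
      simpa [lt_div_iff₀' hc, div_le_iff₀' hc] using hy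
    exact fun y hy hy' ↦ hd (hs _ _ _ hy) (hs _ _ _ hy')
  · have : ∀ p q : ℝ, dist (c * p) (c * q) = c * dist p q := by
      intro p q
      rw [Real.dist_eq, Real.dist_eq, ← mul_sub, abs_mul, abs_of_pos hc]
    simp only [this, ← Finset.mul_sum]
    rwa [lt_div_iff₀' hc] at hlen

theorem memLp_comp_mul {v : ℝ → ℝ} {c : ℝ} (hc : 0 < c) {a b : ℝ}
    (hv : MemLp v 2 (volume.restrict (Icc (c * a) (c * b)))) :
    MemLp (fun s ↦ v (c * s)) 2 (volume.restrict (Icc a b)) := by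
  have hemb : MeasurableEmbedding (fun s : ℝ ↦ c * s) :=
    (Homeomorph.mulLeft₀ c hc.ne').measurableEmbedding
  have hpre : (fun s : ℝ ↦ c * s) ⁻¹' Icc (c * a) (c * b) = Icc a b := by
    ext s; simp [mul_le_mul_iff_right₀ hc]
  have hmap : Measure.map (fun s : ℝ ↦ c * s) (volume.restrict (Icc a b)) =
      ENNReal.ofReal |c⁻¹| • volume.restrict (Icc (c * a) (c * b)) := by
    rw [← hpre, ← hemb.restrict_map, Real.map_volume_mul_left hc.ne', Measure.restrict_smul]
  have h := hv.smul_measure (c := ENNReal.ofReal |c⁻¹|) ENNReal.ofReal_ne_top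
  rw [← hmap] at h
  exact (hemb.memLp_map_measure_iff).1 h

/-- The `n`-th iterate `s ↦ x(n s)` of a loop. -/
def H1Loop.iterate (x : H1Loop M) (n : ℕ) (hn : 1 ≤ n) : H1Loop M where
  toFun s := x (n * s)
  periodic' s := by
    have h := x.periodic'.nat_mul n (n * s)
    simpa [mul_add] using h
  absCont' f a b :=
    absolutelyContinuous_comp_mul (u := fun s ↦ f (x s)) (by exact_mod_cast hn)
      (x.absCont' f _ _)
  memLp_deriv' f a b := by
    have hc : (0 : ℝ) < n := by exact_mod_cast hn
    have h := (memLp_comp_mul hc (x.memLp_deriv' f (n * a) (n * b))).const_mul (n : ℝ)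
    have e : (deriv fun s : ℝ ↦ f (x (n * s))) =
        fun s ↦ (n : ℝ) * deriv (fun s ↦ f (x s)) (n * s) := by
      ext s
      simpa using deriv_comp_mul_left (n : ℝ) (fun s ↦ f (x s)) s
    rw [e]
    exact h

/-- The `n`-th iterate of a closed curve `α = (x, T)`: the curve `αⁿ : [0, n T] → M` that runs
`n` times through `α`, that is, the pair `(x(n ·), n T)`. -/
def iterate (α : CurveSpace M) (n : ℕ) (hn : 1 ≤ n) : CurveSpace M :=
  (α.1.iterate n hn, ⟨n * (α.2 : ℝ), mem_Ioi.2 (mul_pos (Nat.cast_pos.2 hn) α.2.2)⟩)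

end Loops

end MagneticFlow

end

open Set Filter Topology MeasureTheory
open scoped Manifold ContDiff

noncomputable section

namespace MagneticFlow

/-! ### A winding argument: a strand running n times around an annulus crosses its deck translate.
-/

section Crossing

/-! The proof is by induction on the number of iterations: a closed curve near the (k+1)-st iterate
of α can be cut at a self-intersection into a curve near α and a curve near the k-th iterate, up to
time shifts. The action is additive under cutting (`action_cut`) and shift invariant, and it
multiplies under iteration (`action_iterate`), so the lower bounds S(α) and k S(α) for the two parts
add up to the bound (k+1) S(α). Four facts make this work.

Regularity. A local minimizer is C¹ in charts, by the du Bois-Reymond form of the Euler-Lagrange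
equation. Its velocity vanishes nowhere or identically, by a Gronwall estimate for the momentum
(`plane_minimizer_regular`). It cannot be constant, since the action of a constant loop is κT and
decreases with T when κ > 0. Hence α is a C¹ immersed loop (`minimizer_deriv_ne_zero`).

Existence of the cut (`exists_cut`). Embed M in a Euclidean space and let c be the image of the
loop. Orientability gives a periodic family of linear maps A(a) to ℂ that are injective on the
tangent plane at c(a): the real part is the inner product with c'(a), the imaginary part a
transverse covector. Suppose a nearby curve w of period n never satisfies w(a+1+u) = w(a) for small
u. Then D(a,b,u) = A(a+b)(w(a+1+u) - w(a)) never vanishes, and as u increases it travels from the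
left half plane to the right one. Since D has a continuous argument, it passes 0 always on the same
side, above or below. Now look at the strands crossing the transversal at c(0). Their highest
crossings form an n-periodic sequence of heights, which cannot increase strictly, so somewhere the
next strand passes below the highest point of the current one; the lowest crossings give in the same
way a passage above. This contradiction is `exists_crossing` together with
`no_passage_on_both_sides`.

Continuity of cutting (`tendsto_shift_piece`). The two parts of the cut curve, suitably shifted and
rescaled to unit period, converge in H¹ to the loop and to its k-th iterate. The continuity of c' is
used here.

Strictness. If both parts lie on the orbits of α and of its k-th iterate, their phases differ by
something close to a period of c. Both pass through the cut point, so local injectivity of c makes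
the difference an exact period, and the whole curve lies on the orbit of the (k+1)-st iterate
(`eventually_mem_orbit_of_cut`). Off that orbit at least one of the two inequalities is therefore
strict. -/

theorem floor_eq_of_continuous {X : Type*} [TopologicalSpace X] [PreconnectedSpace X] {f : X → ℝ}
    (hf : Continuous f) (h : ∀ x (k : ℤ), f x ≠ k) (x y : X) : ⌊f x⌋ = ⌊f y⌋ := by
  have key : ∀ x y : X, ⌊f y⌋ ≤ ⌊f x⌋ := by
    intro x y
    by_contra! hlt
    have h1 : f x ≤ ⌊f y⌋ := (Int.floor_lt.1 hlt).le
    obtain ⟨z, hz⟩ := mem_range_of_exists_le_of_exists_ge hf ⟨x, h1⟩ ⟨y, Int.floor_le (f y)⟩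
    exact h z _ hz
  exact le_antisymm (key y x) (key x y)

/-- A continuous choice of argument of a nonvanishing function on a simply connected space. -/
theorem exists_continuous_arg {X : Type*} [TopologicalSpace X] [SimplyConnectedSpace X]
    [LocallyPathConnectedSpace X] {D : X → ℂ} (hD : Continuous D) (h0 : ∀ x, D x ≠ 0) :
    ∃ θ : X → ℝ, Continuous θ ∧ ∀ x, D x = ‖D x‖ * Complex.exp (θ x * Complex.I) := by
  obtain ⟨a₀⟩ : Nonempty X := inferInstance
  obtain ⟨F, ⟨-, hF⟩, -⟩ := Complex.isCoveringMapOn_exp.existsUnique_continuousMap_lifts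
    ⟨D, hD⟩ (a₀ := a₀) (e₀ := Complex.log (D a₀)) (Complex.exp_log (h0 a₀)) (fun a ↦ h0 a)
  refine ⟨fun x ↦ (F x).im, by fun_prop, fun x ↦ ?_⟩
  have hx : Complex.exp (F x) = D x := congrFun hF x
  rw [← hx, Complex.norm_exp, Complex.ofReal_exp, ← Complex.exp_add, Complex.re_add_im]

/-- A continuous argument θ of D counts how often the upper and the lower half of the imaginary axis
have been passed. The number ⌊P⌋ is the sheet between consecutive lifts of the upper half axis; it
is constant on each of the two walls u = ±r. The first path avoids the upper half axis, so the sheet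
is the same on both walls; the second avoids the lower half axis, so the sheets differ by one. -/
theorem no_passage_on_both_sides {D : ℝ × ℝ × ℝ → ℂ} (hD : Continuous D) (h0 : ∀ x, D x ≠ 0) {r : ℝ}
    (hL : ∀ a b, (D (a, b, -r)).re < 0) (hR : ∀ a b, 0 < (D (a, b, r)).re)
    {a₁ b₁ a₂ b₂ : ℝ} (h₁ : ∀ u, (D (a₁, b₁, u)).re = 0 → (D (a₁, b₁, u)).im < 0)
    (h₂ : ∀ u, (D (a₂, b₂, u)).re = 0 → 0 < (D (a₂, b₂, u)).im) : False := by
  obtain ⟨θ, hθ, hDθ⟩ := exists_continuous_arg hD h0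
  have hpi := Real.pi_pos
  have hre : ∀ x, (D x).re = ‖D x‖ * Real.cos (θ x) := by
    intro x
    conv_lhs => rw [hDθ x]
    rw [Complex.re_ofReal_mul, Complex.exp_ofReal_mul_I_re]
  have him : ∀ x, (D x).im = ‖D x‖ * Real.sin (θ x) := by
    intro x
    conv_lhs => rw [hDθ x]
    rw [Complex.im_ofReal_mul, Complex.exp_ofReal_mul_I_im]
  have hn : ∀ x, 0 < ‖D x‖ := fun x ↦ norm_pos_iff.2 (h0 x)
  have hc1 : ∀ k : ℤ, Real.cos (Real.pi / 2 + 2 * Real.pi * k) = 0 := by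
    intro k
    rw [show Real.pi / 2 + 2 * Real.pi * k = Real.pi / 2 + k * (2 * Real.pi) by ring,
      Real.cos_add_int_mul_two_pi, Real.cos_pi_div_two]
  have hs1 : ∀ k : ℤ, Real.sin (Real.pi / 2 + 2 * Real.pi * k) = 1 := by
    intro k
    rw [show Real.pi / 2 + 2 * Real.pi * k = Real.pi / 2 + k * (2 * Real.pi) by ring,
      Real.sin_add_int_mul_two_pi, Real.sin_pi_div_two]
  have hc2 : ∀ k : ℤ, Real.cos (-(Real.pi / 2) + 2 * Real.pi * k) = 0 := by
    intro k
    rw [show -(Real.pi / 2) + 2 * Real.pi * k = -(Real.pi / 2) + k * (2 * Real.pi) by ring,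
      Real.cos_add_int_mul_two_pi, Real.cos_neg, Real.cos_pi_div_two]
  have hs2 : ∀ k : ℤ, Real.sin (-(Real.pi / 2) + 2 * Real.pi * k) = -1 := by
    intro k
    rw [show -(Real.pi / 2) + 2 * Real.pi * k = -(Real.pi / 2) + k * (2 * Real.pi) by ring,
      Real.sin_add_int_mul_two_pi, Real.sin_neg, Real.sin_pi_div_two]
  -- `P x = (θ x - π/2) / 2π` and `Q x = (θ x + π/2) / 2π = P x + 1/2`
  set P : ℝ × ℝ × ℝ → ℝ := fun x ↦ (θ x - Real.pi / 2) / (2 * Real.pi) with hP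
  have hPc : Continuous P := by fun_prop
  have hPk : ∀ x (k : ℤ), P x = k → θ x = Real.pi / 2 + 2 * Real.pi * k := by
    intro x k h
    simp only [hP] at h
    field_simp at h
    linarith
  have hQk : ∀ x (k : ℤ), P x + 1 / 2 = k → θ x = -(Real.pi / 2) + 2 * Real.pi * k := by
    intro x k h
    simp only [hP] at h
    field_simp at h
    linarith
  have hθP : ∀ x, θ x = Real.pi / 2 + 2 * Real.pi * P x := by
    intro x; simp only [hP]; field_simp; ring
  have hcosP : ∀ x, Real.cos (θ x) = - Real.sin (2 * Real.pi * Int.fract (P x)) := by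
    intro x
    have : θ x = (2 * Real.pi * Int.fract (P x) + Real.pi / 2) + (⌊P x⌋ : ℤ) * (2 * Real.pi) := by
      rw [hθP x, Int.fract]; ring
    rw [this, Real.cos_add_int_mul_two_pi, Real.cos_add_pi_div_two]
  -- Left and right half planes are the first and the second half of a sheet.
  have hneg : ∀ x, (D x).re < 0 → Int.fract (P x) < 1 / 2 := by
    intro x hx
    by_contra! hge
    rw [hre, hcosP] at hx
    have : Real.sin (2 * Real.pi * Int.fract (P x)) ≤ 0 := by
      rw [← Real.sin_sub_two_pi]
      apply Real.sin_nonpos_of_nonpos_of_neg_pi_le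
      · nlinarith [Int.fract_lt_one (P x)]
      · nlinarith
    nlinarith [hn x]
  have hpos : ∀ x, 0 < (D x).re → 1 / 2 < Int.fract (P x) := by
    intro x hx
    by_contra! hge
    rw [hre, hcosP] at hx
    have : 0 ≤ Real.sin (2 * Real.pi * Int.fract (P x)) := by
      apply Real.sin_nonneg_of_nonneg_of_le_pi
      · have := Int.fract_nonneg (P x); positivity
      · nlinarith
    nlinarith [hn x]
  have hLc : ∀ a b a' b', ⌊P (a, b, -r)⌋ = ⌊P (a', b', -r)⌋ := by
    intro a b a' b'
    refine floor_eq_of_continuous (f := fun x : ℝ × ℝ ↦ P (x.1, x.2, -r)) (by fun_prop) ?_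
      (a, b) (a', b')
    intro x k h
    have := hL x.1 x.2
    rw [hre, hPk _ k h, hc1] at this
    simp at this
  have hRc : ∀ a b a' b', ⌊P (a, b, r)⌋ = ⌊P (a', b', r)⌋ := by
    intro a b a' b'
    refine floor_eq_of_continuous (f := fun x : ℝ × ℝ ↦ P (x.1, x.2, r)) (by fun_prop) ?_
      (a, b) (a', b')
    intro x k h
    have := hR x.1 x.2
    rw [hre, hPk _ k h, hc1] at this
    simp at this
  have e1 : ⌊P (a₁, b₁, -r)⌋ = ⌊P (a₁, b₁, r)⌋ := by
    refine floor_eq_of_continuous (f := fun u : ℝ ↦ P (a₁, b₁, u)) (by fun_prop) ?_ _ _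
    intro u k h
    have hu := h₁ u
    rw [hre, him, hPk _ k h, hc1, hs1] at hu
    have := hu (by simp)
    nlinarith [hn (a₁, b₁, u)]
  -- The second path never meets the lower half axis, where `P + 1 / 2` is an integer.
  have e2 : ⌊P (a₂, b₂, -r) + 1 / 2⌋ = ⌊P (a₂, b₂, r) + 1 / 2⌋ := by
    refine floor_eq_of_continuous (f := fun u : ℝ ↦ P (a₂, b₂, u) + 1 / 2) (by fun_prop) ?_ _ _
    intro u k h
    have hu := h₂ u
    rw [hre, him, hQk _ k h, hc2, hs2] at hu
    have := hu (by simp)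
    nlinarith [hn (a₂, b₂, u)]
  have f1 : ⌊P (a₂, b₂, -r) + 1 / 2⌋ = ⌊P (a₂, b₂, -r)⌋ := by
    rw [Int.floor_eq_iff]
    have := hneg _ (hL a₂ b₂)
    rw [Int.fract] at this
    constructor
    · linarith [Int.floor_le (P (a₂, b₂, -r))]
    · linarith
  have f2 : ⌊P (a₂, b₂, r) + 1 / 2⌋ = ⌊P (a₂, b₂, r)⌋ + 1 := by
    rw [Int.floor_eq_iff]
    have := hpos _ (hR a₂ b₂)
    rw [Int.fract] at this
    push_cast
    constructor
    · linarith
    · linarith [Int.lt_floor_add_one (P (a₂, b₂, r))]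
  have := hLc a₁ b₁ a₂ b₂
  have := hRc a₁ b₁ a₂ b₂
  omega

theorem exists_le_succ_of_periodic {f : ℕ → ℝ} {n : ℕ} (hn : 1 ≤ n) (h : f n = f 0) :
    ∃ j, f (j + 1) ≤ f j := by
  by_contra! hlt
  have : StrictMono f := strictMono_nat_of_lt_succ hlt
  exact (this (show 0 < n by omega)).ne' h

/-- The highest point of a path on the imaginary axis. -/
theorem exists_highest_crossing {X : ℝ → ℂ} (hX : Continuous X) {η : ℝ} (hη : 0 < η)
    (hneg : (X (-η)).re < 0) (hpos : 0 < (X η).re) :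
    ∃ u ∈ Icc (-η) η, (X u).re = 0 ∧ ∀ v ∈ Icc (-η) η, (X v).re = 0 → (X v).im ≤ (X u).im := by
  have hc : IsCompact (Icc (-η) η ∩ {u | (X u).re = 0}) :=
    isCompact_Icc.inter_right (isClosed_eq (by fun_prop) continuous_const)
  have hne : (Icc (-η) η ∩ {u | (X u).re = 0}).Nonempty := by
    have := intermediate_value_Icc (show -η ≤ η by linarith)
      (f := fun u ↦ (X u).re) (by fun_prop) ⟨hneg.le, hpos.le⟩
    obtain ⟨u, hu, h⟩ := this
    exact ⟨u, hu, h⟩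
  obtain ⟨u, hu, hmax⟩ := hc.exists_isMaxOn hne (f := fun u ↦ (X u).im)
    (by fun_prop : Continuous fun u ↦ (X u).im).continuousOn
  exact ⟨u, hu.1, hu.2, fun v hv h ↦ hmax ⟨hv, h⟩⟩

variable {E : Type*} [NormedAddCommGroup E] [NormedSpace ℝ E]

/-- A curve running `n ≥ 1` times through an annulus (`A` is a periodic framing) meets its image
under the deck transformation. -/
theorem exists_crossing {A : ℝ → E →L[ℝ] ℂ} (hA : Continuous A) (hAp : Function.Periodic A 1)
    {w : ℝ → E} (hw : Continuous w) {n : ℕ} (hn : 1 ≤ n) (hwp : Function.Periodic w n)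
    {c₀ : E} {η : ℝ} (hη : 0 < η)
    (hshift : ∀ a b u : ℝ, |b| ≤ η →
      ((u = -(2 * η) → (A (a + b) (w (a + 1 + u) - w a)).re < 0) ∧
      (u = 2 * η → 0 < (A (a + b) (w (a + 1 + u) - w a)).re)))
    (hcol : ∀ (j : ℕ) (u : ℝ), (u ∈ Icc (-(3 * η)) (-η) → (A 0 (w (j + u) - c₀)).re < 0) ∧
      (u ∈ Icc η (3 * η) → 0 < (A 0 (w (j + u) - c₀)).re))
    (hinj : ∀ a b u : ℝ, |b| ≤ η → |u| ≤ 2 * η → A (a + b) (w (a + 1 + u) - w a) = 0 →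
      w (a + 1 + u) = w a) :
    ∃ a u : ℝ, |u| ≤ 2 * η ∧ w (a + 1 + u) = w a := by
  by_contra! hno
  -- Clamping the parameters extends D to all of ℝ³, which is simply connected, without leaving the
  -- range where the hypotheses apply.
  set cl : ℝ → ℝ → ℝ := fun ρ b ↦ max (-ρ) (min ρ b) with hcl
  have clc : ∀ ρ, Continuous (cl ρ) := fun ρ ↦ by fun_prop
  have cl_le : ∀ ρ, 0 ≤ ρ → ∀ b, |cl ρ b| ≤ ρ := by
    intro ρ hρ b
    rw [abs_le]
    exact ⟨le_max_left _ _, max_le (by linarith) (min_le_left _ _)⟩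
  have cl_eq : ∀ ρ b, |b| ≤ ρ → cl ρ b = b := by
    intro ρ b hb
    obtain ⟨h1, h2⟩ := abs_le.1 hb
    simp only [hcl]
    rw [min_eq_right h2, max_eq_right h1]
  -- The parameter b moves only the frame: at a = j + v with b = -v the frame is the one at the
  -- integer j, hence `A 0`, and D becomes a difference of values in one fixed coordinate.
  set D : ℝ × ℝ × ℝ → ℂ := fun x ↦
    A (x.1 + cl η x.2.1) (w (x.1 + 1 + cl (2 * η) x.2.2) - w x.1) with hDdef
  have hD : Continuous D := by
    have h1 : Continuous fun x : ℝ × ℝ × ℝ ↦ x.1 + cl η x.2.1 :=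
      continuous_fst.add ((clc η).comp (by fun_prop))
    have h2 : Continuous fun x : ℝ × ℝ × ℝ ↦ x.1 + 1 + cl (2 * η) x.2.2 :=
      (by fun_prop : Continuous fun x : ℝ × ℝ × ℝ ↦ x.1 + 1).add ((clc (2 * η)).comp (by fun_prop))
    exact (hA.comp h1).clm_apply ((hw.comp h2).sub (hw.comp continuous_fst))
  have h0 : ∀ x, D x ≠ 0 := by
    intro x hx
    exact hno _ _ (cl_le _ (by linarith) x.2.2)
      (hinj _ _ _ (cl_le _ hη.le x.2.1) (cl_le _ (by linarith) x.2.2) hx)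
  have hA0 : ∀ j : ℕ, A j = A 0 := by
    intro j
    have := hAp.nat_mul j 0
    simpa using this
  have hcolL : ∀ j : ℕ, (A 0 (w (j + -η) - c₀)).re < 0 := fun j ↦
    (hcol j (-η)).1 ⟨by linarith, le_rfl⟩
  have hcolR : ∀ j : ℕ, 0 < (A 0 (w (j + η) - c₀)).re := fun j ↦
    (hcol j η).2 ⟨le_rfl, by linarith⟩
  have hXc : ∀ j : ℕ, Continuous fun u : ℝ ↦ A 0 (w (j + u) - c₀) := by
    intro j
    exact (A 0).continuous.comp ((hw.comp (by fun_prop)).sub continuous_const)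
  have htop : ∀ j : ℕ, ∃ u ∈ Icc (-η) η, (A 0 (w (j + u) - c₀)).re = 0 ∧ ∀ v ∈ Icc (-η) η,
      (A 0 (w (j + v) - c₀)).re = 0 → (A 0 (w (j + v) - c₀)).im ≤ (A 0 (w (j + u) - c₀)).im :=
    fun j ↦ exists_highest_crossing (hXc j) hη (hcolL j) (hcolR j)
  have hbot : ∀ j : ℕ, ∃ u ∈ Icc (-η) η, (A 0 (w (j + u) - c₀)).re = 0 ∧ ∀ v ∈ Icc (-η) η,
      (A 0 (w (j + v) - c₀)).re = 0 → (A 0 (w (j + u) - c₀)).im ≤ (A 0 (w (j + v) - c₀)).im := by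
    intro j
    obtain ⟨u, hu, h1, h2⟩ := exists_highest_crossing
      (X := fun u : ℝ ↦ (starRingEnd ℂ) (A 0 (w (j + u) - c₀)))
      (Complex.continuous_conj.comp (hXc j)) hη (by simpa using hcolL j) (by simpa using hcolR j)
    refine ⟨u, hu, by simpa using h1, fun v hv h ↦ ?_⟩
    have := h2 v hv (by simpa using h)
    simp only [Complex.conj_im] at this
    linarith
  choose ut hut hut0 hutm using htop
  choose ub hub hub0 hubm using hbot
  have hper : ∀ u : ℝ, w ((n : ℕ) + u) = w ((0 : ℕ) + u) := by
    intro u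
    have := hwp u
    rw [add_comm] at this
    simpa using this
  -- in the frame at an integer, `D` is the difference of two columns
  have hDcol : ∀ (j : ℕ) (v : ℝ), v ∈ Icc (-η) η → ∀ u,
      D (j + v, -v, u) = A 0 (w ((j + 1 : ℕ) + (v + cl (2 * η) u)) - c₀) -
        A 0 (w (j + v) - c₀) := by
    intro j v hv u
    simp only [hDdef]
    rw [cl_eq η (-v) (by rw [abs_neg]; exact abs_le.2 hv), ← map_sub]
    rw [show (j : ℝ) + v + -v = j by ring, hA0 j]
    congr 1
    rw [sub_sub_sub_cancel_right]
    congr 2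
    push_cast
    ring
  -- The total time offset lies in [-3η, 3η], and `hcol` excludes crossings of the column on its two
  -- outer thirds. So every crossing seen by D competes in the maximum over [-η, η].
  have hwin : ∀ (j : ℕ) (v : ℝ), v ∈ Icc (-η) η → ∀ u,
      (A 0 (w ((j + 1 : ℕ) + (v + cl (2 * η) u)) - c₀)).re = 0 →
      v + cl (2 * η) u ∈ Icc (-η) η := by
    intro j v hv u h
    have h2 := abs_le.1 (cl_le (2 * η) (by linarith) u)
    by_contra hmem
    rw [mem_Icc, not_and_or, not_le, not_le] at hmem
    rcases hmem with hlt | hlt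
    · have := (hcol (j + 1) (v + cl (2 * η) u)).1 ⟨by linarith [hv.1], hlt.le⟩
      exact this.ne h
    · have := (hcol (j + 1) (v + cl (2 * η) u)).2 ⟨hlt.le, by linarith [hv.2]⟩
      exact this.ne' h
  -- The chosen points `ut 0` and `ut n` may differ, but both are maximal on the same strand, so
  -- their heights agree.
  obtain ⟨j, hj⟩ := exists_le_succ_of_periodic (n := n)
    (f := fun j : ℕ ↦ (A 0 (w (j + ut j) - c₀)).im) hn (by
      apply le_antisymm
      · have := hutm 0 (ut n) (hut n) (by rw [← hper]; exact hut0 n)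
        rwa [← hper] at this
      · have := hutm n (ut 0) (hut 0) (by rw [hper]; exact hut0 0)
        rwa [hper] at this)
  obtain ⟨i, hi⟩ := exists_le_succ_of_periodic (n := n)
    (f := fun j : ℕ ↦ -(A 0 (w (j + ub j) - c₀)).im) hn (by
      apply neg_inj.2
      apply le_antisymm
      · have := hubm n (ub 0) (hub 0) (by rw [hper]; exact hub0 0)
        rwa [hper (ub 0)] at this
      · have := hubm 0 (ub n) (hub n) (by rw [← hper]; exact hub0 n)
        rwa [← hper (ub n)] at this)
  refine no_passage_on_both_sides hD h0 (r := 2 * η) (a₁ := j + ut j) (b₁ := -ut j)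
    (a₂ := i + ub i) (b₂ := -ub i) ?_ ?_ ?_ ?_
  · intro a b
    have := (hshift a (cl η b) (-(2 * η)) (cl_le _ hη.le b)).1 rfl
    simp only [hDdef]
    rwa [cl_eq (2 * η) (-(2 * η)) (by rw [abs_neg, abs_of_pos (by linarith)])]
  · intro a b
    have := (hshift a (cl η b) (2 * η) (cl_le _ hη.le b)).2 rfl
    simp only [hDdef]
    rwa [cl_eq (2 * η) (2 * η) (by rw [abs_of_pos (by linarith)])]
  -- Strand j+1 crosses the column no higher than the top of strand j; equality would be a zero of
  -- D.
  · intro u h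
    have hne := h0 (j + ut j, -ut j, u)
    rw [hDcol j _ (hut j)] at h hne ⊢
    rw [Complex.sub_re, hut0 j, sub_zero] at h
    have hle := hutm (j + 1) _ (hwin j _ (hut j) u h) h
    have hle' : (A 0 (w ((j + 1 : ℕ) + (ut j + cl (2 * η) u)) - c₀) - A 0 (w (j + ut j) - c₀)).im ≤ 0 := by
      rw [Complex.sub_im]; linarith
    refine lt_of_le_of_ne hle' fun h0' ↦ hne (Complex.ext ?_ h0')
    rw [Complex.sub_re, h, hut0 j]; simp
  · intro u h
    have hne := h0 (i + ub i, -ub i, u)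
    rw [hDcol i _ (hub i)] at h hne ⊢
    rw [Complex.sub_re, hub0 i, sub_zero] at h
    have hle := hubm (i + 1) _ (hwin i _ (hub i) u h) h
    have hle' : 0 ≤ (A 0 (w ((i + 1 : ℕ) + (ub i + cl (2 * η) u)) - c₀) - A 0 (w (i + ub i) - c₀)).im := by
      rw [Complex.sub_im]; linarith
    refine lt_of_le_of_ne hle' fun h0' ↦ hne (Complex.ext ?_ h0'.symm)
    rw [Complex.sub_re, h, hub0 i]; simp

end Crossing

/-! ### One-dimensional Sobolev functions on intervals. -/

section RealSobolev

/-- `F` is absolutely continuous on `[a, b]` with square integrable derivative. -/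
structure H1On (F : ℝ → ℝ) (a b : ℝ) : Prop where
  ac : AbsolutelyContinuousOnInterval F a b
  memLp : MemLp (deriv F) 2 (volume.restrict (Icc a b))

variable {F G : ℝ → ℝ} {a b c d : ℝ}

theorem ae_restrict_Icc_mem_Ioo (a b : ℝ) : ∀ᵐ s ∂(volume.restrict (Icc a b)), s ∈ Ioo a b := by
  rw [← Measure.restrict_congr_set (Ioo_ae_eq_Icc (μ := volume) (a := a) (b := b))]
  exact ae_restrict_mem measurableSet_Ioo

theorem deriv_ae_eq_of_eqOn (h : EqOn F G (Icc a b)) :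
    deriv F =ᵐ[volume.restrict (Icc a b)] deriv G := by
  filter_upwards [ae_restrict_Icc_mem_Ioo a b] with s hs
  refine Filter.EventuallyEq.deriv_eq ?_
  filter_upwards [isOpen_Ioo.mem_nhds hs] with t ht
  exact h (Ioo_subset_Icc_self ht)

theorem absolutelyContinuous_congr (hF : AbsolutelyContinuousOnInterval F a b)
    (h : EqOn F G (uIcc a b)) : AbsolutelyContinuousOnInterval G a b := by
  rw [absolutelyContinuousOnInterval_iff] at hF ⊢
  intro ε hε
  obtain ⟨δ, hδ, H⟩ := hF ε hε
  refine ⟨δ, hδ, fun E hE hl ↦ ?_⟩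
  convert H E hE hl using 1
  refine Finset.sum_congr rfl fun i hi ↦ ?_
  rw [h (hE.1 i hi).1, h (hE.1 i hi).2]

theorem H1On.congr (hab : a ≤ b) (hF : H1On F a b) (h : EqOn F G (Icc a b)) : H1On G a b :=
  ⟨absolutelyContinuous_congr hF.ac (by rwa [uIcc_of_le hab]),
    hF.memLp.ae_eq (deriv_ae_eq_of_eqOn h)⟩

theorem H1On.mono (hF : H1On F a b) (hac : a ≤ c) (hcd : c ≤ d) (hdb : d ≤ b) : H1On F c d :=
  ⟨hF.ac.mono (by rw [uIcc_of_le hcd, uIcc_of_le (hac.trans (hcd.trans hdb))]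
                  exact Icc_subset_Icc hac hdb),
    hF.memLp.mono_measure (Measure.restrict_mono (Icc_subset_Icc hac hdb) le_rfl)⟩

theorem H1On.continuousOn (hab : a ≤ b) (hF : H1On F a b) : ContinuousOn F (Icc a b) := by
  have := hF.ac.continuousOn
  rwa [uIcc_of_le hab] at this

theorem H1On.ae_differentiableAt (hab : a ≤ b) (hF : H1On F a b) :
    ∀ᵐ s ∂(volume.restrict (Icc a b)), DifferentiableAt ℝ F s := by
  rw [ae_restrict_iff' measurableSet_Icc]
  have := hF.ac.boundedVariationOn.ae_differentiableAt_of_mem_uIcc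
  rwa [uIcc_of_le hab] at this

theorem H1On.integral_deriv (hF : H1On F a b) {s t : ℝ} (hs : s ∈ Icc a b) (ht : t ∈ Icc a b) :
    ∫ r in s..t, deriv F r = F t - F s :=
  (hF.ac.mono (by
    rw [uIcc_of_le (hs.1.trans hs.2)]
    exact uIcc_subset_Icc hs ht)).integral_deriv_eq_sub

theorem memLp_two_intervalIntegrable {g : ℝ → ℝ} (hab : a ≤ b)
    (hg : MemLp g 2 (volume.restrict (Icc a b))) : IntervalIntegrable g volume a b := by
  rw [intervalIntegrable_iff_integrableOn_Icc_of_le hab]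
  exact hg.integrable (by norm_num)

theorem primitive_hasDerivAt_ae {g : ℝ → ℝ} (hab : a ≤ b) (hg : IntervalIntegrable g volume a b)
    (hF : ∀ t ∈ Icc a b, F t = F a + ∫ r in a..t, g r) :
    deriv F =ᵐ[volume.restrict (Icc a b)] g := by
  have h := hg.ae_hasDerivAt_integral
  have h2 : ∀ᵐ s ∂(volume.restrict (Icc a b)), s ∈ uIcc a b →
      ∀ c ∈ uIcc a b, HasDerivAt (fun x ↦ ∫ t in c..x, g t) (g s) s := ae_restrict_of_ae h
  filter_upwards [h2, ae_restrict_Icc_mem_Ioo a b] with s hs hmem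
  have hs' := (hs (by rw [uIcc_of_le hab]; exact Ioo_subset_Icc_self hmem) a left_mem_uIcc).const_add
    (F a)
  refine (hs'.congr_of_eventuallyEq ?_).deriv
  filter_upwards [isOpen_Ioo.mem_nhds hmem] with t ht
  exact hF t (Ioo_subset_Icc_self ht)

theorem primitive_absolutelyContinuous {g : ℝ → ℝ} (hab : a ≤ b)
    (hg : IntervalIntegrable g volume a b)
    (hF : ∀ t ∈ Icc a b, F t = F a + ∫ r in a..t, g r) : AbsolutelyContinuousOnInterval F a b := by
  have h1 := hg.absolutelyContinuousOnInterval_intervalIntegral (c := a) left_mem_uIcc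
  have h2 : AbsolutelyContinuousOnInterval (fun _ : ℝ ↦ F a) a b :=
    (LipschitzWith.const (F a)).lipschitzOnWith.absolutelyContinuousOnInterval
  refine absolutelyContinuous_congr (h2.add h1) ?_
  rw [uIcc_of_le hab]
  intro t ht
  simp only [Pi.add_apply]
  exact (hF t ht).symm

/-- The working criterion for `H1On`: gluing and affine substitution become identities between
integrals of a square integrable density. -/
theorem H1On.of_primitive {g : ℝ → ℝ} (hab : a ≤ b) (hg : MemLp g 2 (volume.restrict (Icc a b)))
    (hF : ∀ t ∈ Icc a b, F t = F a + ∫ r in a..t, g r) : H1On F a b :=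
  ⟨primitive_absolutelyContinuous hab (memLp_two_intervalIntegrable hab hg) hF,
    hg.ae_eq (primitive_hasDerivAt_ae hab (memLp_two_intervalIntegrable hab hg) hF).symm⟩

theorem H1On.glue (hab : a ≤ b) (hbc : b ≤ c) (h1 : H1On F a b) (h2 : H1On F b c) :
    H1On F a c := by
  have hm : MemLp (deriv F) 2 (volume.restrict (Icc a c)) := by
    rw [← Icc_union_Icc_eq_Icc hab hbc]
    have h3 := h1.memLp
    have h4 := h2.memLp
    rw [← memLp_indicator_iff_restrict measurableSet_Icc] at h3 h4
    rw [← memLp_indicator_iff_restrict (measurableSet_Icc.union measurableSet_Icc)]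
    refine (h3.add (h4.indicator (measurableSet_Icc (a := a) (b := b)).compl)).ae_eq
      (Eventually.of_forall fun s ↦ ?_)
    by_cases hs : s ∈ Icc a b
    · simp [hs, indicator]
    · by_cases hs' : s ∈ Icc b c <;> simp [hs, hs', indicator]
  have hi := memLp_two_intervalIntegrable (hab.trans hbc) hm
  refine H1On.of_primitive (hab.trans hbc) hm fun t ht ↦ ?_
  rcases le_total t b with htb | htb
  · rw [h1.integral_deriv (left_mem_Icc.2 hab) ⟨ht.1, htb⟩]; ring
  · rw [← intervalIntegral.integral_add_adjacent_intervals (b := b),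
      h1.integral_deriv (left_mem_Icc.2 hab) (right_mem_Icc.2 hab),
      h2.integral_deriv (left_mem_Icc.2 hbc) ⟨htb, ht.2⟩]
    · ring
    · exact hi.mono_set (by
        rw [uIcc_of_le hab, uIcc_of_le (hab.trans hbc)]; exact Icc_subset_Icc le_rfl hbc)
    · exact hi.mono_set (by
        rw [uIcc_of_le htb, uIcc_of_le (hab.trans hbc)]; exact Icc_subset_Icc hab ht.2)

theorem memLp_comp_affine {v : ℝ → ℝ} (hc : 0 < c)
    (hv : MemLp v 2 (volume.restrict (Icc (d + c * a) (d + c * b)))) :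
    MemLp (fun s ↦ v (d + c * s)) 2 (volume.restrict (Icc a b)) := by
  refine memLp_comp_mul (v := fun s ↦ v (d + s)) hc ?_
  have hmp : MeasurePreserving (fun s : ℝ ↦ d + s) (volume.restrict (Icc (c * a) (c * b)))
      (volume.restrict (Icc (d + c * a) (d + c * b))) := by
    have := (measurePreserving_add_left (volume : Measure ℝ) d).restrict_preimage
      (s := Icc (d + c * a) (d + c * b)) measurableSet_Icc
    have e : (fun s : ℝ ↦ d + s) ⁻¹' Icc (d + c * a) (d + c * b) = Icc (c * a) (c * b) := by
      ext s; simp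
    rwa [e] at this
  exact hv.comp_measurePreserving hmp

theorem H1On.comp_affine (hab : a ≤ b) (hc : 0 < c) (hF : H1On F (d + c * a) (d + c * b)) :
    H1On (fun s ↦ F (d + c * s)) a b := by
  refine H1On.of_primitive hab ((memLp_comp_affine hc hF.memLp).const_mul c) fun t ht ↦ ?_
  have e : ∫ r in a..t, c * deriv F (d + c * r) = ∫ r in (d + c * a)..(d + c * t), deriv F r := by
    rw [intervalIntegral.integral_const_mul, intervalIntegral.integral_comp_add_mul _ hc.ne',
      smul_eq_mul, ← mul_assoc, mul_inv_cancel₀ hc.ne', one_mul]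
  rw [e, hF.integral_deriv]
  · ring
  · exact ⟨le_rfl, by nlinarith⟩
  · exact ⟨by nlinarith [ht.1], by nlinarith [ht.2]⟩

/-- A function dominated by finitely many `H¹` functions in the Lipschitz sense is `H¹`. -/
theorem H1On.of_dominated {ι : Type*} [Fintype ι] (hab : a ≤ b) {w : ι → ℝ → ℝ}
    (hw : ∀ i, H1On (w i) a b) {K : ℝ}
    (h : ∀ s ∈ Icc a b, ∀ t ∈ Icc a b, |F s - F t| ≤ K * ∑ i, |w i s - w i t|) :
    H1On F a b := by
  have hac : AbsolutelyContinuousOnInterval F a b := by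
    have hs : Tendsto (fun E : ℕ × (ℕ → ℝ × ℝ) ↦ K * ∑ i, ∑ k ∈ Finset.range E.1,
        dist (w i (E.2 k).1) (w i (E.2 k).2))
        (AbsolutelyContinuousOnInterval.totalLengthFilter ⊓
          𝓟 (AbsolutelyContinuousOnInterval.disjWithin a b)) (𝓝 0) := by
      have := (tendsto_finsetSum Finset.univ fun i _ ↦ (hw i).ac).const_mul K
      simpa using this
    refine squeeze_zero' (Eventually.of_forall fun E ↦ Finset.sum_nonneg fun i _ ↦ dist_nonneg)
      ?_ hs
    refine (eventually_inf_principal.2 (Eventually.of_forall fun E hE ↦ ?_))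
    rw [Finset.sum_comm, Finset.mul_sum]
    refine Finset.sum_le_sum fun k hk ↦ ?_
    have := hE.1 k hk
    rw [uIcc_of_le hab] at this
    simpa [Real.dist_eq] using h _ this.1 _ this.2
  refine ⟨hac, ?_⟩
  have hb : MemLp (fun s ↦ K * ∑ i, |deriv (w i) s|) 2 (volume.restrict (Icc a b)) := by
    have h1 : MemLp (fun s ↦ ∑ i, ‖deriv (w i) s‖) 2 (volume.restrict (Icc a b)) :=
      memLp_finsetSum Finset.univ fun i _ ↦ (hw i).memLp.norm
    exact h1.const_mul K
  refine hb.mono (stronglyMeasurable_deriv F).aestronglyMeasurable ?_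
  have hFd : ∀ᵐ s ∂(volume.restrict (Icc a b)), DifferentiableAt ℝ F s := by
    rw [ae_restrict_iff' measurableSet_Icc]
    have := hac.boundedVariationOn.ae_differentiableAt_of_mem_uIcc
    rwa [uIcc_of_le hab] at this
  filter_upwards [ae_restrict_Icc_mem_Ioo a b, hFd,
    ae_all_iff.2 fun i ↦ (hw i).ae_differentiableAt hab] with s hs hF hws
  -- Where everything is differentiable, the domination passes from difference quotients to
  -- derivatives.
  refine (?_ : ‖deriv F s‖ ≤ K * ∑ i, |deriv (w i) s|).trans (le_abs_self _)
  have l1 : Tendsto (fun t ↦ |slope F s t|) (𝓝[≠] s) (𝓝 |deriv F s|) :=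
    (hasDerivAt_iff_tendsto_slope.1 hF.hasDerivAt).abs
  have l2 : Tendsto (fun t ↦ K * ∑ i, |slope (w i) s t|) (𝓝[≠] s)
      (𝓝 (K * ∑ i, |deriv (w i) s|)) :=
    (tendsto_finsetSum _ fun i _ ↦
      (hasDerivAt_iff_tendsto_slope.1 (hws i).hasDerivAt).abs).const_mul K
  refine le_of_tendsto_of_tendsto l1 l2 ?_
  filter_upwards [mem_nhdsWithin_of_mem_nhds (isOpen_Ioo.mem_nhds hs)] with t ht
  have := h t (Ioo_subset_Icc_self ht) s (Ioo_subset_Icc_self hs)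
  simp only [slope_def_field, abs_div, ← Finset.sum_div, ← mul_div_assoc]
  gcongr

/-- On [k, k+1) the fractional part is a translation; the condition `F 0 = F 1` is what makes the
formula hold at the right endpoint too, so the translated copies can be glued. -/
theorem H1On.comp_fract (hF : H1On F 0 1) (h01 : F 0 = F 1) (a b : ℝ) :
    H1On (fun s ↦ F (Int.fract s)) a b := by
  have hk : ∀ k : ℤ, H1On (fun s ↦ F (Int.fract s)) k (k + 1) := by
    intro k
    have h1 : H1On (fun s ↦ F (-k + 1 * s)) k (k + 1) :=
      H1On.comp_affine (by linarith) one_pos (by convert hF using 1 <;> ring)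
    refine h1.congr (by linarith) fun s hs ↦ ?_
    rcases eq_or_lt_of_le hs.2 with h | h
    · have : Int.fract s = 0 := by
        rw [h, show (k : ℝ) + 1 = ((k + 1 : ℤ) : ℝ) by push_cast; ring, Int.fract_intCast]
      rw [this, h01, h]
      congr 1; ring
    · have : Int.fract s = -k + 1 * s := by
        rw [Int.fract, Int.floor_eq_iff.2 ⟨hs.1, h⟩]; ring
      simp only [this]
  have hN : ∀ (k : ℤ) (m : ℕ), H1On (fun s ↦ F (Int.fract s)) k (k + (m + 1)) := by
    intro k m
    induction m with
    | zero => simpa using hk k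
    | succ m ih =>
      refine ih.glue (by linarith [(Nat.cast_nonneg m : (0 : ℝ) ≤ m)]) (by push_cast; linarith) ?_
      have := hk (k + (m + 1))
      push_cast at this ⊢
      convert this using 1
      ring
  have key : ∀ a b : ℝ, a ≤ b → H1On (fun s ↦ F (Int.fract s)) a b := by
    intro a b hab
    obtain ⟨m, hm⟩ := exists_nat_ge (b - a)
    refine (hN ⌊a⌋ (m + 1)).mono (Int.floor_le a) hab ?_
    push_cast
    linarith [Int.lt_floor_add_one a]
  rcases le_total a b with hab | hab
  · exact key a b hab
  · refine ⟨(key b a hab).ac.symm, ?_⟩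
    rcases eq_or_lt_of_le hab with rfl | hlt
    · exact (key _ _ le_rfl).memLp
    · simp [Icc_eq_empty_of_lt hlt]

/-- The Sobolev inequality `‖F‖_∞ ≤ ‖F‖₂ + ‖F'‖₂` on `[0, 1]`. -/
theorem H1On.enorm_le (hF : H1On F 0 1) {t : ℝ} (ht : t ∈ Icc (0 : ℝ) 1) :
    ‖F t‖ₑ ≤ eLpNorm F 2 (volume.restrict (Icc 0 1)) +
      eLpNorm (deriv F) 2 (volume.restrict (Icc 0 1)) := by
  set μ := (volume : Measure ℝ).restrict (Icc 0 1) with hμ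
  have : IsProbabilityMeasure μ := ⟨by simp [hμ]⟩
  have hFm : AEStronglyMeasurable F μ :=
    (hF.continuousOn zero_le_one).aestronglyMeasurable measurableSet_Icc
  -- This compares the value at t with the value at any s; averaging over s then gives the
  -- inequality.
  have hpt : ∀ s ∈ Icc (0 : ℝ) 1, ‖F t‖ₑ ≤ ‖F s‖ₑ + eLpNorm (deriv F) 2 μ := by
    intro s hs
    have e : F t = F s + ∫ r in s..t, deriv F r := by rw [hF.integral_deriv hs ht]; ring
    rw [e]
    refine (enorm_add_le _ _).trans (add_le_add le_rfl ?_)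
    calc ‖∫ r in s..t, deriv F r‖ₑ = ‖∫ r in uIoc s t, deriv F r‖ₑ := by
          rw [← ofReal_norm, ← ofReal_norm,
            intervalIntegral.norm_intervalIntegral_eq]
      _ ≤ ∫⁻ r in uIoc s t, ‖deriv F r‖ₑ := enorm_integral_le_lintegral_enorm _
      _ ≤ ∫⁻ r, ‖deriv F r‖ₑ ∂μ :=
          lintegral_mono_set (uIoc_subset_uIcc.trans (uIcc_subset_Icc hs ht))
      _ = eLpNorm (deriv F) 1 μ := by rw [eLpNorm_one_eq_lintegral_enorm]
      _ ≤ eLpNorm (deriv F) 2 μ :=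
          eLpNorm_le_eLpNorm_of_exponent_le (by norm_num) hF.memLp.1
  calc ‖F t‖ₑ = ∫⁻ _, ‖F t‖ₑ ∂μ := by simp
    _ ≤ ∫⁻ s, (‖F s‖ₑ + eLpNorm (deriv F) 2 μ) ∂μ := by
        refine lintegral_mono_ae ?_
        filter_upwards [ae_restrict_mem (measurableSet_Icc (a := (0 : ℝ)) (b := 1))] with s hs
        exact hpt s hs
    _ = eLpNorm F 1 μ + eLpNorm (deriv F) 2 μ := by
        rw [lintegral_add_right _ measurable_const, eLpNorm_one_eq_lintegral_enorm]
        simp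
    _ ≤ _ := add_le_add (eLpNorm_le_eLpNorm_of_exponent_le (by norm_num) hFm) le_rfl

theorem lintegral_periodic {f : ℝ → ENNReal} (hf : Function.Periodic f 1) (a : ℝ) :
    ∫⁻ s in Ioc a (a + 1), f s = ∫⁻ s in Ioc (0 : ℝ) 1, f s := by
  have h1 := isAddFundamentalDomain_Ioc (one_pos : (0 : ℝ) < 1) a
  have h2 := isAddFundamentalDomain_Ioc (one_pos : (0 : ℝ) < 1) 0
  rw [zero_add] at h2
  refine h1.setLIntegral_eq h2 f fun g x ↦ ?_
  exact hf.map_vadd_zmultiples g x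

theorem eLpNorm_comp_add_of_periodic {D : ℝ → ℝ} (hD : Function.Periodic D 1) (σ : ℝ) :
    eLpNorm (fun s ↦ D (σ + s)) 2 (volume.restrict (Icc 0 1)) =
      eLpNorm D 2 (volume.restrict (Icc 0 1)) := by
  rw [← Measure.restrict_congr_set (Ioc_ae_eq_Icc (μ := volume) (a := (0 : ℝ)) (b := 1))]
  rw [eLpNorm_eq_lintegral_rpow_enorm_toReal (by norm_num) (by norm_num),
    eLpNorm_eq_lintegral_rpow_enorm_toReal (by norm_num) (by norm_num)]
  congr 1
  set f : ℝ → ENNReal := fun s ↦ ‖D s‖ₑ ^ (2 : ENNReal).toReal with hf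
  have hfp : Function.Periodic f 1 := fun s ↦ by simp only [hf, hD s]
  have e := lintegral_periodic hfp σ
  rw [← e]
  have hmp := (measurePreserving_add_left (volume : Measure ℝ) σ).setLIntegral_comp_preimage_emb
    (measurableEmbedding_addLeft σ) f (Ioc σ (σ + 1))
  rw [← hmp]
  congr 2
  ext s; simp

end RealSobolev

/-! ### Uniform estimates for 1-periodic functions. -/

section PeriodicFunctions

theorem exists_modulus_of_periodic {X : Type*} [PseudoMetricSpace X] {F : ℝ → X}
    (hF : Continuous F) (hp : Function.Periodic F 1) {ε : ℝ} (hε : 0 < ε) :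
    ∃ δ > 0, ∀ s t : ℝ, |s - t| < δ → dist (F s) (F t) < ε := by
  have hu : UniformContinuousOn F (Icc (-1 : ℝ) 2) :=
    isCompact_Icc.uniformContinuousOn_of_continuous hF.continuousOn
  obtain ⟨δ, hδ, h⟩ := Metric.uniformContinuousOn_iff.1 hu ε hε
  refine ⟨min δ 1, by positivity, fun s t hst ↦ ?_⟩
  have h1 := lt_of_lt_of_le hst (min_le_left _ _)
  have h2 := abs_lt.1 (lt_of_lt_of_le hst (min_le_right _ _))
  have e : ∀ r, F r = F (r - ⌊s⌋) := fun r ↦ by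
    have := hp.sub_zsmul_eq (x := r) ⌊s⌋
    simpa using this.symm
  rw [e s, e t]
  have f1 := Int.floor_le s
  have f2 := Int.lt_floor_add_one s
  refine h _ ⟨by linarith, by linarith⟩ _ ⟨by linarith, by linarith⟩ ?_
  rw [Real.dist_eq, sub_sub_sub_cancel_right]
  exact h1

theorem exists_bound_of_periodic {X : Type*} [SeminormedAddCommGroup X] {F : ℝ → X}
    (hF : Continuous F) (hp : Function.Periodic F 1) : ∃ K, ∀ s, ‖F s‖ ≤ K := by
  obtain ⟨K, hK⟩ := (isCompact_Icc (a := (0 : ℝ)) (b := 1)).exists_bound_of_continuousOn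
    hF.continuousOn
  refine ⟨K, fun s ↦ ?_⟩
  have : F s = F (Int.fract s) := by
    have := hp.sub_zsmul_eq (x := s) ⌊s⌋
    rw [Int.fract, ← this, zsmul_one]
  rw [this]
  exact hK _ ⟨Int.fract_nonneg s, (Int.fract_lt_one s).le⟩

theorem periodic_deriv {E : Type*} [NormedAddCommGroup E] [NormedSpace ℝ E] {F : ℝ → E}
    (hp : Function.Periodic F 1) : Function.Periodic (deriv F) 1 := by
  intro s
  have h : (fun t ↦ F (t + 1)) = F := funext hp
  have := deriv_comp_add_const F 1 s
  rw [← this, h]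

theorem eLpNorm_le_of_bound {D : ℝ → ℝ} {C : ℝ} (h : ∀ s ∈ Icc (0 : ℝ) 1, |D s| ≤ C) :
    eLpNorm D 2 (volume.restrict (Icc (0 : ℝ) 1)) ≤ ENNReal.ofReal C := by
  have := eLpNorm_le_of_ae_bound (p := 2) (μ := volume.restrict (Icc (0 : ℝ) 1)) (f := D) (C := C)
    ((ae_restrict_iff' measurableSet_Icc).2 (Eventually.of_forall h))
  simpa using this

/-- Rescaling part of a period to the whole unit interval. -/
theorem eLpNorm_comp_affine_le {g : ℝ → ℝ} (hp : Function.Periodic g 1) {ℓ : ℝ} (hℓ : 0 < ℓ)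
    (hℓ1 : ℓ ≤ 1) (a : ℝ) :
    eLpNorm (fun s ↦ ℓ * g (a + ℓ * s)) 2 (volume.restrict (Icc (0 : ℝ) 1)) ≤
      eLpNorm g 2 (volume.restrict (Icc (0 : ℝ) 1)) := by
  rw [← Measure.restrict_congr_set (Ioc_ae_eq_Icc (μ := volume) (a := (0 : ℝ)) (b := 1))]
  rw [eLpNorm_eq_lintegral_rpow_enorm_toReal (by norm_num) (by norm_num),
    eLpNorm_eq_lintegral_rpow_enorm_toReal (by norm_num) (by norm_num)]
  refine ENNReal.rpow_le_rpow ?_ (by norm_num)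
  set f : ℝ → ENNReal := fun s ↦ ‖g s‖ₑ ^ (2 : ENNReal).toReal with hf
  have hfp : Function.Periodic f 1 := fun s ↦ by simp only [hf, hp s]
  have e1 : ∫⁻ s in Ioc (0 : ℝ) 1, f (a + ℓ * s) =
      ENNReal.ofReal ℓ⁻¹ * ∫⁻ s in Ioc a (a + ℓ), f s := by
    have hemb : MeasurableEmbedding (fun s : ℝ ↦ ℓ * s) :=
      (Homeomorph.mulLeft₀ ℓ hℓ.ne').measurableEmbedding
    have h1 := hemb.lintegral_map (μ := volume.restrict (Ioc (0 : ℝ) 1)) (fun s ↦ f (a + s))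
    have hpre : (fun s : ℝ ↦ ℓ * s) ⁻¹' Ioc 0 ℓ = Ioc 0 1 := by
      ext s
      simp only [mem_preimage, mem_Ioc]
      constructor
      · rintro ⟨h1, h2⟩; exact ⟨by nlinarith, by nlinarith⟩
      · rintro ⟨h1, h2⟩; exact ⟨by positivity, by nlinarith⟩
    rw [← hpre, ← hemb.restrict_map, Real.map_volume_mul_left hℓ.ne', Measure.restrict_smul,
      lintegral_smul_measure, hpre, abs_of_pos (inv_pos.2 hℓ)] at h1
    rw [← h1, smul_eq_mul]
    congr 1
    have hmp := (measurePreserving_add_left (volume : Measure ℝ) a).setLIntegral_comp_preimage_emb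
      (measurableEmbedding_addLeft a) f (Ioc a (a + ℓ))
    rw [← hmp]
    congr 2
    ext s; simp
  have e2 : ∫⁻ s in Ioc a (a + ℓ), f s ≤ ∫⁻ s in Ioc (0 : ℝ) 1, f s := by
    rw [← lintegral_periodic hfp a]
    exact lintegral_mono_set (Ioc_subset_Ioc le_rfl (by linarith))
  -- The factor ℓ² against the Jacobian 1/ℓ leaves a factor ℓ ≤ 1, and an interval of length ℓ ≤ 1
  -- is contained in one period.
  calc ∫⁻ s in Ioc (0 : ℝ) 1, ‖ℓ * g (a + ℓ * s)‖ₑ ^ (2 : ENNReal).toReal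
      = ∫⁻ s in Ioc (0 : ℝ) 1, ENNReal.ofReal (ℓ ^ 2) * f (a + ℓ * s) := by
        refine lintegral_congr fun s ↦ ?_
        simp only [hf]
        rw [enorm_mul, ENNReal.mul_rpow_of_nonneg _ _ (by norm_num), Real.enorm_eq_ofReal hℓ.le,
          ENNReal.ofReal_rpow_of_pos hℓ]
        norm_num
    _ = ENNReal.ofReal (ℓ ^ 2) * (ENNReal.ofReal ℓ⁻¹ * ∫⁻ s in Ioc a (a + ℓ), f s) := by
        rw [lintegral_const_mul' _ _ ENNReal.ofReal_ne_top, e1]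
    _ = ENNReal.ofReal ℓ * ∫⁻ s in Ioc a (a + ℓ), f s := by
        rw [← mul_assoc, ← ENNReal.ofReal_mul (by positivity)]
        congr 2
        field_simp
    _ ≤ 1 * ∫⁻ s in Ioc (0 : ℝ) 1, f s :=
        mul_le_mul' (by simpa using ENNReal.ofReal_le_ofReal hℓ1) e2
    _ = _ := one_mul _

end PeriodicFunctions

/-! ### Shifting, cutting and convergence in the loop space. -/

section LoopSpace

variable {M : Type*} [TopologicalSpace M] [ChartedSpace Plane M]

theorem H1Loop.ext {x y : H1Loop M} (h : ∀ s, x s = y s) : x = y := by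
  cases x; cases y
  congr
  exact funext h

theorem H1Loop.h1On (x : H1Loop M) (f : SmoothFun M) (a b : ℝ) : H1On (fun s ↦ f (x s)) a b :=
  ⟨x.absCont' f a b, x.memLp_deriv' f a b⟩

theorem H1Loop.periodic_comp (x : H1Loop M) (f : SmoothFun M) :
    Function.Periodic (fun s ↦ f (x s)) 1 := fun s ↦ by simp only [x.periodic' s]

theorem H1Loop.map_add_int (x : H1Loop M) (s : ℝ) (k : ℤ) : x (s + k) = x s := by
  simpa using x.periodic'.int_mul k s

theorem H1Loop.map_fract (x : H1Loop M) (s : ℝ) : x (Int.fract s) = x s := by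
  rw [← x.map_add_int (Int.fract s) ⌊s⌋, Int.fract_add_floor]

/-- A loop from its restrictions to intervals. -/
def H1Loop.ofH1On (w : ℝ → M) (hp : Function.Periodic w 1)
    (hw : ∀ (f : SmoothFun M) (a b : ℝ), a ≤ b → H1On (fun s ↦ f (w s)) a b) : H1Loop M where
  toFun := w
  periodic' := hp
  absCont' f a b := (le_total a b).elim (fun h ↦ (hw f a b h).ac) fun h ↦ (hw f b a h).ac.symm
  memLp_deriv' f a b := by
    rcases le_or_gt a b with h | h
    · exact (hw f a b h).memLp
    · simp [Icc_eq_empty_of_lt h]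

/-- The loop that closes up a path parametrized by `[0, 1]`. -/
def H1Loop.ofPath (w : ℝ → M) (h01 : w 0 = w 1)
    (hw : ∀ f : SmoothFun M, H1On (fun s ↦ f (w s)) 0 1) : H1Loop M :=
  H1Loop.ofH1On (fun s ↦ w (Int.fract s)) (fun s ↦ by simp only [Int.fract_add_one])
    fun f a b _ ↦ (hw f).comp_fract (by simp only [h01]) a b

theorem H1Loop.ofPath_apply {w : ℝ → M} {h01 : w 0 = w 1}
    {hw : ∀ f : SmoothFun M, H1On (fun s ↦ f (w s)) 0 1} {s : ℝ} (hs : s ∈ Icc (0 : ℝ) 1) :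
    H1Loop.ofPath w h01 hw s = w s := by
  change w (Int.fract s) = w s
  rcases eq_or_lt_of_le hs.2 with h | h
  · rw [h, Int.fract_one, h01]
  · rw [Int.fract_eq_self.2 ⟨hs.1, h⟩]

/-- The time shift `s ↦ x(σ + s)` of a loop. -/
def H1Loop.shift (x : H1Loop M) (σ : ℝ) : H1Loop M :=
  H1Loop.ofH1On (fun s ↦ x (σ + s)) (fun s ↦ by simp only [← add_assoc, x.periodic' (σ + s)])
    fun f a b hab ↦ by
      have := H1On.comp_affine (c := 1) (d := σ) hab one_pos
        (x.h1On f (σ + 1 * a) (σ + 1 * b))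
      simpa using this

@[simp] theorem H1Loop.shift_apply (x : H1Loop M) (σ s : ℝ) : x.shift σ s = x (σ + s) := rfl

@[simp] theorem H1Loop.iterate_apply (x : H1Loop M) (n : ℕ) (hn : 1 ≤ n) (s : ℝ) :
    x.iterate n hn s = x (n * s) := rfl

/-- The loop cut out of `y` between the times `a` and `a + ℓ`. -/
def H1Loop.piece (y : H1Loop M) (a ℓ : ℝ) (hℓ : 0 < ℓ) (h : y a = y (a + ℓ)) : H1Loop M :=
  H1Loop.ofPath (fun s ↦ y (a + ℓ * s)) (by simpa using h)
    fun f ↦ H1On.comp_affine zero_le_one hℓ (y.h1On f _ _)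

theorem H1Loop.piece_apply {y : H1Loop M} {a ℓ : ℝ} {hℓ : 0 < ℓ} {h : y a = y (a + ℓ)} {s : ℝ}
    (hs : s ∈ Icc (0 : ℝ) 1) : y.piece a ℓ hℓ h s = y (a + ℓ * s) :=
  H1Loop.ofPath_apply hs

/-- Convergence of loops. -/
theorem tendsto_loop_iff {ι : Type*} {l : Filter ι} {y : ι → H1Loop M} {x : H1Loop M} :
    Tendsto y l (𝓝 x) ↔ ∀ f : SmoothFun M,
      Tendsto (fun i ↦ eLpNorm (fun s ↦ f (y i s) - f (x s)) 2 (volume.restrict (Icc 0 1))) l (𝓝 0) ∧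
      Tendsto (fun i ↦ eLpNorm (fun s ↦ deriv (fun s ↦ f (y i s)) s - deriv (fun s ↦ f (x s)) s) 2
        (volume.restrict (Icc 0 1))) l (𝓝 0) := by
  rw [nhds_iInf, tendsto_iInf]
  refine forall_congr' fun f ↦ ?_
  rw [nhds_induced, tendsto_comap_iff, nhds_prod_eq, tendsto_prod_iff']
  refine and_congr ?_ ?_
  · exact Lp.tendsto_Lp_iff_tendsto_eLpNorm'' (fun i s ↦ f (y i s)) (fun i ↦ (y i).memLp f)
      (fun s ↦ f (x s)) (x.memLp f)
  · exact Lp.tendsto_Lp_iff_tendsto_eLpNorm'' (fun i ↦ deriv fun s ↦ f (y i s))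
      (fun i ↦ (y i).memLp_deriv' f 0 1) (deriv fun s ↦ f (x s)) (x.memLp_deriv' f 0 1)

/-- The Sobolev inequality `H1On.enorm_le`, applied to the difference of the two compositions, turns
H¹ convergence into uniform convergence. -/
theorem eventually_uniform_close {ι : Type*} {l : Filter ι} {y : ι → H1Loop M} {x : H1Loop M}
    (h : Tendsto y l (𝓝 x)) (f : SmoothFun M) {ε : ℝ} (hε : 0 < ε) :
    ∀ᶠ i in l, ∀ s, |f (y i s) - f (x s)| ≤ ε := by
  obtain ⟨h1, h2⟩ := tendsto_loop_iff.1 h f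
  have h3 := h1.add h2
  rw [add_zero] at h3
  filter_upwards [ENNReal.tendsto_nhds_zero.1 h3 (ENNReal.ofReal ε) (by simpa using hε)] with i hi s
  have hd : H1On (fun s ↦ f (y i s) - f (x s)) 0 1 := by
    refine H1On.of_dominated (ι := Bool) zero_le_one
      (w := fun b ↦ bif b then fun s ↦ f (y i s) else fun s ↦ f (x s)) (K := 1) ?_ ?_
    · rintro (_ | _)
      · exact x.h1On f 0 1
      · exact (y i).h1On f 0 1
    · intro s _ t _
      simp only [Fintype.univ_bool, Finset.mem_singleton, Bool.true_eq_false, not_false_eq_true,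
        Finset.sum_insert, cond_true, Finset.sum_singleton, cond_false, one_mul]
      calc |f (y i s) - f (x s) - (f (y i t) - f (x t))|
          = |(f (y i s) - f (y i t)) - (f (x s) - f (x t))| := by congr 1; ring
        _ ≤ _ := abs_sub _ _
  have e : (fun s ↦ deriv (fun s ↦ f (y i s)) s - deriv (fun s ↦ f (x s)) s)
      =ᵐ[volume.restrict (Icc 0 1)] deriv fun s ↦ f (y i s) - f (x s) := by
    filter_upwards [((y i).h1On f 0 1).ae_differentiableAt zero_le_one,
      (x.h1On f 0 1).ae_differentiableAt zero_le_one] with s hs1 hs2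
    exact (deriv_fun_sub hs1 hs2).symm
  rw [eLpNorm_congr_ae e] at hi
  have := (hd.enorm_le (t := Int.fract s) ⟨Int.fract_nonneg s, (Int.fract_lt_one s).le⟩).trans hi
  simp only [H1Loop.map_fract] at this
  rw [Real.enorm_eq_ofReal_abs] at this
  exact (ENNReal.ofReal_le_ofReal_iff hε.le).1 this

theorem tendsto_shift {ι : Type*} {l : Filter ι} {y : ι → H1Loop M} {x : H1Loop M}
    (h : Tendsto y l (𝓝 x)) (σ : ℝ) : Tendsto (fun i ↦ (y i).shift σ) l (𝓝 (x.shift σ)) := by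
  rw [tendsto_loop_iff] at h ⊢
  intro f
  obtain ⟨h1, h2⟩ := h f
  constructor
  · refine h1.congr fun i ↦ ?_
    exact (eLpNorm_comp_add_of_periodic (D := fun s ↦ f (y i s) - f (x s))
      (fun s ↦ by simp only [(y i).periodic' s, x.periodic' s]) σ).symm
  · refine h2.congr fun i ↦ ?_
    have := eLpNorm_comp_add_of_periodic
      (D := fun s ↦ deriv (fun s ↦ f (y i s)) s - deriv (fun s ↦ f (x s)) s)
      (fun s ↦ by
        have e1 := periodic_deriv ((y i).periodic_comp f) s
        have e2 := periodic_deriv (x.periodic_comp f) s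
        simp only [e1, e2]) σ
    rw [← this]
    congr 1
    ext s
    simp only [H1Loop.shift_apply]
    rw [deriv_comp_const_add (fun s ↦ f (y i s)) σ s, deriv_comp_const_add (fun s ↦ f (x s)) σ s]

/-- A piece of a loop near `xⁿ` of length about `k / n` is, up to a shift, near `xᵏ`. -/
theorem tendsto_shift_piece {ι : Type*} {l : Filter ι} {x : H1Loop M}
    (hx : ∀ f : SmoothFun M, ContDiff ℝ 1 fun s ↦ f (x s)) {n k : ℕ} (hn : 1 ≤ n) (hk : 1 ≤ k)
    {y : ι → H1Loop M} (hy : Tendsto y l (𝓝 (x.iterate n hn))) {a ℓ : ι → ℝ} (hℓ : ∀ i, 0 < ℓ i)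
    (hℓ1 : ∀ i, ℓ i ≤ 1) (hc : ∀ i, y i (a i) = y i (a i + ℓ i))
    (hlim : Tendsto (fun i ↦ n * ℓ i) l (𝓝 (k : ℝ))) :
    Tendsto (fun i ↦ ((y i).piece (a i) (ℓ i) (hℓ i) (hc i)).shift (-(n * a i) / k)) l
      (𝓝 (x.iterate k hk)) := by
  rw [tendsto_loop_iff]
  intro f
  set F : ℝ → ℝ := fun s ↦ f (x s) with hF
  have hFp : Function.Periodic F 1 := x.periodic_comp f
  have hFk : ∀ s (m : ℕ), F (s + m) = F s := fun s m ↦ by simpa using hFp.nat_mul m s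
  have hFc : Continuous F := (hx f).continuous
  have hF'c : Continuous (deriv F) := (hx f).continuous_deriv le_rfl
  have hF'p := periodic_deriv hFp
  have hF'k : ∀ s (m : ℕ), deriv F (s + m) = deriv F s := fun s m ↦ by simpa using hF'p.nat_mul m s
  have hk0 : (0 : ℝ) < k := by exact_mod_cast hk
  set z : ι → H1Loop M := fun i ↦ (y i).piece (a i) (ℓ i) (hℓ i) (hc i) with hz
  have hzs : ∀ i s, s ∈ Icc (0 : ℝ) 1 → z i s = y i (a i + ℓ i * s) := fun i s hs ↦
    H1Loop.piece_apply hs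
  -- The shift matches phases: undoing it reduces the claim to comparing the unshifted piece at s
  -- with x(ks + na), the value of x at which the piece nearly starts when s = 0.
  have hsc : ∀ i s, (k : ℝ) * s = k * (-(n * a i) / k + s) + n * a i := by
    intro i s; field_simp; ring
  constructor
  · rw [ENNReal.tendsto_nhds_zero]
    intro ε hε
    obtain ⟨ε', hε', hεε⟩ : ∃ ε' : ℝ, 0 < ε' ∧ ENNReal.ofReal (ε' + ε') ≤ ε := by
      rcases eq_or_ne ε ⊤ with rfl | htop
      · exact ⟨1, one_pos, le_top⟩
      · refine ⟨ε.toReal / 2, half_pos (ENNReal.toReal_pos hε.ne' htop), ?_⟩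
        rw [add_halves, ENNReal.ofReal_toReal htop]
    obtain ⟨δ, hδ, hmod⟩ := exists_modulus_of_periodic hFc hFp hε'
    have hclose := eventually_uniform_close hy f hε'
    have hev := hlim.eventually (Metric.ball_mem_nhds _ hδ)
    filter_upwards [hclose, hev] with i hi hi2
    rw [Real.dist_eq] at hi2
    refine le_trans ?_ hεε
    have e := eLpNorm_comp_add_of_periodic (D := fun s ↦ f (z i s) - F (k * s + n * a i))
      (fun s ↦ by
        have : k * (s + 1) + n * a i = (k * s + n * a i) + (k : ℕ) := by ring
        simp only [(z i).periodic' s, this, hFk]) (-(n * a i) / k)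
    simp only [← hsc] at e
    refine (le_of_eq e).trans (eLpNorm_le_of_bound fun s hs ↦ ?_)
    rw [hzs i s hs]
    have h1 := hi (a i + ℓ i * s)
    have h2 := hmod (n * (a i + ℓ i * s)) (k * s + n * a i) (by
      rw [show n * (a i + ℓ i * s) - (k * s + n * a i) = (n * ℓ i - k) * s by ring, abs_mul,
        abs_of_nonneg hs.1]
      exact lt_of_le_of_lt (mul_le_of_le_one_right (abs_nonneg _) hs.2) hi2)
    rw [Real.dist_eq] at h2
    exact (abs_sub_le _ _ _).trans (add_le_add h1 h2.le)
  · rw [ENNReal.tendsto_nhds_zero]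
    intro ε hε
    obtain ⟨K, hK⟩ := exists_bound_of_periodic hF'c hF'p
    have hK0 : 0 ≤ K := (norm_nonneg _).trans (hK 0)
    -- The three terms bound, in order, the L² distance of the derivatives of y and xⁿ, the error nℓ
    -- - k times the bound K for F', and k times the oscillation of F'.
    obtain ⟨ε', hε', hεε⟩ : ∃ ε' : ℝ, 0 < ε' ∧ ENNReal.ofReal ε' + ENNReal.ofReal
        (ε' * K + k * ε') ≤ ε := by
      rcases eq_or_ne ε ⊤ with rfl | htop
      · exact ⟨1, one_pos, le_top⟩
      · have hpos := ENNReal.toReal_pos hε.ne' htop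
        refine ⟨ε.toReal / (1 + K + k), by positivity, ?_⟩
        rw [← ENNReal.ofReal_add (by positivity) (by positivity)]
        refine le_of_eq ?_
        conv_rhs => rw [← ENNReal.ofReal_toReal htop]
        congr 1
        field_simp
        ring
    obtain ⟨δ, hδ, hmod⟩ := exists_modulus_of_periodic hF'c hF'p hε'
    have hclose := ENNReal.tendsto_nhds_zero.1 (tendsto_loop_iff.1 hy f).2 (ENNReal.ofReal ε')
      (by simpa using hε')
    have hev := hlim.eventually (Metric.ball_mem_nhds _ hδ)
    have hev2 := hlim.eventually (Metric.ball_mem_nhds _ hε')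
    filter_upwards [hclose, hev, hev2] with i hi hi2 hi3
    rw [Real.dist_eq] at hi2 hi3
    refine le_trans ?_ hεε
    set Y : ℝ → ℝ := fun s ↦ f (y i s) with hY
    set g : ℝ → ℝ := fun s ↦ deriv Y s - n * deriv F (n * s) with hg
    have hgp : Function.Periodic g 1 := fun s ↦ by
      have e1 : deriv Y (s + 1) = deriv Y s := periodic_deriv ((y i).periodic_comp f) s
      have : (n : ℝ) * (s + 1) = n * s + (n : ℕ) := by ring
      simp only [hg, e1, this, hF'k]
    have hgle : eLpNorm g 2 (volume.restrict (Icc (0 : ℝ) 1)) ≤ ENNReal.ofReal ε' := by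
      refine (le_of_eq ?_).trans hi
      congr 1
      ext s
      simp only [hg, H1Loop.iterate_apply]
      congr 1
      exact (deriv_comp_mul_left (n : ℝ) F s).symm
    have e := eLpNorm_comp_add_of_periodic
      (D := fun s ↦ deriv (fun s ↦ f (z i s)) s - k * deriv F (k * s + n * a i))
      (fun s ↦ by
        have e1 := periodic_deriv ((z i).periodic_comp f) s
        have : k * (s + 1) + n * a i = (k * s + n * a i) + (k : ℕ) := by ring
        simp only [e1, this, hF'k]) (-(n * a i) / k)
    simp only [← hsc] at e
    have e' : eLpNorm (fun s ↦ deriv (fun s ↦ f ((z i).shift (-(n * a i) / k) s)) s -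
        deriv (fun s ↦ f (x.iterate k hk s)) s) 2 (volume.restrict (Icc (0 : ℝ) 1)) =
        eLpNorm (fun s ↦ deriv (fun s ↦ f (z i s)) s - k * deriv F (k * s + n * a i)) 2
          (volume.restrict (Icc (0 : ℝ) 1)) := by
      rw [← e]
      congr 1
      ext s
      simp only [H1Loop.shift_apply, H1Loop.iterate_apply]
      rw [deriv_comp_const_add (fun s ↦ f (z i s)) (-(n * a i) / k) s]
      congr 1
      exact deriv_comp_mul_left (k : ℝ) F s
    -- Only the first summand sees y, and it is a rescaled L² error; the second involves the C¹
    -- function F alone and is small uniformly.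
    have e'' : (fun s ↦ deriv (fun s ↦ f (z i s)) s - k * deriv F (k * s + n * a i))
        =ᵐ[volume.restrict (Icc (0 : ℝ) 1)] (fun s ↦ ℓ i * g (a i + ℓ i * s)) +
          fun s ↦ n * ℓ i * deriv F (n * (a i + ℓ i * s)) - k * deriv F (k * s + n * a i) := by
      filter_upwards [deriv_ae_eq_of_eqOn (F := fun s ↦ f (z i s))
        (G := fun s ↦ Y (a i + ℓ i * s)) (fun s hs ↦ by simp only [hY, hzs i s hs])] with s hs
      have hd : deriv (fun s ↦ Y (a i + ℓ i * s)) s = ℓ i * deriv Y (a i + ℓ i * s) := by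
        have := deriv_comp_mul_left (ℓ i) (fun s ↦ Y (a i + s)) s
        rw [smul_eq_mul, deriv_comp_const_add] at this
        exact this
      rw [hs, hd]
      simp only [Pi.add_apply, hg]
      ring
    have hgm : AEStronglyMeasurable (fun s ↦ ℓ i * g (a i + ℓ i * s))
        (volume.restrict (Icc (0 : ℝ) 1)) := by
      have : Measurable g :=
        (measurable_deriv Y).sub (measurable_const.mul
          ((measurable_deriv F).comp (measurable_const.mul measurable_id)))
      exact (measurable_const.mul (this.comp
        (measurable_const.add (measurable_const.mul measurable_id)))).aestronglyMeasurable
    have hsm : Continuous fun s : ℝ ↦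
        n * ℓ i * deriv F (n * (a i + ℓ i * s)) - k * deriv F (k * s + n * a i) := by
      have h1 : Continuous fun s : ℝ ↦ deriv F (n * (a i + ℓ i * s)) := hF'c.comp (by fun_prop)
      have h2 : Continuous fun s : ℝ ↦ deriv F (k * s + n * a i) := hF'c.comp (by fun_prop)
      fun_prop
    refine (le_of_eq (e'.trans (eLpNorm_congr_ae e''))).trans
      ((eLpNorm_add_le hgm hsm.aestronglyMeasurable (by norm_num)).trans (add_le_add ?_ ?_))
    · exact (eLpNorm_comp_affine_le hgp (hℓ i) (hℓ1 i) (a i)).trans hgle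
    · refine eLpNorm_le_of_bound fun s hs ↦ ?_
      have h2 := hmod (n * (a i + ℓ i * s)) (k * s + n * a i) (by
        rw [show n * (a i + ℓ i * s) - (k * s + n * a i) = (n * ℓ i - k) * s by ring, abs_mul,
          abs_of_nonneg hs.1]
        exact lt_of_le_of_lt (mul_le_of_le_one_right (abs_nonneg _) hs.2) hi2)
      rw [Real.dist_eq] at h2
      have h3 := hK (n * (a i + ℓ i * s))
      rw [Real.norm_eq_abs] at h3
      calc |n * ℓ i * deriv F (n * (a i + ℓ i * s)) - k * deriv F (k * s + n * a i)|
          = |(n * ℓ i - k) * deriv F (n * (a i + ℓ i * s)) +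
            k * (deriv F (n * (a i + ℓ i * s)) - deriv F (k * s + n * a i))| := by
            congr 1; ring
        _ ≤ |n * ℓ i - k| * |deriv F (n * (a i + ℓ i * s))| +
            k * |deriv F (n * (a i + ℓ i * s)) - deriv F (k * s + n * a i)| := by
            refine (abs_add_le _ _).trans ?_
            rw [abs_mul, abs_mul, Nat.abs_cast]
        _ ≤ ε' * K + k * ε' := by gcongr

end LoopSpace

/-! ### The Lagrangian in charts and under affine reparametrization. -/

section Charts

variable {M : Type*} [TopologicalSpace M] [ChartedSpace Plane M]

/-- No differentiability is needed: an invertible affine substitution preserves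
non-differentiability, and then both derivatives have the default value 0. -/
theorem mfderiv_comp_affine (w : ℝ → M) {ℓ : ℝ} (hℓ : ℓ ≠ 0) (a s : ℝ) :
    (mfderiv 𝓘(ℝ, ℝ) (𝓡 2) (fun r ↦ w (a + ℓ * r)) s (1 : ℝ) : Plane) =
      ℓ • (mfderiv 𝓘(ℝ, ℝ) (𝓡 2) w (a + ℓ * s) (1 : ℝ) : Plane) := by
  have haff : ∀ (b k r : ℝ), HasDerivAt (fun r : ℝ ↦ b + k * r) k r := fun b k r ↦ by
    simpa using ((hasDerivAt_id r).const_mul k).const_add b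
  by_cases hd : MDifferentiableAt 𝓘(ℝ, ℝ) (𝓡 2) w (a + ℓ * s)
  · have h1 : MDifferentiableAt 𝓘(ℝ, ℝ) 𝓘(ℝ, ℝ) (fun r : ℝ ↦ a + ℓ * r) s :=
      (haff a ℓ s).differentiableAt.mdifferentiableAt
    have h2 := mfderiv_comp_apply (I := 𝓘(ℝ, ℝ)) (I' := 𝓘(ℝ, ℝ)) (I'' := 𝓡 2) s hd h1 (1 : ℝ)
    have h3 : (mfderiv 𝓘(ℝ, ℝ) 𝓘(ℝ, ℝ) (fun r : ℝ ↦ a + ℓ * r) s (1 : ℝ) : ℝ) = ℓ • (1 : ℝ) := by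
      rw [mfderiv_eq_fderiv]
      have := (haff a ℓ s).deriv
      rw [smul_eq_mul, mul_one]
      exact this
    refine h2.trans ?_
    refine (congrArg (fun r : ℝ ↦ (mfderiv 𝓘(ℝ, ℝ) (𝓡 2) w (a + ℓ * s) : ℝ →L[ℝ] Plane) r)
      h3).trans ?_
    exact (mfderiv 𝓘(ℝ, ℝ) (𝓡 2) w (a + ℓ * s) : ℝ →L[ℝ] Plane).map_smul ℓ 1
  · have hd' : ¬ MDifferentiableAt 𝓘(ℝ, ℝ) (𝓡 2) (fun r ↦ w (a + ℓ * r)) s := by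
      intro h
      apply hd
      have h1 : MDifferentiableAt 𝓘(ℝ, ℝ) 𝓘(ℝ, ℝ) (fun r : ℝ ↦ -(ℓ⁻¹ * a) + ℓ⁻¹ * r)
          (a + ℓ * s) := (haff _ _ _).differentiableAt.mdifferentiableAt
      have e : -(ℓ⁻¹ * a) + ℓ⁻¹ * (a + ℓ * s) = s := by field_simp; ring
      have h2 := MDifferentiableAt.comp_of_eq (a + ℓ * s) h h1 e
      convert h2 using 1
      ext r
      simp only [Function.comp]
      congr 1
      field_simp; ring
    rw [mfderiv_zero_of_not_mdifferentiableAt hd, mfderiv_zero_of_not_mdifferentiableAt hd']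
    exact (smul_zero ℓ).symm

theorem mfderiv_chart {φ : OpenPartialHomeomorph M Plane}
    (hφ : φ ∈ IsManifold.maximalAtlas (𝓡 2) ∞ M) {w : ℝ → M} {u : ℝ → Plane} {v : Plane} {s : ℝ}
    (hw : w =ᶠ[𝓝 s] fun r ↦ φ.symm (u r)) (hu : u s ∈ φ.target) (hd : HasDerivAt u v s) :
    (mfderiv 𝓘(ℝ, ℝ) (𝓡 2) w s (1 : ℝ) : Plane) =
      (mfderiv (𝓡 2) (𝓡 2) φ.symm (u s) : Plane →L[ℝ] Plane) v := by
  have h1 : MDifferentiableAt (𝓡 2) (𝓡 2) φ.symm (u s) :=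
    ((contMDiffOn_symm_of_mem_maximalAtlas hφ).contMDiffAt
      (φ.open_target.mem_nhds hu)).mdifferentiableAt (by simp)
  have h2 : MDifferentiableAt 𝓘(ℝ, ℝ) (𝓡 2) u s := hd.differentiableAt.mdifferentiableAt
  have h3 := hw.mfderiv_eq (I := 𝓘(ℝ, ℝ)) (I' := 𝓡 2)
  have h4 := mfderiv_comp_apply (I := 𝓘(ℝ, ℝ)) (I' := 𝓡 2) (I'' := 𝓡 2) s h1 h2 (1 : ℝ)
  have h5 : (mfderiv 𝓘(ℝ, ℝ) (𝓡 2) u s (1 : ℝ) : Plane) = v := by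
    rw [mfderiv_eq_fderiv]
    exact hd.deriv
  refine (congrArg (fun A : ℝ →L[ℝ] Plane ↦ A 1) h3).trans (h4.trans ?_)
  exact congrArg (mfderiv (𝓡 2) (𝓡 2) φ.symm (u s) : Plane →L[ℝ] Plane) h5

variable [IsManifold (𝓡 2) ∞ M]

/-- The coordinate expression of the metric in a chart. -/
def metricCoeff (g : SmoothMetric M) (φ : OpenPartialHomeomorph M Plane) (q : Plane) :
    Plane →L[ℝ] Plane →L[ℝ] ℝ :=
  ContinuousLinearMap.bilinearComp (E := Plane) (F := Plane) (E' := Plane) (F' := Plane)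
    (g.inner (φ.symm q)) (mfderiv (𝓡 2) (𝓡 2) φ.symm q) (mfderiv (𝓡 2) (𝓡 2) φ.symm q)

/-- The coordinate expression of a `1`-form in a chart. -/
def formCoeff (θ : SmoothOneForm M) (φ : OpenPartialHomeomorph M Plane) (q : Plane) :
    Plane →L[ℝ] ℝ :=
  ContinuousLinearMap.comp (M₁ := Plane) (M₂ := Plane) (M₃ := ℝ) (θ (φ.symm q))
    (mfderiv (𝓡 2) (𝓡 2) φ.symm q)

theorem contMDiffOn_mfderiv_symm {φ : OpenPartialHomeomorph M Plane}
    (hφ : φ ∈ IsManifold.maximalAtlas (𝓡 2) ∞ M) (v : Plane) :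
    ContMDiffOn (𝓡 2) ((𝓡 2).prod (𝓡 2)) ∞
      (fun q : Plane ↦ Bundle.TotalSpace.mk' Plane (E := fun p : M ↦ TangentSpace (𝓡 2) p)
        (φ.symm q) (mfderiv (𝓡 2) (𝓡 2) φ.symm q v)) φ.target := by
  have h1 : ContMDiffOn (𝓡 2) (𝓡 2) ∞ φ.symm φ.target := contMDiffOn_symm_of_mem_maximalAtlas hφ
  have h2 := h1.contMDiffOn_tangentMapWithin (m := ∞) (by simp) φ.open_target.uniqueMDiffOn
  have h3 : ContMDiffOn (𝓡 2) ((𝓡 2).prod (𝓡 2)) ∞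
      (fun q : Plane ↦ (⟨q, v⟩ : TangentBundle (𝓡 2) Plane)) φ.target :=
    contMDiffOn_vectorSpace_iff_contDiffOn.2 contDiffOn_const
  have h4 := h2.comp h3 (fun q hq ↦ hq)
  refine h4.congr fun q hq ↦ ?_
  simp only [Function.comp, tangentMapWithin]
  rw [mfderivWithin_of_mem_nhds (φ.open_target.mem_nhds hq)]

theorem contDiffOn_metricCoeff (g : SmoothMetric M) {φ : OpenPartialHomeomorph M Plane}
    (hφ : φ ∈ IsManifold.maximalAtlas (𝓡 2) ∞ M) :
    ContDiffOn ℝ ∞ (metricCoeff g φ) φ.target := by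
  rw [contDiffOn_clm_apply]
  intro v
  rw [contDiffOn_clm_apply]
  intro w
  have h1 : ContMDiffOn (𝓡 2) (𝓡 2) ∞ φ.symm φ.target := contMDiffOn_symm_of_mem_maximalAtlas hφ
  have h2 := ContMDiffOn.clm_bundle_apply₂ (E₃ := Bundle.Trivial M ℝ) (F₃ := ℝ)
    (g.contMDiff.comp_contMDiffOn h1)
    (contMDiffOn_mfderiv_symm hφ v) (contMDiffOn_mfderiv_symm hφ w)
  intro q hq
  have h3 := h2 q hq
  rw [Bundle.contMDiffWithinAt_totalSpace] at h3
  exact contMDiffWithinAt_iff_contDiffWithinAt.1 h3.2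

theorem contDiffOn_formCoeff (θ : SmoothOneForm M) {φ : OpenPartialHomeomorph M Plane}
    (hφ : φ ∈ IsManifold.maximalAtlas (𝓡 2) ∞ M) :
    ContDiffOn ℝ ∞ (formCoeff θ φ) φ.target := by
  rw [contDiffOn_clm_apply]
  intro v
  have h1 : ContMDiffOn (𝓡 2) (𝓡 2) ∞ φ.symm φ.target := contMDiffOn_symm_of_mem_maximalAtlas hφ
  have h2 := ContMDiffOn.clm_bundle_apply (E₂ := Bundle.Trivial M ℝ) (F₂ := ℝ)
    (θ.contMDiff.comp_contMDiffOn h1)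
    (contMDiffOn_mfderiv_symm hφ v)
  intro q hq
  have h3 := h2 q hq
  rw [Bundle.contMDiffWithinAt_totalSpace] at h3
  exact contMDiffWithinAt_iff_contDiffWithinAt.1 h3.2

/-- Multiplying the chart by a bump function supported in its source extends the coordinates
globally, which links the definition of `H1Loop` by global functions with local coordinates. -/
theorem exists_smooth_coordinates [T2Space M] {φ : OpenPartialHomeomorph M Plane}
    (hφ : φ ∈ IsManifold.maximalAtlas (𝓡 2) ∞ M) {p : M} (hp : p ∈ φ.source) :
    ∃ f : Fin 2 → SmoothFun M, ∀ᶠ q in 𝓝 p, ∀ i, f i q = φ q i := by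
  obtain ⟨χ, -, hχ⟩ := (SmoothBumpFunction.nhds_basis_tsupport (I := 𝓡 2) p).mem_iff.1
    (φ.open_source.mem_nhds hp)
  have hs : ∀ i : Fin 2, ContMDiff (𝓡 2) 𝓘(ℝ, ℝ) ∞ fun q ↦ χ q * φ q i := by
    intro i
    refine contMDiff_of_tsupport fun q hq ↦ ?_
    have hq' : q ∈ φ.source := hχ (tsupport_mul_subset_left hq)
    have h1 : ContMDiffAt (𝓡 2) (𝓡 2) ∞ φ q :=
      (contMDiffOn_of_mem_maximalAtlas hφ).contMDiffAt (φ.open_source.mem_nhds hq')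
    have h2 : ContMDiffAt (𝓡 2) 𝓘(ℝ, ℝ) ∞ (fun q ↦ φ q i) q :=
      ((EuclideanSpace.proj (𝕜 := ℝ) i).contMDiff (n := ∞)).contMDiffAt.comp q h1
    exact χ.contMDiff.contMDiffAt.mul h2
  refine ⟨fun i ↦ ⟨_, hs i⟩, ?_⟩
  filter_upwards [χ.eventuallyEq_one] with q hq i
  change χ q * φ q i = φ q i
  rw [hq]; simp

/-- The derivative of a curve in the plane, taken componentwise. -/
def planeDeriv (u : ℝ → Plane) (s : ℝ) : Plane :=
  WithLp.toLp 2 fun i ↦ deriv (fun r ↦ u r i) s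

@[simp] theorem planeDeriv_apply (u : ℝ → Plane) (s : ℝ) (i : Fin 2) :
    planeDeriv u s i = deriv (fun r ↦ u r i) s := rfl

theorem hasDerivAt_plane {u : ℝ → Plane} {v : Plane} {s : ℝ}
    (h : ∀ i, HasDerivAt (fun r ↦ u r i) (v i) s) : HasDerivAt u v s := by
  have h1 : HasDerivAt (fun r ↦ WithLp.ofLp (u r)) (WithLp.ofLp v) s := hasDerivAt_pi.2 h
  have h2 := ((PiLp.continuousLinearEquiv 2 ℝ (fun _ : Fin 2 ↦ ℝ)).symm.toContinuousLinearMap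
    |>.hasFDerivAt).comp_hasDerivAt s h1
  exact h2

theorem planeDeriv_memLp {u : ℝ → Plane} {μ : Measure ℝ}
    (h : ∀ i, MemLp (deriv fun r ↦ u r i) 2 μ) : MemLp (planeDeriv u) 2 μ := by
  have e : planeDeriv u =
      fun s ↦ ∑ i, deriv (fun r ↦ u r i) s • (EuclideanSpace.single i 1 : Plane) := by
    ext s j
    fin_cases j <;> simp [planeDeriv]
  rw [e]
  refine memLp_finsetSum _ fun i _ ↦ ?_
  have := (ContinuousLinearMap.toSpanSingleton ℝ (EuclideanSpace.single i 1 : Plane)).comp_memLp'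
    (h i)
  exact this

theorem H1On.planeDeriv_hasDerivAt {u : ℝ → Plane} {a b : ℝ} (hab : a ≤ b)
    (h : ∀ i, H1On (fun r ↦ u r i) a b) :
    ∀ᵐ s ∂(volume.restrict (Icc a b)), HasDerivAt u (planeDeriv u s) s := by
  filter_upwards [ae_all_iff.2 fun i ↦ (h i).ae_differentiableAt hab] with s hs
  exact hasDerivAt_plane fun i ↦ (hs i).hasDerivAt

theorem aestronglyMeasurable_clm_apply {F : Type*} [NormedAddCommGroup F] [NormedSpace ℝ F]
    {B : ℝ → Plane →L[ℝ] F} {v : ℝ → Plane} {μ : Measure ℝ} (hB : AEStronglyMeasurable B μ)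
    (hv : AEStronglyMeasurable v μ) : AEStronglyMeasurable (fun s ↦ B s (v s)) μ :=
  (isBoundedBilinearMap_apply (𝕜 := ℝ) (E := Plane) (F := F)).continuous.comp_aestronglyMeasurable
    (hB.prodMk hv)

theorem integrable_bilinear {B : ℝ → Plane →L[ℝ] Plane →L[ℝ] ℝ} {a b : ℝ}
    (hB : ContinuousOn B (Icc a b)) {v w : ℝ → Plane} (hv : MemLp v 2 (volume.restrict (Icc a b)))
    (hw : MemLp w 2 (volume.restrict (Icc a b))) :
    IntegrableOn (fun s ↦ B s (v s) (w s)) (Icc a b) := by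
  obtain ⟨K, hK⟩ := IsCompact.exists_bound_of_continuousOn (f := B) isCompact_Icc hB
  have hm := (hv.norm.integrable_mul hw.norm).const_mul K
  refine hm.mono (aestronglyMeasurable_clm_apply
    (aestronglyMeasurable_clm_apply (hB.aestronglyMeasurable measurableSet_Icc) hv.1) hw.1) ?_
  filter_upwards [ae_restrict_mem measurableSet_Icc] with s hs
  calc ‖B s (v s) (w s)‖ ≤ ‖B s‖ * ‖v s‖ * ‖w s‖ := (B s).le_opNorm₂ _ _
    _ ≤ K * ‖v s‖ * ‖w s‖ := by gcongr; exact hK s hs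
    _ = K * (‖v s‖ * ‖w s‖) := by ring
    _ ≤ _ := le_abs_self _

theorem integrable_linear {B : ℝ → Plane →L[ℝ] ℝ} {a b : ℝ}
    (hB : ContinuousOn B (Icc a b)) {v : ℝ → Plane} (hv : MemLp v 2 (volume.restrict (Icc a b))) :
    IntegrableOn (fun s ↦ B s (v s)) (Icc a b) := by
  obtain ⟨K, hK⟩ := IsCompact.exists_bound_of_continuousOn (f := B) isCompact_Icc hB
  have hm : IntegrableOn (fun s ↦ K * ‖v s‖) (Icc a b) :=
    (hv.norm.integrable (by norm_num)).const_mul K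
  refine Integrable.mono hm
    (aestronglyMeasurable_clm_apply (hB.aestronglyMeasurable measurableSet_Icc) hv.1) ?_
  filter_upwards [ae_restrict_mem measurableSet_Icc] with s hs
  calc ‖B s (v s)‖ ≤ ‖B s‖ * ‖v s‖ := (B s).le_opNorm _
    _ ≤ K * ‖v s‖ := by gcongr; exact hK s hs
    _ ≤ _ := le_abs_self _

/-- The Lagrangian along the curve `w`, run through in time `T`. -/
def lagAlong (g : SmoothMetric M) (θ : SmoothOneForm M) (T : ℝ) (w : ℝ → M) (s : ℝ) : ℝ :=
  lagrangian g θ (w s) (T⁻¹ • (mfderiv 𝓘(ℝ, ℝ) (𝓡 2) w s (1 : ℝ)))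

theorem lagrangian_congr (g : SmoothMetric M) (θ : SmoothOneForm M) {p q : M} (h : p = q)
    {v w : Plane} (hv : v = w) :
    lagrangian g θ p (v : TangentSpace (𝓡 2) p) = lagrangian g θ q (w : TangentSpace (𝓡 2) q) := by
  subst h hv; rfl

variable (g : SmoothMetric M) (θ : SmoothOneForm M)

theorem lagAlong_congr {T : ℝ} {w w' : ℝ → M} {s : ℝ} (h : w =ᶠ[𝓝 s] w') :
    lagAlong g θ T w s = lagAlong g θ T w' s := by
  refine lagrangian_congr g θ h.eq_of_nhds ?_
  have := h.mfderiv_eq (I := 𝓘(ℝ, ℝ)) (I' := 𝓡 2)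
  exact congrArg (fun A : ℝ →L[ℝ] Plane ↦ T⁻¹ • A 1) this

/-- Scaling the parameter and the period by the same factor leaves the velocity of the actual closed
curve unchanged. -/
theorem lagAlong_affine (w : ℝ → M) (T : ℝ) {ℓ : ℝ} (hℓ : ℓ ≠ 0) (a s : ℝ) :
    lagAlong g θ (ℓ * T) (fun r ↦ w (a + ℓ * r)) s = lagAlong g θ T w (a + ℓ * s) := by
  refine lagrangian_congr g θ rfl ?_
  have := mfderiv_comp_affine w hℓ a s
  calc ((ℓ * T)⁻¹ • (mfderiv 𝓘(ℝ, ℝ) (𝓡 2) (fun r ↦ w (a + ℓ * r)) s (1 : ℝ) : Plane))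
      = (ℓ * T)⁻¹ • ℓ • (mfderiv 𝓘(ℝ, ℝ) (𝓡 2) w (a + ℓ * s) (1 : ℝ) : Plane) := by rw [this]
    _ = _ := by
        rw [smul_smul, mul_inv, mul_comm ℓ⁻¹, mul_assoc, inv_mul_cancel₀ hℓ, mul_one]

theorem lagAlong_chart {φ : OpenPartialHomeomorph M Plane}
    (hφ : φ ∈ IsManifold.maximalAtlas (𝓡 2) ∞ M) (T : ℝ) {w : ℝ → M} {u : ℝ → Plane} {v : Plane}
    {s : ℝ} (hw : w =ᶠ[𝓝 s] fun r ↦ φ.symm (u r)) (hu : u s ∈ φ.target) (hd : HasDerivAt u v s) :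
    lagAlong g θ T w s = metricCoeff g φ (u s) (T⁻¹ • v) (T⁻¹ • v) / 2 +
      formCoeff θ φ (u s) (T⁻¹ • v) := by
  refine lagrangian_congr g θ (q := φ.symm (u s)) hw.eq_of_nhds
    (w := (mfderiv (𝓡 2) (𝓡 2) φ.symm (u s) : Plane →L[ℝ] Plane) (T⁻¹ • v)) ?_
  exact (congrArg (fun z : Plane ↦ T⁻¹ • z) (mfderiv_chart hφ hw hu hd)).trans
    ((mfderiv (𝓡 2) (𝓡 2) φ.symm (u s) : Plane →L[ℝ] Plane).map_smul T⁻¹ v).symm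

theorem action_eq (κ : ℝ) (x : H1Loop M) (T : Ioi (0 : ℝ)) :
    action g θ κ (x, T) = T * ∫ s in (0 : ℝ)..1, (lagAlong g θ T x.toFun s + κ) := rfl

theorem lagAlong_periodic (x : H1Loop M) (T : ℝ) :
    Function.Periodic (lagAlong g θ T x.toFun) 1 := by
  intro s
  have h := lagAlong_affine g θ x.toFun T one_ne_zero 1 s
  have e : (fun r ↦ x.toFun (1 + 1 * r)) = x.toFun := by
    ext r
    rw [one_mul, add_comm, x.periodic']
  rw [e, one_mul, one_mul, add_comm] at h
  exact h.symm

theorem action_shift (κ : ℝ) (x : H1Loop M) (T : Ioi (0 : ℝ)) (σ : ℝ) :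
    action g θ κ (x.shift σ, T) = action g θ κ (x, T) := by
  rw [action_eq, action_eq]
  congr 1
  have h : ∀ s, lagAlong g θ T (x.shift σ).toFun s = lagAlong g θ T x.toFun (σ + s) := by
    intro s
    have := lagAlong_affine g θ x.toFun T one_ne_zero σ s
    simp only [one_mul] at this
    exact this
  have hp : Function.Periodic (fun s ↦ lagAlong g θ T x.toFun s + κ) 1 := fun s ↦ by
    simp only [lagAlong_periodic g θ x T s]
  have e := hp.intervalIntegral_add_eq σ 0
  rw [zero_add] at e
  rw [← e]
  simp only [h]
  have := intervalIntegral.integral_comp_add_left (a := 0) (b := 1)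
    (fun s ↦ lagAlong g θ T x.toFun s + κ) σ
  rw [this, add_zero]

theorem action_piece (κ : ℝ) (y : H1Loop M) (T : Ioi (0 : ℝ)) {a ℓ : ℝ} (hℓ : 0 < ℓ)
    (h : y a = y (a + ℓ)) :
    action g θ κ (y.piece a ℓ hℓ h, ⟨ℓ * T, mul_pos hℓ T.2⟩) =
      T * ∫ s in a..(a + ℓ), (lagAlong g θ T y.toFun s + κ) := by
  rw [action_eq]
  -- The piece agrees with an affine reparametrization of y only on [0, 1], so derivatives are
  -- compared on the open interval; its endpoints do not affect the integral.
  have e : ∫ s in (0 : ℝ)..1, (lagAlong g θ (ℓ * T) (y.piece a ℓ hℓ h).toFun s + κ) =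
      ∫ s in (0 : ℝ)..1, (lagAlong g θ T y.toFun (a + ℓ * s) + κ) := by
    rw [intervalIntegral.integral_of_le zero_le_one, intervalIntegral.integral_of_le zero_le_one,
      integral_Ioc_eq_integral_Ioo, integral_Ioc_eq_integral_Ioo]
    refine setIntegral_congr_fun measurableSet_Ioo fun s hs ↦ ?_
    rw [← lagAlong_affine g θ y.toFun T hℓ.ne' a s]
    congr 1
    refine lagAlong_congr g θ ?_
    filter_upwards [isOpen_Ioo.mem_nhds hs] with r hr
    exact H1Loop.piece_apply (Ioo_subset_Icc_self hr)
  rw [e, intervalIntegral.integral_comp_add_mul (fun s ↦ lagAlong g θ T y.toFun s + κ) hℓ.ne']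
  rw [mul_zero, mul_one, add_zero, smul_eq_mul]
  field_simp

end Charts

/-! ### Integrability of the Lagrangian and additivity of the action. -/

section LoopsInCharts

variable {M : Type*} [TopologicalSpace M] [ChartedSpace Plane M] [IsManifold (𝓡 2) ∞ M]
  [T2Space M] [CompactSpace M]

variable (M) in
theorem exists_smooth_embedding : ∃ (N : ℕ) (e : M → EuclideanSpace ℝ (Fin N)),
    ContMDiff (𝓡 2) 𝓘(ℝ, EuclideanSpace ℝ (Fin N)) ∞ e ∧ IsClosedEmbedding e ∧
      ∀ p : M, Function.Injective (mfderiv (𝓡 2) 𝓘(ℝ, EuclideanSpace ℝ (Fin N)) e p) :=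
  exists_embedding_euclidean_of_compact

/-- The components of a smooth map to a Euclidean space. -/
def smoothComponent {N : ℕ} {e : M → EuclideanSpace ℝ (Fin N)}
    (he : ContMDiff (𝓡 2) 𝓘(ℝ, EuclideanSpace ℝ (Fin N)) ∞ e) (i : Fin N) : SmoothFun M :=
  ⟨fun p ↦ e p i, (EuclideanSpace.proj (𝕜 := ℝ) i).contMDiff.comp he⟩

theorem H1Loop.continuous (x : H1Loop M) : Continuous x.toFun := by
  obtain ⟨N, e, he, hemb, -⟩ := exists_smooth_embedding M
  rw [hemb.isEmbedding.continuous_iff]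
  have h : ∀ i, Continuous fun s ↦ e (x s) i := by
    intro i
    rw [continuous_iff_continuousAt]
    intro s
    exact ((x.h1On (smoothComponent he i) (s - 1) (s + 1)).continuousOn (by linarith)).continuousAt
      (Icc_mem_nhds (by linarith) (by linarith))
  exact (PiLp.continuous_toLp 2 (fun _ : Fin N ↦ ℝ)).comp (continuous_pi h)

theorem H1Loop.exists_chart_interval (x : H1Loop M) {φ : OpenPartialHomeomorph M Plane}
    (hφ : φ ∈ IsManifold.maximalAtlas (𝓡 2) ∞ M) {s₀ : ℝ} (hs : x s₀ ∈ φ.source) :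
    ∃ δ > 0, (∀ s ∈ Icc (s₀ - δ) (s₀ + δ), x s ∈ φ.source) ∧
      ∀ i, H1On (fun s ↦ φ (x s) i) (s₀ - δ) (s₀ + δ) := by
  obtain ⟨f, hf⟩ := exists_smooth_coordinates hφ hs
  have hev := x.continuous.continuousAt.eventually (hf.and (φ.open_source.mem_nhds hs))
  obtain ⟨δ, hδ, hball⟩ := Metric.eventually_nhds_iff.1 hev
  have hmem : ∀ s ∈ Icc (s₀ - δ / 2) (s₀ + δ / 2), dist s s₀ < δ := by
    intro s hs
    rw [Real.dist_eq]
    have : |s - s₀| ≤ δ / 2 := abs_le.2 ⟨by linarith [hs.1], by linarith [hs.2]⟩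
    linarith
  refine ⟨δ / 2, half_pos hδ, fun s hs ↦ (hball (hmem s hs)).2, fun i ↦ ?_⟩
  exact (x.h1On (f i) _ _).congr (by linarith) fun s hs ↦ (hball (hmem s hs)).1 i

variable (g : SmoothMetric M) (θ : SmoothOneForm M)

/-- In a chart the integrand is a continuous quadratic form plus a continuous linear form in a
square integrable velocity; compactness passes from local to global. -/
theorem intervalIntegrable_lagAlong (x : H1Loop M) (T a b : ℝ) :
    IntervalIntegrable (lagAlong g θ T x.toFun) volume a b := by
  have hloc : LocallyIntegrable (lagAlong g θ T x.toFun) volume := by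
    intro s₀
    have hφ : chartAt Plane (x s₀) ∈ IsManifold.maximalAtlas (𝓡 2) ∞ M :=
      IsManifold.chart_mem_maximalAtlas _
    set φ := chartAt Plane (x s₀) with hφd
    obtain ⟨δ, hδ, hsrc, hu⟩ := x.exists_chart_interval hφ (mem_chart_source Plane (x s₀))
    refine ⟨Icc (s₀ - δ) (s₀ + δ), Icc_mem_nhds (by linarith) (by linarith), ?_⟩
    set u : ℝ → Plane := fun s ↦ φ (x s) with hud
    have hab : s₀ - δ ≤ s₀ + δ := by linarith
    have huc : ContinuousOn u (Icc (s₀ - δ) (s₀ + δ)) :=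
      φ.continuousOn.comp x.continuous.continuousOn hsrc
    have hmaps : MapsTo u (Icc (s₀ - δ) (s₀ + δ)) φ.target := fun s hs ↦ φ.map_source (hsrc s hs)
    have hG : ContinuousOn (fun s ↦ metricCoeff g φ (u s)) (Icc (s₀ - δ) (s₀ + δ)) :=
      (contDiffOn_metricCoeff g hφ).continuousOn.comp huc hmaps
    have hΘ : ContinuousOn (fun s ↦ formCoeff θ φ (u s)) (Icc (s₀ - δ) (s₀ + δ)) :=
      (contDiffOn_formCoeff θ hφ).continuousOn.comp huc hmaps
    have hv : MemLp (fun s ↦ T⁻¹ • planeDeriv u s) 2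
        (volume.restrict (Icc (s₀ - δ) (s₀ + δ))) :=
      (planeDeriv_memLp fun i ↦ (hu i).memLp).const_smul T⁻¹
    refine (((integrable_bilinear hG hv hv).div_const 2).add (integrable_linear hΘ hv)).congr ?_
    filter_upwards [ae_restrict_Icc_mem_Ioo (s₀ - δ) (s₀ + δ),
      H1On.planeDeriv_hasDerivAt hab hu] with s hs hd
    refine (lagAlong_chart g θ hφ T (w := x.toFun) ?_ (hmaps (Ioo_subset_Icc_self hs)) hd).symm
    filter_upwards [isOpen_Ioo.mem_nhds hs] with r hr
    exact (φ.left_inv (hsrc r (Ioo_subset_Icc_self hr))).symm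
  exact (hloc.integrableOn_isCompact isCompact_uIcc).intervalIntegrable

theorem action_split (κ : ℝ) (y : H1Loop M) (T : Ioi (0 : ℝ)) {a ℓ : ℝ} (hℓ : 0 < ℓ) (hℓ1 : 0 < 1 - ℓ)
    (h : y a = y (a + ℓ)) (h' : y (a + ℓ) = y (a + ℓ + (1 - ℓ))) :
    action g θ κ (y, T) = action g θ κ (y.piece a ℓ hℓ h, ⟨ℓ * T, mul_pos hℓ T.2⟩) +
      action g θ κ (y.piece (a + ℓ) (1 - ℓ) hℓ1 h', ⟨(1 - ℓ) * T, mul_pos hℓ1 T.2⟩) := by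
  rw [action_piece, action_piece, ← mul_add, intervalIntegral.integral_add_adjacent_intervals,
    action_eq]
  · congr 1
    have hp : Function.Periodic (fun s ↦ lagAlong g θ T y.toFun s + κ) 1 := fun s ↦ by
      simp only [lagAlong_periodic g θ y T s]
    have e := hp.intervalIntegral_add_eq a 0
    rw [zero_add] at e
    rw [← e, show a + ℓ + (1 - ℓ) = a + 1 by ring]
  · exact (intervalIntegrable_lagAlong g θ y T _ _).add intervalIntegrable_const
  · exact (intervalIntegrable_lagAlong g θ y T _ _).add intervalIntegrable_const

end LoopsInCharts

/-! ### Uniform Taylor estimates and the du Bois-Reymond lemma. -/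

section Calculus

/-- A closed thickening of C inside D is compact, so the first two derivatives are bounded there;
the mean value inequality on balls gives the quadratic remainder. -/
theorem exists_uniform_taylor {F : Type*} [NormedAddCommGroup F] [NormedSpace ℝ F] {f : Plane → F}
    {D C : Set Plane} (hD : IsOpen D) (hf : ContDiffOn ℝ ∞ f D) (hC : IsCompact C) (hCD : C ⊆ D) :
    ∃ ρ > 0, ∃ K, 0 ≤ K ∧ ∀ q ∈ C, ‖f q‖ ≤ K ∧ (∀ h, ‖fderiv ℝ f q h‖ ≤ K * ‖h‖) ∧ ∀ h : Plane, ‖h‖ ≤ ρ →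
      q + h ∈ D ∧ ‖f (q + h) - f q - fderiv ℝ f q h‖ ≤ K * ‖h‖ ^ 2 := by
  obtain ⟨ρ, hρ, hsub⟩ := hC.exists_cthickening_subset_open hD hCD
  have hC' : IsCompact (Metric.cthickening ρ C) := hC.cthickening
  have hf1 : ContDiffOn ℝ ∞ (fderiv ℝ f) D := hf.fderiv_of_isOpen hD (by simp)
  have hf2 : ContDiffOn ℝ ∞ (fderiv ℝ (fderiv ℝ f)) D := hf1.fderiv_of_isOpen hD (by simp)
  obtain ⟨K0, hK0⟩ := IsCompact.exists_bound_of_continuousOn (f := f) hC' (hf.continuousOn.mono hsub)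
  obtain ⟨K1, hK1⟩ := IsCompact.exists_bound_of_continuousOn (f := fderiv ℝ f) hC'
    (hf1.continuousOn.mono hsub)
  obtain ⟨K2, hK2⟩ := IsCompact.exists_bound_of_continuousOn (f := fderiv ℝ (fderiv ℝ f)) hC'
    (hf2.continuousOn.mono hsub)
  have hself : ∀ q ∈ C, q ∈ Metric.cthickening ρ C := fun q hq ↦ Metric.self_subset_cthickening C hq
  refine ⟨ρ, hρ, max 0 (max K0 (max K1 K2)), le_max_left _ _, fun q hq ↦ ⟨?_, fun h ↦ ?_, fun h hh ↦ ?_⟩⟩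
  · exact (hK0 q (hself q hq)).trans (by simp)
  · refine ((fderiv ℝ f q).le_opNorm h).trans ?_
    gcongr
    exact (hK1 q (hself q hq)).trans (by simp)
  have hball : Metric.closedBall q ‖h‖ ⊆ Metric.cthickening ρ C :=
    (Metric.closedBall_subset_closedBall hh).trans (Metric.closedBall_subset_cthickening hq ρ)
  have hqh : q + h ∈ Metric.closedBall q ‖h‖ := by simp [dist_eq_norm]
  have hqq : q ∈ Metric.closedBall q ‖h‖ := by simp
  have hconv : Convex ℝ (Metric.closedBall q ‖h‖) := convex_closedBall q ‖h‖
  refine ⟨hsub (hball hqh), ?_⟩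
  have hd : ∀ p ∈ Metric.closedBall q ‖h‖, ‖fderiv ℝ f p - fderiv ℝ f q‖ ≤ K2 * ‖h‖ := by
    intro p hp
    have h1 := hconv.norm_image_sub_le_of_norm_hasFDerivWithin_le (f := fderiv ℝ f)
      (f' := fderiv ℝ (fderiv ℝ f)) (C := K2)
      (fun r hr ↦ (((hf1.contDiffAt (hD.mem_nhds (hsub (hball hr)))).differentiableAt
        (by simp)).hasFDerivAt).hasFDerivWithinAt)
      (fun r hr ↦ hK2 r (hball hr)) hqq hp
    refine h1.trans ?_
    have : ‖p - q‖ ≤ ‖h‖ := by simpa [dist_eq_norm] using hp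
    have hK20 : 0 ≤ K2 := (norm_nonneg (fderiv ℝ (fderiv ℝ f) q)).trans (hK2 q (hself q hq))
    gcongr
  have h2 := hconv.norm_image_sub_le_of_norm_hasFDerivWithin_le' (f := f)
    (f' := fderiv ℝ f) (φ := fderiv ℝ f q) (C := K2 * ‖h‖)
    (fun r hr ↦ (((hf.contDiffAt (hD.mem_nhds (hsub (hball hr)))).differentiableAt
      (by simp)).hasFDerivAt).hasFDerivWithinAt) hd hqq hqh
  rw [add_sub_cancel_left] at h2
  refine h2.trans ?_
  rw [mul_assoc, ← pow_two]
  gcongr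
  simp

/-- The du Bois-Reymond lemma. -/
theorem du_bois_reymond {A B : ℝ → ℝ} {a b : ℝ} (hab : a < b)
    (hA : MemLp A 2 (volume.restrict (Icc a b))) (hB : IntervalIntegrable B volume a b)
    (h : ∀ η : ℝ → ℝ, H1On η a b → η a = 0 → η b = 0 →
      0 ≤ ∫ s in a..b, (B s * η s + A s * deriv η s)) :
    ∃ c : ℝ, ∀ᵐ s ∂(volume.restrict (Icc a b)), A s = c + ∫ r in a..s, B r := by
  set β : ℝ → ℝ := fun s ↦ ∫ r in a..s, B r with hβ
  have hβa : β a = 0 := by simp [hβ]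
  have hβp : ∀ t ∈ Icc a b, β t = β a + ∫ r in a..t, B r := fun t _ ↦ by simp [hβ]
  have hβac := primitive_absolutelyContinuous hab.le hB hβp
  have hβd := primitive_hasDerivAt_ae hab.le hB hβp
  have hβc : ContinuousOn β (Icc a b) := by
    have := hβac.continuousOn
    rwa [uIcc_of_le hab.le] at this
  have hβL : MemLp β 2 (volume.restrict (Icc a b)) := by
    obtain ⟨C, hC⟩ := isCompact_Icc.exists_bound_of_continuousOn hβc
    exact MemLp.of_bound (hβc.aestronglyMeasurable measurableSet_Icc) C
      ((ae_restrict_iff' measurableSet_Icc).2 (Eventually.of_forall hC))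
  -- Subtracting the mean makes P integrate to zero, so that η = -∫ P vanishes at both ends and is
  -- an admissible test function.
  set c : ℝ := (b - a)⁻¹ * ∫ s in a..b, (A s - β s) with hc
  set P : ℝ → ℝ := fun s ↦ A s - β s - c with hP
  have hABi : IntervalIntegrable (fun s ↦ A s - β s) volume a b :=
    memLp_two_intervalIntegrable hab.le (hA.sub hβL)
  have hPL : MemLp P 2 (volume.restrict (Icc a b)) := (hA.sub hβL).sub (memLp_const c)
  have hP0 : ∫ s in a..b, P s = 0 := by
    simp only [hP]
    rw [intervalIntegral.integral_sub hABi intervalIntegrable_const,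
      intervalIntegral.integral_const, smul_eq_mul, hc, ← mul_assoc,
      mul_inv_cancel₀ (by linarith), one_mul, sub_self]
  set η : ℝ → ℝ := fun s ↦ ∫ r in a..s, -P r with hη
  have hηa : η a = 0 := by simp [hη]
  have hηb : η b = 0 := by simp [hη, hP0]
  have hηp : ∀ t ∈ Icc a b, η t = η a + ∫ r in a..t, -P r := fun t _ ↦ by simp [hη]
  have hηH : H1On η a b := H1On.of_primitive hab.le hPL.neg hηp
  have hηd : deriv η =ᵐ[volume.restrict (Icc a b)] fun s ↦ -P s :=
    primitive_hasDerivAt_ae hab.le (memLp_two_intervalIntegrable hab.le hPL.neg) hηp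
  have key := h η hηH hηa hηb
  have hibp := AbsolutelyContinuousOnInterval.integral_mul_deriv_eq_deriv_mul hβac hηH.ac
  rw [hηa, hηb] at hibp
  simp only [mul_zero, sub_zero, zero_sub] at hibp
  have to_int : ∀ {f₁ f₂ : ℝ → ℝ}, f₁ =ᵐ[volume.restrict (Icc a b)] f₂ →
      ∫ s in a..b, f₁ s = ∫ s in a..b, f₂ s := by
    intro f₁ f₂ hf
    rw [intervalIntegral.integral_of_le hab.le, intervalIntegral.integral_of_le hab.le]
    exact integral_congr_ae (ae_restrict_of_ae_restrict_of_subset Ioc_subset_Icc_self hf)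
  have e1 : ∫ s in a..b, β s * deriv η s = ∫ s in a..b, β s * -P s :=
    to_int (by filter_upwards [hηd] with s hs; rw [hs])
  have e2 : ∫ s in a..b, deriv β s * η s = ∫ s in a..b, B s * η s :=
    to_int (by filter_upwards [hβd] with s hs; rw [hs])
  have e3 : ∫ s in a..b, (B s * η s + A s * deriv η s) =
      ∫ s in a..b, (B s * η s + A s * -P s) :=
    to_int (by filter_upwards [hηd] with s hs; rw [hs])
  have iBη : IntervalIntegrable (fun s ↦ B s * η s) volume a b :=
    hB.mul_continuousOn hηH.ac.continuousOn
  have ii : ∀ {f₁ f₂ : ℝ → ℝ}, MemLp f₁ 2 (volume.restrict (Icc a b)) →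
      MemLp f₂ 2 (volume.restrict (Icc a b)) → IntervalIntegrable (fun s ↦ f₁ s * f₂ s) volume a b := by
    intro f₁ f₂ h1 h2
    rw [intervalIntegrable_iff_integrableOn_Icc_of_le hab.le]
    exact h1.integrable_mul h2
  have iAP : IntervalIntegrable (fun s ↦ A s * -P s) volume a b := ii hA hPL.neg
  have iβP : IntervalIntegrable (fun s ↦ β s * -P s) volume a b := ii hβL hPL.neg
  have iPP := ii hPL hPL
  have iP := memLp_two_intervalIntegrable hab.le hPL
  -- For this test function the first variation is -∫ P², so the one-sided hypothesis already forces
  -- P = 0.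
  have e4 : ∫ s in a..b, (B s * η s + A s * -P s) = - ∫ s in a..b, P s * P s := by
    rw [intervalIntegral.integral_add iBη iAP]
    have e5 : ∫ s in a..b, B s * η s = -∫ s in a..b, β s * -P s := by
      rw [← e2, ← e1, hibp, neg_neg]
    rw [e5, neg_add_eq_sub]
    have e6 : (∫ s in a..b, A s * -P s) - (∫ s in a..b, β s * -P s) =
        ∫ s in a..b, (-(P s * P s) - c * P s) := by
      refine (intervalIntegral.integral_sub iAP iβP).symm.trans ?_
      congr 1; ext s
      simp only [hP]; ring
    refine e6.trans ?_
    rw [intervalIntegral.integral_sub (f := fun s ↦ -(P s * P s)) iPP.neg (iP.const_mul c), intervalIntegral.integral_neg,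
      intervalIntegral.integral_const_mul, hP0, mul_zero, sub_zero]
  rw [e3, e4] at key
  have hnn : 0 ≤ᵐ[volume.restrict (Icc a b)] fun s ↦ P s * P s :=
    Eventually.of_forall fun s ↦ mul_self_nonneg _
  have hz : ∫ s in Icc a b, P s * P s = 0 := by
    apply le_antisymm
    · rw [intervalIntegral.integral_of_le hab.le, ← integral_Icc_eq_integral_Ioc] at key
      linarith
    · exact integral_nonneg_of_ae hnn
  rw [integral_eq_zero_iff_of_nonneg_ae hnn (hPL.integrable_mul hPL)] at hz
  refine ⟨c, ?_⟩
  filter_upwards [hz] with s hs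
  have : P s = 0 := by simpa using hs
  simp only [hP] at this
  linarith

end Calculus

/-! ### Second-order expansion of the Lagrangian. -/

section FirstVariation

/-- A Lagrangian on a planar domain that is quadratic in the velocity. -/
def planeLag (G : Plane → Plane →L[ℝ] Plane →L[ℝ] ℝ) (Θ : Plane → Plane →L[ℝ] ℝ) (q v : Plane) : ℝ :=
  G q v v / 2 + Θ q v

/-- The derivative of `planeLag` in the direction `(h, k)`. -/
def planeLagDeriv (G : Plane → Plane →L[ℝ] Plane →L[ℝ] ℝ) (Θ : Plane → Plane →L[ℝ] ℝ)
    (q v h k : Plane) : ℝ :=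
  (fderiv ℝ G q h v v / 2 + fderiv ℝ Θ q h v) + (G q v k + Θ q k)

variable {G : Plane → Plane →L[ℝ] Plane →L[ℝ] ℝ} {Θ : Plane → Plane →L[ℝ] ℝ}

theorem expansion_bound {K H V W : ℝ} (hK : 0 ≤ K) (hH : 0 ≤ H) (hV : 0 ≤ V) (hW : 0 ≤ W) :
    K * H ^ 2 * (V + W) ^ 2 / 2 + K * H ^ 2 * (V + W) +
        (K * H * V * W + K * H * W * W / 2 + K * W * W / 2 + K * H * W) ≤
      K * (2 * H ^ 2 + 2 * H + 1) * (1 + V ^ 2 + W ^ 2) := by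
  have p1 : (V + W) ^ 2 / 2 ≤ 1 + V ^ 2 + W ^ 2 := by linarith [sq_nonneg (V - W)]
  have p2 : V + W ≤ 1 + V ^ 2 + W ^ 2 := by linarith [sq_nonneg (V - 1), sq_nonneg (W - 1), sq_nonneg V, sq_nonneg W]
  have p3 : V * W + W * W / 2 + W ≤ 2 * (1 + V ^ 2 + W ^ 2) := by
    linarith [sq_nonneg (V - W), sq_nonneg (W - 1), sq_nonneg V, sq_nonneg W]
  have p4 : W * W / 2 ≤ 1 + V ^ 2 + W ^ 2 := by linarith [sq_nonneg V, sq_nonneg W]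
  have q1 := mul_le_mul_of_nonneg_left p1 (by positivity : 0 ≤ K * H ^ 2)
  have q2 := mul_le_mul_of_nonneg_left p2 (by positivity : 0 ≤ K * H ^ 2)
  have q3 := mul_le_mul_of_nonneg_left p3 (by positivity : 0 ≤ K * H)
  have q4 := mul_le_mul_of_nonneg_left p4 hK
  linarith

/-- An upper bound is enough, since it is combined with minimality. The remainder is ε² times a
quantity integrable for square integrable v and k. Symmetry of G merges the two mixed terms in v and
k. -/
theorem planeLag_expansion {q v h k : Plane} {ε K H : ℝ} (hsym : ∀ v w, G q v w = G q w v)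
    (hε0 : 0 ≤ ε) (hε1 : ε ≤ 1) (hK : 0 ≤ K) (hH : ‖h‖ ≤ H)
    (hG : ‖G q‖ ≤ K) (hDh : ‖fderiv ℝ G q h‖ ≤ K * H) (hDh' : ‖fderiv ℝ Θ q h‖ ≤ K * H)
    (hRG : ‖G (q + ε • h) - G q - fderiv ℝ G q (ε • h)‖ ≤ K * ‖ε • h‖ ^ 2)
    (hRΘ : ‖Θ (q + ε • h) - Θ q - fderiv ℝ Θ q (ε • h)‖ ≤ K * ‖ε • h‖ ^ 2) :
    planeLag G Θ (q + ε • h) (v + ε • k) ≤ planeLag G Θ q v + ε * planeLagDeriv G Θ q v h k +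
      ε ^ 2 * (K * (2 * H ^ 2 + 2 * H + 1) * (1 + ‖v‖ ^ 2 + ‖k‖ ^ 2)) := by
  have hH0 : 0 ≤ H := (norm_nonneg h).trans hH
  set R := G (q + ε • h) - G q - fderiv ℝ G q (ε • h) with hR
  set R' := Θ (q + ε • h) - Θ q - fderiv ℝ Θ q (ε • h) with hR'
  have eG : G (q + ε • h) = R + G q + ε • fderiv ℝ G q h := by
    rw [hR, map_smul]; abel
  have eΘ : Θ (q + ε • h) = R' + Θ q + ε • fderiv ℝ Θ q h := by
    rw [hR', map_smul]; abel
  have hεh : ‖ε • h‖ ^ 2 ≤ ε ^ 2 * H ^ 2 := by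
    rw [norm_smul, mul_pow, Real.norm_eq_abs, sq_abs]
    gcongr
  have hRn : ‖R‖ ≤ K * (ε ^ 2 * H ^ 2) := hRG.trans (by gcongr)
  have hR'n : ‖R'‖ ≤ K * (ε ^ 2 * H ^ 2) := hRΘ.trans (by gcongr)
  have hvk : ‖v + ε • k‖ ≤ ‖v‖ + ‖k‖ := by
    refine (norm_add_le _ _).trans ?_
    rw [norm_smul, Real.norm_eq_abs, abs_of_nonneg hε0]
    gcongr
    exact mul_le_of_le_one_left (norm_nonneg _) hε1
  have b1 : R (v + ε • k) (v + ε • k) ≤ K * (ε ^ 2 * H ^ 2) * (‖v‖ + ‖k‖) * (‖v‖ + ‖k‖) :=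
    (le_abs_self _).trans ((R.le_opNorm₂ _ _).trans (by gcongr))
  have b2 : R' (v + ε • k) ≤ K * (ε ^ 2 * H ^ 2) * (‖v‖ + ‖k‖) :=
    (le_abs_self _).trans ((R'.le_opNorm _).trans (by gcongr))
  have bil : ∀ {w z : Plane}, fderiv ℝ G q h w z ≤ K * H * ‖w‖ * ‖z‖ := fun {w z} ↦
    (le_abs_self _).trans (((fderiv ℝ G q h).le_opNorm₂ _ _).trans (by gcongr))
  have b3 := bil (w := v) (z := k)
  have b4 := bil (w := k) (z := v)
  have b5 := bil (w := k) (z := k)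
  have b6 : G q k k ≤ K * ‖k‖ * ‖k‖ :=
    (le_abs_self _).trans (((G q).le_opNorm₂ _ _).trans (by gcongr))
  have b7 : fderiv ℝ Θ q h k ≤ K * H * ‖k‖ :=
    (le_abs_self _).trans (((fderiv ℝ Θ q h).le_opNorm _).trans (by gcongr))
  have expand : planeLag G Θ (q + ε • h) (v + ε • k) = planeLag G Θ q v +
      ε * planeLagDeriv G Θ q v h k + (R (v + ε • k) (v + ε • k) / 2 + R' (v + ε • k) +
        ε ^ 2 * (fderiv ℝ G q h v k / 2 + fderiv ℝ G q h k v / 2 + ε * (fderiv ℝ G q h k k) / 2 +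
          G q k k / 2 + fderiv ℝ Θ q h k)) := by
    unfold planeLag planeLagDeriv
    rw [eG, eΘ]
    have h1 : (R + G q + ε • fderiv ℝ G q h) (v + ε • k) (v + ε • k) =
        R (v + ε • k) (v + ε • k) + G q (v + ε • k) (v + ε • k) +
          ε * fderiv ℝ G q h (v + ε • k) (v + ε • k) := rfl
    have h2 : (R' + Θ q + ε • fderiv ℝ Θ q h) (v + ε • k) =
        R' (v + ε • k) + Θ q (v + ε • k) + ε * fderiv ℝ Θ q h (v + ε • k) := rfl
    have h3 : ∀ B : Plane →L[ℝ] Plane →L[ℝ] ℝ, B (v + ε • k) (v + ε • k) =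
        B v v + ε * B v k + ε * B k v + ε ^ 2 * B k k := by
      intro B
      simp only [map_add, map_smul, add_apply, smul_apply,
        smul_eq_mul]
      ring
    have h4 : ∀ B : Plane →L[ℝ] ℝ, B (v + ε • k) = B v + ε * B k := by
      intro B
      simp only [map_add, map_smul, smul_eq_mul]
    rw [h1, h2, h3 (G q), h3 (fderiv ℝ G q h), h4 (Θ q), h4 (fderiv ℝ Θ q h), hsym k v]
    ring
  rw [expand]
  have b5' : ε * fderiv ℝ G q h k k ≤ K * H * ‖k‖ * ‖k‖ :=
    (mul_le_mul_of_nonneg_left b5 hε0).trans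
      (mul_le_of_le_one_left (by positivity) hε1)
  set V := ‖v‖
  set κ := ‖k‖
  have hV : 0 ≤ V := norm_nonneg v
  have hκ : 0 ≤ κ := norm_nonneg k
  have inner_le : fderiv ℝ G q h v k / 2 + fderiv ℝ G q h k v / 2 + ε * (fderiv ℝ G q h k k) / 2 +
      G q k k / 2 + fderiv ℝ Θ q h k ≤
      K * H * V * κ + K * H * κ * κ / 2 + K * κ * κ / 2 + K * H * κ := by
    linarith
  have e2 : 0 ≤ ε ^ 2 := sq_nonneg ε
  have step : R (v + ε • k) (v + ε • k) / 2 + R' (v + ε • k) +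
        ε ^ 2 * (fderiv ℝ G q h v k / 2 + fderiv ℝ G q h k v / 2 + ε * (fderiv ℝ G q h k k) / 2 +
          G q k k / 2 + fderiv ℝ Θ q h k) ≤
      ε ^ 2 * (K * H ^ 2 * (V + κ) ^ 2 / 2 + K * H ^ 2 * (V + κ) +
        (K * H * V * κ + K * H * κ * κ / 2 + K * κ * κ / 2 + K * H * κ)) := by
    have := mul_le_mul_of_nonneg_left inner_le e2
    linarith
  have fin := expansion_bound hK hH0 hV hκ
  have := mul_le_mul_of_nonneg_left fin e2
  linarith

end FirstVariation

/-! ### The first variation inequality in the plane. -/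

section EulerLagrange

variable {G : Plane → Plane →L[ℝ] Plane →L[ℝ] ℝ} {Θ : Plane → Plane →L[ℝ] ℝ} {D : Set Plane}
  {u : ℝ → Plane} {a b : ℝ}

theorem H1On.plane_continuousOn (hab : a ≤ b) (hu : ∀ i, H1On (fun r ↦ u r i) a b) :
    ContinuousOn u (Icc a b) := by
  have h : ContinuousOn (fun s ↦ WithLp.ofLp (u s)) (Icc a b) :=
    continuousOn_pi.2 fun i ↦ (hu i).continuousOn hab
  exact (PiLp.continuous_toLp 2 (fun _ : Fin 2 ↦ ℝ)).comp_continuousOn h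

theorem integrable_planeLag {w v : ℝ → Plane} (hG : ContinuousOn G D) (hΘ : ContinuousOn Θ D)
    (hw : ContinuousOn w (Icc a b)) (hwD : MapsTo w (Icc a b) D)
    (hv : MemLp v 2 (volume.restrict (Icc a b))) :
    IntegrableOn (fun s ↦ planeLag G Θ (w s) (v s)) (Icc a b) :=
  ((integrable_bilinear (B := fun s ↦ G (w s)) (hG.comp hw hwD) hv hv).div_const 2).add
    (integrable_linear (B := fun s ↦ Θ (w s)) (hΘ.comp hw hwD) hv)

theorem continuousOn_fderiv_apply {F : Type*} [NormedAddCommGroup F] [NormedSpace ℝ F]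
    {f : Plane → F} (hD : IsOpen D) (hf : ContDiffOn ℝ ∞ f D) {w h : ℝ → Plane} {S : Set ℝ}
    (hw : ContinuousOn w S) (hwD : MapsTo w S D) (hh : ContinuousOn h S) :
    ContinuousOn (fun s ↦ fderiv ℝ f (w s) (h s)) S :=
  ((hf.continuousOn_fderiv_of_isOpen hD (by simp)).comp hw hwD).clm_apply hh

/-- Integrating the expansion and using minimality gives 0 ≤ ε(I + εJ) with J finite; divide by ε
and let ε tend to 0. -/
theorem first_variation (hD : IsOpen D) (hG : ContDiffOn ℝ ∞ G D) (hΘ : ContDiffOn ℝ ∞ Θ D)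
    (hsym : ∀ q ∈ D, ∀ v w, G q v w = G q w v) (hab : a < b)
    (hu : ∀ i, H1On (fun r ↦ u r i) a b) (huD : MapsTo u (Icc a b) D) {η : ℝ → Plane}
    (hη : ∀ i, H1On (fun r ↦ η r i) a b)
    (hmin : ∀ᶠ ε : ℝ in 𝓝[>] 0, ∫ s in a..b, planeLag G Θ (u s) (planeDeriv u s) ≤
      ∫ s in a..b, planeLag G Θ (u s + ε • η s) (planeDeriv u s + ε • planeDeriv η s)) :
    0 ≤ ∫ s in a..b, planeLagDeriv G Θ (u s) (planeDeriv u s) (η s) (planeDeriv η s) := by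
  have huc := H1On.plane_continuousOn hab.le hu
  have hηc := H1On.plane_continuousOn hab.le hη
  have huv : MemLp (planeDeriv u) 2 (volume.restrict (Icc a b)) :=
    planeDeriv_memLp fun i ↦ (hu i).memLp
  have hηv : MemLp (planeDeriv η) 2 (volume.restrict (Icc a b)) :=
    planeDeriv_memLp fun i ↦ (hη i).memLp
  have hC : IsCompact (u '' Icc a b) := isCompact_Icc.image_of_continuousOn huc
  have hCD : u '' Icc a b ⊆ D := huD.image_subset
  obtain ⟨ρ₁, hρ₁, K₁, hK₁, h₁⟩ := exists_uniform_taylor hD hG hC hCD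
  obtain ⟨ρ₂, hρ₂, K₂, hK₂, h₂⟩ := exists_uniform_taylor hD hΘ hC hCD
  obtain ⟨H, hH⟩ := isCompact_Icc.exists_bound_of_continuousOn hηc
  have hH0 : 0 ≤ H := (norm_nonneg _).trans (hH a (left_mem_Icc.2 hab.le))
  set K := max K₁ K₂ with hK
  have hK0 : 0 ≤ K := hK₁.trans (le_max_left _ _)
  set I := ∫ s in a..b, planeLagDeriv G Θ (u s) (planeDeriv u s) (η s) (planeDeriv η s) with hI
  set J := ∫ s in a..b, K * (2 * H ^ 2 + 2 * H + 1) *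
    (1 + ‖planeDeriv u s‖ ^ 2 + ‖planeDeriv η s‖ ^ 2) with hJ
  have toII : ∀ {f : ℝ → ℝ}, IntegrableOn f (Icc a b) → IntervalIntegrable f volume a b :=
    fun hf ↦ (intervalIntegrable_iff_integrableOn_Icc_of_le hab.le).2 hf
  have iL : IntervalIntegrable (fun s ↦ planeLag G Θ (u s) (planeDeriv u s)) volume a b :=
    toII (integrable_planeLag hG.continuousOn hΘ.continuousOn huc huD huv)
  have iI : IntervalIntegrable
      (fun s ↦ planeLagDeriv G Θ (u s) (planeDeriv u s) (η s) (planeDeriv η s)) volume a b := by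
    apply toII
    have t1 := (integrable_bilinear (continuousOn_fderiv_apply hD hG huc huD hηc) huv huv).div_const 2
    have t2 := integrable_linear (continuousOn_fderiv_apply hD hΘ huc huD hηc) huv
    have t3 := integrable_bilinear (B := fun s ↦ G (u s)) (hG.continuousOn.comp huc huD) huv hηv
    have t4 := integrable_linear (B := fun s ↦ Θ (u s)) (hΘ.continuousOn.comp huc huD) hηv
    exact (t1.add t2).add (t3.add t4)
  have iJ : IntervalIntegrable (fun s ↦ K * (2 * H ^ 2 + 2 * H + 1) *
      (1 + ‖planeDeriv u s‖ ^ 2 + ‖planeDeriv η s‖ ^ 2)) volume a b := by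
    apply toII
    have t1 := huv.integrable_norm_pow (by norm_num)
    have t2 := hηv.integrable_norm_pow (by norm_num)
    exact (((integrable_const (1 : ℝ)).add t1).add t2).const_mul _
  -- The bound on `ε * H` keeps the varied curve in the range where both Taylor estimates hold.
  have key : ∀ᶠ ε : ℝ in 𝓝[>] 0, 0 ≤ I + ε * J := by
    have hε1 : ∀ᶠ ε : ℝ in 𝓝[>] 0, ε < 1 :=
      mem_nhdsWithin_of_mem_nhds (Iio_mem_nhds one_pos)
    have hε2 : ∀ᶠ ε : ℝ in 𝓝[>] 0, ε * H < min ρ₁ ρ₂ := by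
      have : Tendsto (fun ε : ℝ ↦ ε * H) (𝓝[>] 0) (𝓝 (0 * H)) :=
        (tendsto_id.mul_const H).mono_left nhdsWithin_le_nhds
      rw [zero_mul] at this
      exact this.eventually (Iio_mem_nhds (lt_min hρ₁ hρ₂))
    filter_upwards [hmin, hε1, hε2, self_mem_nhdsWithin] with ε hm h1 h2 hpos
    have hpos : 0 < ε := hpos
    have hn : ∀ s ∈ Icc a b, ‖ε • η s‖ ≤ min ρ₁ ρ₂ := by
      intro s hs
      rw [norm_smul, Real.norm_eq_abs, abs_of_pos hpos]
      exact (mul_le_mul_of_nonneg_left (hH s hs) hpos.le).trans h2.le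
    have hεD : MapsTo (fun s ↦ u s + ε • η s) (Icc a b) D := fun s hs ↦
      ((h₁ (u s) (mem_image_of_mem u hs)).2.2 _ ((hn s hs).trans (min_le_left _ _))).1
    have iε : IntervalIntegrable
        (fun s ↦ planeLag G Θ (u s + ε • η s) (planeDeriv u s + ε • planeDeriv η s)) volume a b :=
      toII (integrable_planeLag hG.continuousOn hΘ.continuousOn (huc.add (hηc.const_smul ε)) hεD
        (huv.add (hηv.const_smul ε)))
    have hle : ∫ s in a..b, planeLag G Θ (u s + ε • η s) (planeDeriv u s + ε • planeDeriv η s) ≤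
        ∫ s in a..b, (planeLag G Θ (u s) (planeDeriv u s) +
          ε * planeLagDeriv G Θ (u s) (planeDeriv u s) (η s) (planeDeriv η s) +
          ε ^ 2 * (K * (2 * H ^ 2 + 2 * H + 1) *
            (1 + ‖planeDeriv u s‖ ^ 2 + ‖planeDeriv η s‖ ^ 2))) := by
      refine intervalIntegral.integral_mono_on hab.le iε
        ((iL.add (iI.const_mul ε)).add (iJ.const_mul _)) fun s hs ↦ ?_
      obtain ⟨g1, g2, g3⟩ := h₁ (u s) (mem_image_of_mem u hs)
      obtain ⟨k1, k2, k3⟩ := h₂ (u s) (mem_image_of_mem u hs)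
      refine planeLag_expansion (hsym _ (huD hs)) hpos.le h1.le hK0 (hH s hs)
        (g1.trans (le_max_left _ _)) ((g2 _).trans ?_) ((k2 _).trans ?_)
        ((g3 _ ((hn s hs).trans (min_le_left _ _))).2.trans ?_)
        ((k3 _ ((hn s hs).trans (min_le_right _ _))).2.trans ?_)
      · exact mul_le_mul (le_max_left _ _) (hH s hs) (norm_nonneg _) hK0
      · exact mul_le_mul (le_max_right _ _) (hH s hs) (norm_nonneg _) hK0
      · exact mul_le_mul_of_nonneg_right (le_max_left _ _) (sq_nonneg _)
      · exact mul_le_mul_of_nonneg_right (le_max_right _ _) (sq_nonneg _)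
    rw [intervalIntegral.integral_add (iL.add (iI.const_mul ε)) (iJ.const_mul _),
      intervalIntegral.integral_add iL (iI.const_mul ε), intervalIntegral.integral_const_mul,
      intervalIntegral.integral_const_mul, ← hI, ← hJ] at hle
    have : 0 ≤ ε * (I + ε * J) := by
      have := hm.trans hle
      linarith [this, sq ε, mul_assoc ε ε J]
    exact nonneg_of_mul_nonneg_right this hpos
  have hlim : Tendsto (fun ε : ℝ ↦ I + ε * J) (𝓝[>] 0) (𝓝 (I + 0 * J)) :=
    ((tendsto_id.mul_const J).const_add I).mono_left nhdsWithin_le_nhds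
  rw [zero_mul, add_zero] at hlim
  exact ge_of_tendsto hlim key

theorem isInvertible_of_posDef {B : Plane →L[ℝ] Plane →L[ℝ] ℝ} (h : ∀ v, v ≠ 0 → 0 < B v v) :
    ∃ L : Plane ≃L[ℝ] (Plane →L[ℝ] ℝ), (L : Plane →L[ℝ] Plane →L[ℝ] ℝ) = B := by
  have hinj : Function.Injective (B : Plane →ₗ[ℝ] Plane →L[ℝ] ℝ) := by
    rw [injective_iff_map_eq_zero]
    intro v hv
    by_contra hne
    have h1 := h v hne
    have h2 : B v = 0 := hv
    rw [h2] at h1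
    simp at h1
  have hfin : Module.finrank ℝ Plane = Module.finrank ℝ (Plane →L[ℝ] ℝ) := by
    rw [← (LinearMap.toContinuousLinearMap (𝕜 := ℝ) (E := Plane) (F' := ℝ)).finrank_eq,
      Subspace.dual_finrank_eq]
  refine ⟨(LinearMap.linearEquivOfInjective (B : Plane →ₗ[ℝ] Plane →L[ℝ] ℝ) hinj hfin).toContinuousLinearEquiv, ?_⟩
  ext v w
  rfl

theorem clm_eq_sum (B : Plane →L[ℝ] ℝ) :
    B = ∑ i, B (EuclideanSpace.single i 1) • (EuclideanSpace.proj i : Plane →L[ℝ] ℝ) := by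
  ext v
  have hv : v = ∑ i, v i • (EuclideanSpace.single i 1 : Plane) := by
    ext j; fin_cases j <;> simp
  conv_lhs => rw [hv]
  simp [mul_comm]

end EulerLagrange

/-! ### Uniqueness of the zero solution. -/

section Gronwall

variable {E : Type*} [NormedAddCommGroup E] [NormedSpace ℝ E]

theorem eq_zero_right_of_norm_deriv_le {f f' : ℝ → E} {a b K : ℝ}
    (h : ∀ s ∈ Ioo a b, HasDerivAt f (f' s) s) (hb : ∀ s ∈ Ioo a b, ‖f' s‖ ≤ K * ‖f s‖)
    {s₁ s : ℝ} (hs₁ : s₁ ∈ Ioo a b) (h0 : f s₁ = 0) (hs : s ∈ Ico s₁ b) : f s = 0 := by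
  have hsub : Icc s₁ s ⊆ Ioo a b := fun r hr ↦ ⟨hs₁.1.trans_le hr.1, hr.2.trans_lt hs.2⟩
  have := norm_le_gronwallBound_of_norm_deriv_right_le (f := f) (f' := f') (δ := 0) (K := K)
    (ε := 0) (a := s₁) (b := s) (fun r hr ↦ (h r (hsub hr)).continuousAt.continuousWithinAt)
    (fun r hr ↦ (h r (hsub (Ico_subset_Icc_self hr))).hasDerivWithinAt) (by simp [h0])
    (fun r hr ↦ by simpa using hb r (hsub (Ico_subset_Icc_self hr))) s (right_mem_Icc.2 hs.1)
  rw [gronwallBound_ε0_δ0] at this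
  exact norm_le_zero_iff.1 this

theorem eq_zero_of_norm_deriv_le {f f' : ℝ → E} {a b K : ℝ}
    (h : ∀ s ∈ Ioo a b, HasDerivAt f (f' s) s) (hb : ∀ s ∈ Ioo a b, ‖f' s‖ ≤ K * ‖f s‖)
    {s₁ : ℝ} (hs₁ : s₁ ∈ Ioo a b) (h0 : f s₁ = 0) : ∀ s ∈ Ioo a b, f s = 0 := by
  intro s hs
  rcases le_total s₁ s with hle | hle
  · exact eq_zero_right_of_norm_deriv_le h hb hs₁ h0 ⟨hle, hs.2⟩
  have neg_mem : ∀ {r : ℝ}, r ∈ Ioo (-b) (-a) → -r ∈ Ioo a b := fun hr ↦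
    ⟨by linarith [hr.2], by linarith [hr.1]⟩
  have := eq_zero_right_of_norm_deriv_le (f := fun r ↦ f (-r)) (f' := fun r ↦ -f' (-r)) (a := -b)
    (b := -a) (K := K) (s₁ := -s₁) (s := -s) (fun r hr ↦ by
      simpa [Function.comp_def] using (h (-r) (neg_mem hr)).scomp r (hasDerivAt_neg r))
    (fun r hr ↦ by simpa using hb (-r) (neg_mem hr))
    ⟨by linarith [hs₁.2], by linarith [hs₁.1]⟩ (by simpa using h0)
    ⟨by linarith, by linarith [hs.1]⟩
  simpa using this

end Gronwall

/-! ### Momentum equation and regularity of planar minimizers. -/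

section EulerLagrange

variable {G : Plane → Plane →L[ℝ] Plane →L[ℝ] ℝ} {Θ : Plane → Plane →L[ℝ] ℝ} {D : Set Plane}
  {u : ℝ → Plane} {a b : ℝ}

/-- The `i`-th component of the force `∂L/∂q`. -/
def planeForce (G : Plane → Plane →L[ℝ] Plane →L[ℝ] ℝ) (Θ : Plane → Plane →L[ℝ] ℝ)
    (q v : Plane) (i : Fin 2) : ℝ :=
  fderiv ℝ G q (EuclideanSpace.single i 1) v v / 2 + fderiv ℝ Θ q (EuclideanSpace.single i 1) v

/-- Testing with a scalar function times the i-th basis vector reduces this to the du Bois-Reymond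
lemma, with the momentum ∂L/∂v in the role of A and the force ∂L/∂q in the role of B. -/
theorem exists_momentum (hD : IsOpen D) (hG : ContDiffOn ℝ ∞ G D) (hΘ : ContDiffOn ℝ ∞ Θ D)
    (hsym : ∀ q ∈ D, ∀ v w, G q v w = G q w v) (hab : a < b)
    (hu : ∀ i, H1On (fun r ↦ u r i) a b) (huD : MapsTo u (Icc a b) D)
    (hmin : ∀ η : ℝ → Plane, (∀ i, H1On (fun r ↦ η r i) a b) → η a = 0 → η b = 0 →
      ∀ᶠ ε : ℝ in 𝓝[>] 0, ∫ s in a..b, planeLag G Θ (u s) (planeDeriv u s) ≤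
        ∫ s in a..b, planeLag G Θ (u s + ε • η s) (planeDeriv u s + ε • planeDeriv η s)) :
    ∃ c : Fin 2 → ℝ, ∀ i, ∀ᵐ s ∂(volume.restrict (Icc a b)),
      G (u s) (planeDeriv u s) (EuclideanSpace.single i 1) + Θ (u s) (EuclideanSpace.single i 1) =
        c i + ∫ r in a..s, planeForce G Θ (u r) (planeDeriv u r) i := by
  have huc := H1On.plane_continuousOn hab.le hu
  have huv : MemLp (planeDeriv u) 2 (volume.restrict (Icc a b)) :=
    planeDeriv_memLp fun i ↦ (hu i).memLp
  suffices key : ∀ i : Fin 2, ∃ c, ∀ᵐ s ∂(volume.restrict (Icc a b)),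
      G (u s) (planeDeriv u s) (EuclideanSpace.single i 1) + Θ (u s) (EuclideanSpace.single i 1) =
        c + ∫ r in a..s, planeForce G Θ (u r) (planeDeriv u r) i by
    choose c hc using key
    exact ⟨c, hc⟩
  intro i
  set e : Plane := EuclideanSpace.single i 1 with he
  have hGu : ContinuousOn (fun s ↦ G (u s)) (Icc a b) := hG.continuousOn.comp huc huD
  have hΘu : ContinuousOn (fun s ↦ Θ (u s)) (Icc a b) := hΘ.continuousOn.comp huc huD
  refine du_bois_reymond hab ?_ ?_ fun η hη ha hb ↦ ?_
  · refine MemLp.add ?_ ?_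
    · obtain ⟨K, hK⟩ := IsCompact.exists_bound_of_continuousOn (f := fun s ↦ G (u s))
        isCompact_Icc hGu
      refine (huv.norm.const_mul (K * ‖e‖)).mono (aestronglyMeasurable_clm_apply
        (aestronglyMeasurable_clm_apply (hGu.aestronglyMeasurable measurableSet_Icc) huv.1)
          aestronglyMeasurable_const) ?_
      filter_upwards [ae_restrict_mem measurableSet_Icc] with s hs
      calc ‖G (u s) (planeDeriv u s) e‖ ≤ ‖G (u s)‖ * ‖planeDeriv u s‖ * ‖e‖ :=
            (G (u s)).le_opNorm₂ _ _
        _ ≤ K * ‖planeDeriv u s‖ * ‖e‖ := by gcongr; exact hK s hs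
        _ = K * ‖e‖ * ‖planeDeriv u s‖ := by ring
        _ ≤ _ := le_abs_self _
    · have hc : ContinuousOn (fun s ↦ Θ (u s) e) (Icc a b) := hΘu.clm_apply continuousOn_const
      obtain ⟨K, hK⟩ := isCompact_Icc.exists_bound_of_continuousOn hc
      exact MemLp.of_bound (hc.aestronglyMeasurable measurableSet_Icc) K
        ((ae_restrict_iff' measurableSet_Icc).2 (Eventually.of_forall hK))
  · rw [intervalIntegrable_iff_integrableOn_Icc_of_le hab.le]
    exact ((integrable_bilinear (continuousOn_fderiv_apply hD hG huc huD continuousOn_const) huv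
      huv).div_const 2).add
        (integrable_linear (continuousOn_fderiv_apply hD hΘ huc huD continuousOn_const) huv)
  · have hcomp : ∀ j, (fun r ↦ (η r • e) j) = fun r ↦ e j * η r := fun j ↦ by
      ext r; simp [mul_comm]
    have hηe : ∀ j, H1On (fun r ↦ (η r • e) j) a b := by
      intro j
      rw [hcomp j]
      refine H1On.of_dominated (ι := Unit) (w := fun _ ↦ η) (K := |e j|) hab.le (fun _ ↦ hη)
        fun s _ t _ ↦ ?_
      rw [← mul_sub, abs_mul]
      simp
    have hd : planeDeriv (fun r ↦ η r • e) = fun r ↦ deriv η r • e := by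
      ext r j
      rw [planeDeriv_apply, hcomp j, deriv_const_mul_field]
      simp [mul_comm]
    have := first_variation hD hG hΘ hsym hab hu huD hηe
      (hmin _ hηe (by simp [ha]) (by simp [hb]))
    rw [hd] at this
    refine this.trans_eq ?_
    congr 1
    ext s
    simp only [planeLagDeriv, planeForce, map_smul, smul_apply, smul_eq_mul, ← he]
    ring

theorem hasDerivAt_of_eq_integral {f g : ℝ → ℝ} (hg : ContinuousOn g (Icc a b))
    (hf : ∀ t ∈ Icc a b, f t = f a + ∫ s in a..t, g s) {s : ℝ} (hs : s ∈ Ioo a b) :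
    HasDerivAt f (g s) s := by
  have h1 : HasDerivAt (fun t ↦ f a + ∫ s in a..t, g s) (g s) s := by
    refine (intervalIntegral.integral_hasDerivAt_right ?_ ?_ ?_).const_add _
    · refine (hg.mono ?_).intervalIntegrable
      rw [uIcc_of_le hs.1.le]
      exact Icc_subset_Icc_right hs.2.le
    · exact (hg.mono Ioo_subset_Icc_self).stronglyMeasurableAtFilter isOpen_Ioo s hs
    · exact hg.continuousAt (Icc_mem_nhds hs.1 hs.2)
  refine h1.congr_of_eventuallyEq ?_
  filter_upwards [isOpen_Ioo.mem_nhds hs] with r hr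
  exact hf r (Ioo_subset_Icc_self hr)

theorem integral_congr_of_ae_restrict {f g : ℝ → ℝ} (h : f =ᵐ[volume.restrict (Icc a b)] g) {t : ℝ}
    (ht : t ∈ Icc a b) : ∫ s in a..t, f s = ∫ s in a..t, g s := by
  rw [intervalIntegral.integral_of_le ht.1, intervalIntegral.integral_of_le ht.1]
  exact integral_congr_ae (ae_restrict_of_ae_restrict_of_subset
    (show Ioc a t ⊆ Icc a b from fun r hr ↦ ⟨hr.1.le, hr.2.trans ht.2⟩) h)

/-- The momentum has a continuous representative, being a primitive of the force. As G is positive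
definite, the Legendre transform inverts and gives a continuous velocity V. The kinetic momentum m =
G V is then differentiable, and its derivative is bounded by a multiple of |V|, hence of |m|. By
Gronwall a single zero of V forces V = 0 throughout. -/
theorem plane_minimizer_regular (hD : IsOpen D) (hG : ContDiffOn ℝ ∞ G D)
    (hΘ : ContDiffOn ℝ ∞ Θ D) (hsym : ∀ q ∈ D, ∀ v w, G q v w = G q w v)
    (hpos : ∀ q ∈ D, ∀ v, v ≠ 0 → 0 < G q v v) (hab : a < b)
    (hu : ∀ i, H1On (fun r ↦ u r i) a b) (huD : MapsTo u (Icc a b) D)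
    (hmin : ∀ η : ℝ → Plane, (∀ i, H1On (fun r ↦ η r i) a b) → η a = 0 → η b = 0 →
      ∀ᶠ ε : ℝ in 𝓝[>] 0, ∫ s in a..b, planeLag G Θ (u s) (planeDeriv u s) ≤
        ∫ s in a..b, planeLag G Θ (u s + ε • η s) (planeDeriv u s + ε • planeDeriv η s)) :
    ∃ V : ℝ → Plane, ContinuousOn V (Ioo a b) ∧ (∀ s ∈ Ioo a b, HasDerivAt u (V s) s) ∧
      ((∃ s ∈ Ioo a b, V s = 0) → ∀ s ∈ Ioo a b, V s = 0) := by
  obtain ⟨c, hc⟩ := exists_momentum hD hG hΘ hsym hab hu huD hmin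
  have huc := H1On.plane_continuousOn hab.le hu
  have huv : MemLp (planeDeriv u) 2 (volume.restrict (Icc a b)) :=
    planeDeriv_memLp fun i ↦ (hu i).memLp
  have hGu : ContinuousOn (fun s ↦ G (u s)) (Icc a b) := hG.continuousOn.comp huc huD
  have hΘu : ContinuousOn (fun s ↦ Θ (u s)) (Icc a b) := hΘ.continuousOn.comp huc huD
  have iF : ∀ i, IntervalIntegrable (fun r ↦ planeForce G Θ (u r) (planeDeriv u r) i) volume a b := by
    intro i
    rw [intervalIntegrable_iff_integrableOn_Icc_of_le hab.le]
    exact ((integrable_bilinear (continuousOn_fderiv_apply hD hG huc huD continuousOn_const) huv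
      huv).div_const 2).add
        (integrable_linear (continuousOn_fderiv_apply hD hΘ huc huD continuousOn_const) huv)
  set p : Fin 2 → ℝ → ℝ := fun i s ↦ c i + ∫ r in a..s, planeForce G Θ (u r) (planeDeriv u r) i
    with hp
  have hpc : ∀ i, ContinuousOn (p i) (Icc a b) := by
    intro i
    have := (primitive_absolutelyContinuous (F := p i) hab.le (iF i)
      (fun t _ ↦ by simp [hp])).continuousOn
    rwa [uIcc_of_le hab.le] at this
  set m : ℝ → Plane →L[ℝ] ℝ := fun s ↦ (∑ i, p i s • (EuclideanSpace.proj i : Plane →L[ℝ] ℝ)) - Θ (u s)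
    with hm
  have hmc : ContinuousOn m (Icc a b) :=
    (continuousOn_finsetSum _ fun i _ ↦ (hpc i).smul continuousOn_const).sub hΘu
  have hinv : ∀ s ∈ Icc a b, ∃ L : Plane ≃L[ℝ] (Plane →L[ℝ] ℝ),
      (L : Plane →L[ℝ] Plane →L[ℝ] ℝ) = G (u s) := fun s hs ↦
    isInvertible_of_posDef (hpos _ (huD hs))
  have hic : ContinuousOn (fun s ↦ ContinuousLinearMap.inverse (G (u s))) (Icc a b) := by
    intro s hs
    obtain ⟨L, hL⟩ := hinv s hs
    have h1 : ContinuousAt (ContinuousLinearMap.inverse : (Plane →L[ℝ] Plane →L[ℝ] ℝ) → _) (G (u s)) := by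
      rw [← hL]
      exact (contDiffAt_map_inverse (n := 0) L).continuousAt
    exact h1.comp_continuousWithinAt (f := fun s ↦ G (u s)) (hGu s hs)
  set V : ℝ → Plane := fun s ↦ ContinuousLinearMap.inverse (G (u s)) (m s) with hV
  have hVc : ContinuousOn V (Icc a b) := hic.clm_apply hmc
  have hGV : ∀ s ∈ Icc a b, ∀ w, G (u s) w = m s → w = V s := by
    intro s hs w hw
    obtain ⟨L, hL⟩ := hinv s hs
    simp only [hV, ← hw, ← hL, ContinuousLinearMap.inverse_equiv]
    simp
  have hVm : ∀ s ∈ Icc a b, G (u s) (V s) = m s := by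
    intro s hs
    obtain ⟨L, hL⟩ := hinv s hs
    simp only [hV, ← hL, ContinuousLinearMap.inverse_equiv]
    simp
  -- The two momentum identities together say that G(u) u' = m almost everywhere.
  have hae : planeDeriv u =ᵐ[volume.restrict (Icc a b)] V := by
    filter_upwards [ae_all_iff.2 hc, ae_restrict_mem measurableSet_Icc] with s hs hsI
    refine hGV s hsI _ ?_
    rw [clm_eq_sum (G (u s) (planeDeriv u s))]
    simp only [hm]
    conv_rhs => rw [clm_eq_sum (Θ (u s))]
    rw [← Finset.sum_sub_distrib]
    refine Finset.sum_congr rfl fun i _ ↦ ?_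
    rw [← sub_smul]
    congr 1
    linarith [hs i]
  have hud : ∀ s ∈ Ioo a b, HasDerivAt u (V s) s := by
    intro s hs
    refine hasDerivAt_plane fun i ↦ ?_
    refine hasDerivAt_of_eq_integral (g := fun s ↦ V s i) (a := a) (b := b)
      ((EuclideanSpace.proj (𝕜 := ℝ) i).continuous.comp_continuousOn hVc) (fun t ht ↦ ?_) hs
    have h1 := (hu i).integral_deriv (left_mem_Icc.2 hab.le) ht
    have h2 : (deriv fun r ↦ u r i) =ᵐ[volume.restrict (Icc a b)] fun s ↦ V s i := by
      filter_upwards [hae] with s hs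
      rw [← hs, planeDeriv_apply]
    rw [← integral_congr_of_ae_restrict h2 ht, h1]
    ring
  refine ⟨V, hVc.mono Ioo_subset_Icc_self, hud, ?_⟩
  rintro ⟨s₁, hs₁, hz⟩
  have hFc : ∀ i, ContinuousOn (fun s ↦ planeForce G Θ (u s) (V s) i) (Icc a b) := fun i ↦
    ((((continuousOn_fderiv_apply hD hG huc huD continuousOn_const).clm_apply hVc).clm_apply
      hVc).div_const 2).add
      ((continuousOn_fderiv_apply hD hΘ huc huD continuousOn_const).clm_apply hVc)
  have hpd : ∀ i, ∀ s ∈ Ioo a b, HasDerivAt (p i) (planeForce G Θ (u s) (V s) i) s := by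
    intro i s hs
    refine hasDerivAt_of_eq_integral (hFc i) (fun t ht ↦ ?_) hs
    have h2 : (fun r ↦ planeForce G Θ (u r) (planeDeriv u r) i) =ᵐ[volume.restrict (Icc a b)]
        fun r ↦ planeForce G Θ (u r) (V r) i := by
      filter_upwards [hae] with s hs
      rw [hs]
    simp only [hp, intervalIntegral.integral_same, add_zero]
    rw [integral_congr_of_ae_restrict h2 ht]
  have hmd : ∀ s ∈ Ioo a b, HasDerivAt m ((∑ i, planeForce G Θ (u s) (V s) i •
      (EuclideanSpace.proj i : Plane →L[ℝ] ℝ)) - fderiv ℝ Θ (u s) (V s)) s := by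
    intro s hs
    refine HasDerivAt.sub (HasDerivAt.fun_sum fun i _ ↦ HasDerivAt.smul_const (F := Plane →L[ℝ] ℝ) (hpd i s hs) _) ?_
    have h1 := ((hΘ.contDiffAt (hD.mem_nhds (huD (Ioo_subset_Icc_self hs)))).differentiableAt
      (by simp)).hasFDerivAt
    exact h1.comp_hasDerivAt s (hud s hs)
  have hC : IsCompact (u '' Icc a b) := isCompact_Icc.image_of_continuousOn huc
  have hCD : u '' Icc a b ⊆ D := huD.image_subset
  obtain ⟨_, _, K₁, hK₁, h₁⟩ := exists_uniform_taylor hD hG hC hCD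
  obtain ⟨_, _, K₂, hK₂, h₂⟩ := exists_uniform_taylor hD hΘ hC hCD
  obtain ⟨K₃, h₃⟩ := isCompact_Icc.exists_bound_of_continuousOn hVc
  obtain ⟨K₄, h₄⟩ := IsCompact.exists_bound_of_continuousOn
    (f := fun s ↦ ContinuousLinearMap.inverse (G (u s))) isCompact_Icc hic
  have hm0 : m s₁ = 0 := by
    rw [← hVm s₁ (Ioo_subset_Icc_self hs₁), hz, map_zero]
  have hK₃ : 0 ≤ K₃ := (norm_nonneg _).trans (h₃ a (left_mem_Icc.2 hab.le))
  have hVle : ∀ s ∈ Icc a b, ‖V s‖ ≤ K₄ * ‖m s‖ := fun s hs ↦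
    ((ContinuousLinearMap.inverse (G (u s))).le_opNorm _).trans (by gcongr; exact h₄ s hs)
  -- The force is quadratic plus linear in V without a constant term; one factor of the quadratic
  -- part is absorbed by the bound `K₃` on V.
  have hFle : ∀ i, ∀ s ∈ Icc a b, |planeForce G Θ (u s) (V s) i| ≤ (K₁ * K₃ + K₂) * ‖V s‖ := by
    intro i s hs
    have g1 := (h₁ (u s) (mem_image_of_mem u hs)).2.1 (EuclideanSpace.single i 1)
    have g2 := (h₂ (u s) (mem_image_of_mem u hs)).2.1 (EuclideanSpace.single i 1)
    simp only [PiLp.norm_single, norm_one, mul_one] at g1 g2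
    have k1 : |fderiv ℝ G (u s) (EuclideanSpace.single i 1) (V s) (V s)| ≤ K₁ * K₃ * ‖V s‖ :=
      ((fderiv ℝ G (u s) (EuclideanSpace.single i 1)).le_opNorm₂ _ _).trans
        (by gcongr; exact h₃ s hs)
    have k2 : |fderiv ℝ Θ (u s) (EuclideanSpace.single i 1) (V s)| ≤ K₂ * ‖V s‖ :=
      ((fderiv ℝ Θ (u s) (EuclideanSpace.single i 1)).le_opNorm _).trans (by gcongr)
    have k3 : 0 ≤ K₁ * K₃ * ‖V s‖ := by positivity
    unfold planeForce
    refine (abs_add_le _ _).trans ?_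
    rw [abs_div, abs_two]
    linarith
  have hpr : ∀ i : Fin 2, ‖(EuclideanSpace.proj i : Plane →L[ℝ] ℝ)‖ ≤ 1 := fun i ↦
    ContinuousLinearMap.opNorm_le_bound _ zero_le_one fun w ↦ by
      simpa using PiLp.norm_apply_le w i
  -- In the constant, the doubled term comes from the two force components, the extra `K₂` from
  -- differentiating Θ along u, and `K₄` from |V| ≤ `K₄` |m|.
  have hall := eq_zero_of_norm_deriv_le (K := (2 * (K₁ * K₃ + K₂) + K₂) * K₄) hmd (fun s hs ↦ by
    have hs' := Ioo_subset_Icc_self hs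
    have t1 := (h₂ (u s) (mem_image_of_mem u hs')).2.1 (V s)
    have t2 : ∀ i, ‖planeForce G Θ (u s) (V s) i • (EuclideanSpace.proj i : Plane →L[ℝ] ℝ)‖ ≤
        (K₁ * K₃ + K₂) * ‖V s‖ := fun i ↦ by
      rw [norm_smul]
      exact (mul_le_of_le_one_right (norm_nonneg _) (hpr i)).trans (hFle i s hs')
    have t3 := norm_sum_le (Finset.univ : Finset (Fin 2)) fun i ↦
      planeForce G Θ (u s) (V s) i • (EuclideanSpace.proj i : Plane →L[ℝ] ℝ)
    rw [Fin.sum_univ_two (fun i ↦ ‖planeForce G Θ (u s) (V s) i •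
      (EuclideanSpace.proj i : Plane →L[ℝ] ℝ)‖)] at t3
    have t4 : (2 * (K₁ * K₃ + K₂) + K₂) * ‖V s‖ ≤ (2 * (K₁ * K₃ + K₂) + K₂) * (K₄ * ‖m s‖) := by
      gcongr; exact hVle s hs'
    refine (norm_sub_le _ _).trans ?_
    linarith [t2 0, t2 1]) hs₁ hm0
  intro s hs
  have := hVle s (Ioo_subset_Icc_self hs)
  rw [hall s hs, norm_zero, mul_zero] at this
  exact norm_le_zero_iff.1 this

end EulerLagrange

theorem exists_lipschitz_bounds {F : Plane → ℝ} {D B : Set Plane} (hD : IsOpen D)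
    (hF : ContDiffOn ℝ ∞ F D) (hB : IsCompact B) (hconv : Convex ℝ B) (hBD : B ⊆ D) :
    ∃ K, 0 ≤ K ∧ ∀ q ∈ B, ‖fderiv ℝ F q‖ ≤ K ∧ ∀ p ∈ B, |F p - F q| ≤ K * ‖p - q‖ ∧
      ‖fderiv ℝ F p - fderiv ℝ F q‖ ≤ K * ‖p - q‖ := by
  have hF1 : ContDiffOn ℝ ∞ (fderiv ℝ F) D := hF.fderiv_of_isOpen hD (by simp)
  have hF2 : ContDiffOn ℝ ∞ (fderiv ℝ (fderiv ℝ F)) D := hF1.fderiv_of_isOpen hD (by simp)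
  obtain ⟨K1, hK1⟩ := IsCompact.exists_bound_of_continuousOn (f := fderiv ℝ F) hB
    (hF1.continuousOn.mono hBD)
  obtain ⟨K2, hK2⟩ := IsCompact.exists_bound_of_continuousOn (f := fderiv ℝ (fderiv ℝ F)) hB
    (hF2.continuousOn.mono hBD)
  refine ⟨max 0 (max K1 K2), le_max_left _ _, fun q hq ↦
    ⟨(hK1 q hq).trans (by simp), fun p hp ↦ ⟨?_, ?_⟩⟩⟩
  · exact hconv.norm_image_sub_le_of_norm_hasFDerivWithin_le (f := F) (f' := fderiv ℝ F)
      (fun r hr ↦ (((hF.contDiffAt (hD.mem_nhds (hBD hr))).differentiableAt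
        (by simp)).hasFDerivAt).hasFDerivWithinAt) (fun r hr ↦ (hK1 r hr).trans (by simp)) hq hp
  · exact hconv.norm_image_sub_le_of_norm_hasFDerivWithin_le (f := fderiv ℝ F)
      (f' := fderiv ℝ (fderiv ℝ F))
      (fun r hr ↦ (((hF1.contDiffAt (hD.mem_nhds (hBD hr))).differentiableAt
        (by simp)).hasFDerivAt).hasFDerivWithinAt) (fun r hr ↦ (hK2 r hr).trans (by simp)) hq hp

theorem tendsto_eLpNorm_of_le_mul {μ : Measure ℝ} {d : ℝ → ℝ → ℝ} {Ψ : ℝ → ℝ} (hΨ : MemLp Ψ 2 μ)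
    (h : ∀ᶠ ε : ℝ in 𝓝[>] 0, ∀ᵐ s ∂μ, |d ε s| ≤ ε * Ψ s) :
    Tendsto (fun ε ↦ eLpNorm (d ε) 2 μ) (𝓝[>] 0) (𝓝 0) := by
  have h1 : ∀ᶠ ε : ℝ in 𝓝[>] 0, eLpNorm (d ε) 2 μ ≤ ENNReal.ofReal ε * eLpNorm Ψ 2 μ := by
    filter_upwards [h, self_mem_nhdsWithin] with ε hε hpos
    refine eLpNorm_le_mul_eLpNorm_of_ae_le_mul ?_ 2
    filter_upwards [hε] with s hs
    exact hs.trans (mul_le_mul_of_nonneg_left (le_abs_self _) (le_of_lt hpos))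
  have h2 : Tendsto (fun ε : ℝ ↦ ENNReal.ofReal ε * eLpNorm Ψ 2 μ) (𝓝[>] 0) (𝓝 0) := by
    have h3 : Tendsto (fun ε : ℝ ↦ ENNReal.ofReal ε) (𝓝[>] 0) (𝓝 0) := by
      have := (ENNReal.continuous_ofReal.tendsto 0).mono_left
        (nhdsWithin_le_nhds (s := Ioi (0 : ℝ)))
      rwa [ENNReal.ofReal_zero] at this
    have := ENNReal.Tendsto.mul_const h3 (b := eLpNorm Ψ 2 μ) (Or.inr hΨ.2.ne)
    rwa [zero_mul] at this
  exact tendsto_of_tendsto_of_tendsto_of_le_of_le' tendsto_const_nhds h2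
    (Eventually.of_forall fun _ ↦ zero_le) h1

theorem abs_apply_add_smul_sub_le {A A' : Plane →L[ℝ] ℝ} {v w : Plane} {ε K H : ℝ} (hε : 0 < ε)
    (h1 : ‖A' - A‖ ≤ K * (ε * H)) (h2 : ‖A'‖ ≤ K) :
    |A' (v + ε • w) - A v| ≤ ε * (K * H * ‖v‖ + K * ‖w‖) := by
  have e : A' (v + ε • w) - A v = (A' - A) v + ε * A' w := by
    rw [map_add, map_smul, sub_apply, smul_eq_mul]; ring
  have b1 : |(A' - A) v| ≤ K * (ε * H) * ‖v‖ :=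
    ((A' - A).le_opNorm v).trans (mul_le_mul_of_nonneg_right h1 (norm_nonneg v))
  have b2 : |A' w| ≤ K * ‖w‖ := (A'.le_opNorm w).trans (mul_le_mul_of_nonneg_right h2 (norm_nonneg w))
  have b3 := mul_le_mul_of_nonneg_left b2 hε.le
  rw [e]
  refine (abs_add_le _ _).trans ?_
  rw [abs_mul, abs_of_pos hε]
  linarith

/-! ### Variations of a loop supported in one chart. -/

section Variation

variable {M : Type*} [TopologicalSpace M] [ChartedSpace Plane M]

theorem contDiffOn_smoothFun_symm (f : SmoothFun M) {φ : OpenPartialHomeomorph M Plane}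
    (hφ : φ ∈ IsManifold.maximalAtlas (𝓡 2) ∞ M) :
    ContDiffOn ℝ ∞ (fun q ↦ f (φ.symm q)) φ.target :=
  contMDiffOn_iff_contDiffOn.1 (f.contMDiff.comp_contMDiffOn (contMDiffOn_symm_of_mem_maximalAtlas hφ))

theorem H1On.smoothFun_symm (f : SmoothFun M) {φ : OpenPartialHomeomorph M Plane}
    (hφ : φ ∈ IsManifold.maximalAtlas (𝓡 2) ∞ M) {c : Plane} {r : ℝ}
    (hc : Metric.closedBall c r ⊆ φ.target) {a b : ℝ} (hab : a ≤ b) {u η : ℝ → Plane}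
    (hu : ∀ i, H1On (fun s ↦ u s i) a b) (hη : ∀ i, H1On (fun s ↦ η s i) a b) {ε : ℝ}
    (hmem : ∀ s ∈ Icc a b, u s + ε • η s ∈ Metric.closedBall c r) :
    H1On (fun s ↦ f (φ.symm (u s + ε • η s))) a b := by
  obtain ⟨K, hK0, hK⟩ := exists_lipschitz_bounds φ.open_target (contDiffOn_smoothFun_symm f hφ)
    (isCompact_closedBall c r) (convex_closedBall c r) hc
  refine H1On.of_dominated (ι := Fin 2 ⊕ Fin 2)
    (w := Sum.elim (fun i s ↦ u s i) (fun i s ↦ η s i)) (K := K * (1 + |ε|)) hab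
    (by rintro (i | i); exacts [hu i, hη i]) fun s hs t ht ↦ ?_
  refine ((hK _ (hmem t ht)).2 _ (hmem s hs)).1.trans ?_
  rw [mul_assoc, Fintype.sum_sum_type]
  refine mul_le_mul_of_nonneg_left ?_ hK0
  simp only [Sum.elim_inl, Sum.elim_inr]
  have norm_le : ∀ p : Plane, ‖p‖ ≤ ∑ i, |p i| := by
    intro p
    rw [EuclideanSpace.norm_eq]
    refine Real.sqrt_le_iff.2 ⟨by positivity, ?_⟩
    simp only [Fin.sum_univ_two, Real.norm_eq_abs, sq_abs]
    nlinarith [abs_nonneg (p 0), abs_nonneg (p 1), sq_abs (p 0), sq_abs (p 1),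
      mul_nonneg (abs_nonneg (p 0)) (abs_nonneg (p 1))]
  have e : u s + ε • η s - (u t + ε • η t) = (u s - u t) + ε • (η s - η t) := by
    rw [smul_sub]; abel
  have h1 := norm_le (u s - u t)
  have h2 := norm_le (η s - η t)
  simp only [PiLp.sub_apply] at h1 h2
  have n1 := norm_nonneg (u s - u t)
  have n2 := norm_nonneg (η s - η t)
  calc ‖u s + ε • η s - (u t + ε • η t)‖ ≤ ‖u s - u t‖ + |ε| * ‖η s - η t‖ := by
        rw [e]
        refine (norm_add_le _ _).trans ?_
        rw [norm_smul, Real.norm_eq_abs]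
    _ ≤ (∑ i, |u s i - u t i|) + |ε| * ∑ i, |η s i - η t i| := by gcongr
    _ ≤ (1 + |ε|) * _ := by
        have m1 := mul_nonneg (abs_nonneg ε) (n1.trans h1)
        have m2 := n2.trans h2
        linarith

theorem hasDerivAt_smoothFun_symm (f : SmoothFun M) {φ : OpenPartialHomeomorph M Plane}
    (hφ : φ ∈ IsManifold.maximalAtlas (𝓡 2) ∞ M) {w : ℝ → Plane} {v : Plane} {s : ℝ}
    (hw : w s ∈ φ.target) (hd : HasDerivAt w v s) :
    HasDerivAt (fun r ↦ f (φ.symm (w r))) (fderiv ℝ (fun q ↦ f (φ.symm q)) (w s) v) s :=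
  (((contDiffOn_smoothFun_symm f hφ).contDiffAt
    (φ.open_target.mem_nhds hw)).differentiableAt (by simp)).hasFDerivAt.comp_hasDerivAt s hd

/-- The loop is moved by ε η in the chart on [a, b] and kept elsewhere; the zeros of η at a and b
make the pieces match. In H¹ the difference is O(ε). The ball of radius 2r leaves room for a
perturbation of size r and is convex, as the Lipschitz bounds require. -/
theorem exists_variation (x : H1Loop M) {φ : OpenPartialHomeomorph M Plane}
    (hφ : φ ∈ IsManifold.maximalAtlas (𝓡 2) ∞ M) {c : Plane} {r : ℝ} (hr : 0 < r)
    (hc : Metric.closedBall c (2 * r) ⊆ φ.target) {a b : ℝ} (ha : 0 < a) (hab : a < b) (hb : b < 1)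
    (hx : ∀ s ∈ Icc a b, x s ∈ φ.source ∧ φ (x s) ∈ Metric.closedBall c r)
    (hu : ∀ i, H1On (fun s ↦ φ (x s) i) a b) {η : ℝ → Plane}
    (hη : ∀ i, H1On (fun s ↦ η s i) a b) (hηa : η a = 0) (hηb : η b = 0) :
    ∃ y : ℝ → H1Loop M, Tendsto y (𝓝[>] 0) (𝓝 x) ∧ ∀ᶠ ε : ℝ in 𝓝[>] 0,
      (∀ s ∈ Icc 0 a ∪ Icc b 1, y ε s = x s) ∧
      ∀ s ∈ Icc a b, φ (x s) + ε • η s ∈ φ.target ∧ y ε s = φ.symm (φ (x s) + ε • η s) := by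
  obtain ⟨H, hH⟩ := isCompact_Icc.exists_bound_of_continuousOn (H1On.plane_continuousOn hab.le hη)
  have hH0 : 0 ≤ H := (norm_nonneg _).trans (hH a (left_mem_Icc.2 hab.le))
  have hsmall : ∀ᶠ ε : ℝ in 𝓝[>] 0, ∀ s ∈ Icc a b,
      φ (x s) + ε • η s ∈ Metric.closedBall c (2 * r) := by
    have h1 : Tendsto (fun ε : ℝ ↦ ε * H) (𝓝[>] 0) (𝓝 (0 * H)) :=
      (tendsto_id.mul_const H).mono_left nhdsWithin_le_nhds
    rw [zero_mul] at h1
    filter_upwards [h1.eventually (Iio_mem_nhds hr), self_mem_nhdsWithin] with ε hε hpos s hs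
    have hpos : 0 < ε := hpos
    rw [mem_closedBall_iff_norm]
    have h2 := mem_closedBall_iff_norm.1 (hx s hs).2
    have h3 : ‖ε • η s‖ ≤ r := by
      rw [norm_smul, Real.norm_eq_abs, abs_of_pos hpos]
      exact (mul_le_mul_of_nonneg_left (hH s hs) hpos.le).trans (le_of_lt hε)
    calc ‖φ (x s) + ε • η s - c‖ = ‖(φ (x s) - c) + ε • η s‖ := by congr 1; abel
      _ ≤ r + r := (norm_add_le _ _).trans (add_le_add h2 h3)
      _ = 2 * r := by ring
  classical
  set w : ℝ → ℝ → M := fun ε s ↦ if s ∈ Icc a b then φ.symm (φ (x s) + ε • η s) else x s with hw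
  have hwin : ∀ ε, ∀ s ∈ Icc a b, w ε s = φ.symm (φ (x s) + ε • η s) := fun ε s hs ↦ if_pos hs
  have hwout : ∀ ε, ∀ s ∈ Icc 0 a ∪ Icc b 1, w ε s = x s := by
    intro ε s hs
    by_cases h : s ∈ Icc a b
    · rw [hwin ε s h]
      have : η s = 0 := by
        rcases hs with hs | hs
        · rw [le_antisymm hs.2 h.1, hηa]
        · rw [le_antisymm h.2 hs.1, hηb]
      rw [this, smul_zero, add_zero, φ.left_inv (hx s h).1]
    · exact if_neg h
  have hex : ∀ᶠ ε : ℝ in 𝓝[>] 0, ∃ z : H1Loop M, ∀ s ∈ Icc (0 : ℝ) 1, z s = w ε s := by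
    filter_upwards [hsmall] with ε hε
    have h01 : w ε 0 = w ε 1 := by
      rw [hwout ε 0 (Or.inl ⟨le_rfl, ha.le⟩), hwout ε 1 (Or.inr ⟨hb.le, le_rfl⟩)]
      simpa using (x.periodic' 0).symm
    have hH1 : ∀ f : SmoothFun M, H1On (fun s ↦ f (w ε s)) 0 1 := by
      intro f
      have p1 : H1On (fun s ↦ f (w ε s)) 0 a := (x.h1On f 0 a).congr ha.le fun s hs ↦ by
        simp only [hwout ε s (Or.inl hs)]
      have p2 : H1On (fun s ↦ f (w ε s)) a b :=
        (H1On.smoothFun_symm f hφ hc hab.le hu hη hε).congr hab.le fun s hs ↦ by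
          simp only [hwin ε s hs]
      have p3 : H1On (fun s ↦ f (w ε s)) b 1 := (x.h1On f b 1).congr hb.le fun s hs ↦ by
        simp only [hwout ε s (Or.inr hs)]
      exact (p1.glue ha.le hab.le p2).glue (ha.le.trans hab.le) hb.le p3
    exact ⟨H1Loop.ofPath (w ε) h01 hH1, fun s hs ↦ H1Loop.ofPath_apply hs⟩
  set y : ℝ → H1Loop M := fun ε ↦
    if h : ∃ z : H1Loop M, ∀ s ∈ Icc (0 : ℝ) 1, z s = w ε s then h.choose else x with hy
  have hyw : ∀ᶠ ε : ℝ in 𝓝[>] 0, ∀ s ∈ Icc (0 : ℝ) 1, y ε s = w ε s := by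
    filter_upwards [hex] with ε hε
    simp only [hy, dif_pos hε]
    exact hε.choose_spec
  have hI : Icc a b ⊆ Icc 0 1 := Icc_subset_Icc ha.le hb.le
  refine ⟨y, ?_, ?_⟩
  · rw [tendsto_loop_iff]
    intro f
    obtain ⟨K, hK0, hK⟩ := exists_lipschitz_bounds φ.open_target (contDiffOn_smoothFun_symm f hφ)
      (isCompact_closedBall c (2 * r)) (convex_closedBall c (2 * r)) hc
    have hxball : ∀ s ∈ Icc a b, φ (x s) ∈ Metric.closedBall c (2 * r) := fun s hs ↦
      Metric.closedBall_subset_closedBall (by linarith) (hx s hs).2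
    have hdist : ∀ ε : ℝ, 0 < ε → ∀ s ∈ Icc a b, ‖φ (x s) + ε • η s - φ (x s)‖ ≤ ε * H := by
      intro ε hε s hs
      rw [add_sub_cancel_left, norm_smul, Real.norm_eq_abs, abs_of_pos hε]
      exact mul_le_mul_of_nonneg_left (hH s hs) hε.le
    constructor
    · refine tendsto_eLpNorm_of_le_mul (Ψ := fun _ ↦ K * H) (memLp_const _) ?_
      filter_upwards [hyw, hsmall, self_mem_nhdsWithin] with ε hε hs2 hpos
      have hpos : 0 < ε := hpos
      filter_upwards [ae_restrict_mem measurableSet_Icc] with s hs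
      rw [hε s hs]
      by_cases h : s ∈ Icc a b
      · rw [hwin ε s h]
        have h1 := ((hK _ (hxball s h)).2 _ (hs2 s h)).1
        simp only [φ.left_inv (hx s h).1] at h1
        refine h1.trans ?_
        have := mul_le_mul_of_nonneg_left (hdist ε hpos s h) hK0
        linarith
      · simp only [hw, if_neg h, sub_self, abs_zero]
        positivity
    · have hψ : MemLp (fun s ↦ K * H * ‖planeDeriv (fun s ↦ φ (x s)) s‖ + K * ‖planeDeriv η s‖) 2
          (volume.restrict (Icc a b)) :=
        ((planeDeriv_memLp fun i ↦ (hu i).memLp).norm.const_mul _).add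
          ((planeDeriv_memLp fun i ↦ (hη i).memLp).norm.const_mul _)
      have hΨ := (hψ.indicator (μ := volume.restrict (Icc a b)) measurableSet_Icc (s := Icc a b))
      rw [memLp_indicator_iff_restrict measurableSet_Icc, Measure.restrict_restrict measurableSet_Icc,
        inter_self, ← memLp_indicator_iff_restrict measurableSet_Icc] at hΨ
      refine tendsto_eLpNorm_of_le_mul (hΨ.restrict _) ?_
      filter_upwards [hyw, hsmall, self_mem_nhdsWithin] with ε hε hs2 hpos
      have hpos : 0 < ε := hpos
      have hd1 : ∀ᵐ s ∂(volume.restrict (Icc a b)),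
          HasDerivAt (fun s ↦ φ (x s)) (planeDeriv (fun s ↦ φ (x s)) s) s :=
        H1On.planeDeriv_hasDerivAt hab.le hu
      have hd2 : ∀ᵐ s ∂(volume.restrict (Icc a b)), HasDerivAt η (planeDeriv η s) s :=
        H1On.planeDeriv_hasDerivAt hab.le hη
      rw [ae_restrict_iff' measurableSet_Icc] at hd1 hd2
      -- Away from the two endpoints, near s the varied loop is given by a single one of its two
      -- formulas.
      have hne : ∀ᵐ s : ℝ, s ≠ a ∧ s ≠ b := by
        have : ({a, b} : Set ℝ).Finite := by simp
        filter_upwards [this.countable.ae_notMem volume] with s hs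
        simpa using hs
      filter_upwards [ae_restrict_of_ae hd1, ae_restrict_of_ae hd2, ae_restrict_of_ae hne,
        ae_restrict_Icc_mem_Ioo 0 1] with s h1 h2 h3 hs
      by_cases h : s ∈ Icc a b
      · have ho : s ∈ Ioo a b := ⟨lt_of_le_of_ne h.1 (Ne.symm h3.1), lt_of_le_of_ne h.2 h3.2⟩
        have g1 := hasDerivAt_smoothFun_symm f hφ (w := fun s ↦ φ (x s)) (hc (hxball s h)) (h1 h)
        have g0 : HasDerivAt (fun s ↦ φ (x s) + ε • η s)
            (planeDeriv (fun s ↦ φ (x s)) s + ε • planeDeriv η s) s :=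
          (h1 h).add ((h2 h).const_smul ε)
        have g2 := hasDerivAt_smoothFun_symm f hφ (w := fun s ↦ φ (x s) + ε • η s) (hc (hs2 s h)) g0
        have e1 : deriv (fun s ↦ f (x s)) s = _ := (g1.congr_of_eventuallyEq (by
          filter_upwards [isOpen_Ioo.mem_nhds ho] with t ht
          rw [φ.left_inv (hx t (Ioo_subset_Icc_self ht)).1])).deriv
        have e2 : deriv (fun s ↦ f (y ε s)) s = _ := (g2.congr_of_eventuallyEq (by
          filter_upwards [isOpen_Ioo.mem_nhds ho] with t ht
          rw [hε t (hI (Ioo_subset_Icc_self ht)), hwin ε t (Ioo_subset_Icc_self ht)])).deriv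
        rw [e1, e2, indicator_of_mem h]
        obtain ⟨k1, k2⟩ := hK _ (hxball s h)
        have k3 := (k2 _ (hs2 s h)).2
        have k4 := (hK _ (hs2 s h)).1
        exact abs_apply_add_smul_sub_le hpos
          (k3.trans (mul_le_mul_of_nonneg_left (hdist ε hpos s h) hK0)) k4
      · have e : deriv (fun s ↦ f (y ε s)) s = deriv (fun s ↦ f (x s)) s := by
          refine Filter.EventuallyEq.deriv_eq ?_
          filter_upwards [isClosed_Icc.isOpen_compl.mem_nhds h, isOpen_Ioo.mem_nhds hs] with t ht ht'
          rw [hε t (Ioo_subset_Icc_self ht')]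
          simp only [hw, if_neg ht]
        rw [e, indicator_of_notMem h]
        simp
  · filter_upwards [hyw, hsmall] with ε hε hs
    refine ⟨fun s h ↦ ?_, fun s h ↦ ⟨hc (hs s h), ?_⟩⟩
    · rw [hε s ?_, hwout ε s h]
      rcases h with h | h
      · exact ⟨h.1, by linarith [h.2]⟩
      · exact ⟨by linarith [h.1], h.2⟩
    · rw [hε s (hI h), hwin ε s h]

end Variation

/-! ### Metric, form and action in a chart. -/

section ChartExpression

variable {M : Type*} [TopologicalSpace M] [ChartedSpace Plane M]

theorem mfderiv_symm_injective {φ : OpenPartialHomeomorph M Plane}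
    (hφ : φ ∈ IsManifold.maximalAtlas (𝓡 2) ∞ M) {q : Plane} (hq : q ∈ φ.target) :
    Function.Injective (mfderiv (𝓡 2) (𝓡 2) φ.symm q) := by
  have h : φ.MDifferentiable (𝓡 2) (𝓡 2) :=
    ⟨(contMDiffOn_of_mem_maximalAtlas hφ).mdifferentiableOn (by simp),
      (contMDiffOn_symm_of_mem_maximalAtlas hφ).mdifferentiableOn (by simp)⟩
  exact h.symm.mfderiv_injective hq

theorem tendsto_shift_curve (α : CurveSpace M) (σ : ℝ) :
    Tendsto (fun γ : CurveSpace M ↦ ((γ.1.shift (-σ), γ.2) : CurveSpace M))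
      (𝓝 (α.1.shift σ, α.2)) (𝓝 α) := by
  have h := tendsto_shift (l := 𝓝 ((α.1.shift σ, α.2) : CurveSpace M))
    (y := fun β : CurveSpace M ↦ β.1) (x := α.1.shift σ) continuous_fst.continuousAt (-σ)
  have e : (α.1.shift σ).shift (-σ) = α.1 := H1Loop.ext fun s ↦ by
    simp only [H1Loop.shift_apply]; congr 1; ring
  rw [e] at h
  exact h.prodMk_nhds continuous_snd.continuousAt

variable [IsManifold (𝓡 2) ∞ M] (g : SmoothMetric M) (θ : SmoothOneForm M)

theorem metricCoeff_symm (φ : OpenPartialHomeomorph M Plane) (q v w : Plane) :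
    metricCoeff g φ q v w = metricCoeff g φ q w v :=
  g.symm _ _ _

theorem metricCoeff_pos {φ : OpenPartialHomeomorph M Plane}
    (hφ : φ ∈ IsManifold.maximalAtlas (𝓡 2) ∞ M) {q : Plane} (hq : q ∈ φ.target) {v : Plane}
    (hv : v ≠ 0) : 0 < metricCoeff g φ q v v := by
  refine g.pos _ _ fun h ↦ hv ?_
  exact mfderiv_symm_injective hφ hq (h.trans
    (mfderiv (𝓡 2) (𝓡 2) φ.symm q : Plane →L[ℝ] Plane).map_zero.symm)

theorem contDiffOn_smul_metricCoeff {φ : OpenPartialHomeomorph M Plane}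
    (hφ : φ ∈ IsManifold.maximalAtlas (𝓡 2) ∞ M) (t : ℝ) :
    ContDiffOn ℝ ∞ (fun q ↦ t • metricCoeff g φ q) φ.target := by
  rw [contDiffOn_clm_apply]
  intro v
  rw [contDiffOn_clm_apply]
  intro w
  exact contDiffOn_const.mul
    (((contDiffOn_metricCoeff g hφ).clm_apply contDiffOn_const).clm_apply contDiffOn_const)

theorem contDiffOn_smul_formCoeff {φ : OpenPartialHomeomorph M Plane}
    (hφ : φ ∈ IsManifold.maximalAtlas (𝓡 2) ∞ M) (t : ℝ) :
    ContDiffOn ℝ ∞ (fun q ↦ t • formCoeff θ φ q) φ.target := by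
  rw [contDiffOn_clm_apply]
  intro v
  exact contDiffOn_const.mul ((contDiffOn_formCoeff θ hφ).clm_apply contDiffOn_const)

theorem integral_lagAlong_congr {T : ℝ} {w w' : ℝ → M} {a b : ℝ} (hab : a ≤ b)
    (h : ∀ s ∈ Icc a b, w s = w' s) :
    ∫ s in a..b, lagAlong g θ T w s = ∫ s in a..b, lagAlong g θ T w' s := by
  rw [intervalIntegral.integral_of_le hab, intervalIntegral.integral_of_le hab,
    integral_Ioc_eq_integral_Ioo, integral_Ioc_eq_integral_Ioo]
  refine setIntegral_congr_fun measurableSet_Ioo fun s hs ↦ lagAlong_congr g θ ?_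
  filter_upwards [isOpen_Ioo.mem_nhds hs] with r hr
  exact h r (Ioo_subset_Icc_self hr)

/-- The period is absorbed into the coefficients: the quadratic part at T⁻¹v carries T⁻², the linear
part T⁻¹. -/
theorem integral_lagAlong_chart {φ : OpenPartialHomeomorph M Plane}
    (hφ : φ ∈ IsManifold.maximalAtlas (𝓡 2) ∞ M) (T : ℝ) {w : ℝ → M} {u v : ℝ → Plane} {a b : ℝ}
    (hab : a ≤ b) (h : ∀ s ∈ Icc a b, u s ∈ φ.target ∧ w s = φ.symm (u s))
    (hu : ∀ᵐ s ∂(volume.restrict (Icc a b)), HasDerivAt u (v s) s) :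
    ∫ s in a..b, lagAlong g θ T w s = ∫ s in a..b,
      planeLag (fun q ↦ (T⁻¹ ^ 2) • metricCoeff g φ q) (fun q ↦ T⁻¹ • formCoeff θ φ q) (u s) (v s) := by
  refine integral_congr_of_ae_restrict ?_ (right_mem_Icc.2 hab)
  filter_upwards [hu, ae_restrict_Icc_mem_Ioo a b] with s hd hs
  rw [lagAlong_chart g θ hφ T (u := u) ?_ (h s (Ioo_subset_Icc_self hs)).1 hd]
  · simp only [planeLag, map_smul, smul_apply, smul_eq_mul]
    ring
  · filter_upwards [isOpen_Ioo.mem_nhds hs] with r hr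
    exact (h r (Ioo_subset_Icc_self hr)).2

theorem isLocalMin_shift {κ : ℝ} {x : H1Loop M} {T : Ioi (0 : ℝ)}
    (hmin : IsLocalMin (action g θ κ) (x, T)) (σ : ℝ) :
    IsLocalMin (action g θ κ) (x.shift σ, T) := by
  have hm : ∀ᶠ β in 𝓝 (x, T), action g θ κ (x, T) ≤ action g θ κ β := hmin
  change ∀ᶠ β in 𝓝 (x.shift σ, T), action g θ κ (x.shift σ, T) ≤ action g θ κ β
  filter_upwards [(tendsto_shift_curve (x, T) σ).eventually hm] with β hβ
  rw [action_shift] at hβ ⊢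
  exact hβ

end ChartExpression

/-! ### Regularity of local minimizers of the action. -/

section Minimizers

variable {M : Type*} [TopologicalSpace M] [ChartedSpace Plane M] [IsManifold (𝓡 2) ∞ M]
  [T2Space M] [CompactSpace M] (g : SmoothMetric M) (θ : SmoothOneForm M)

/-- Both loops have the same period, so the κ-terms cancel, as do the contributions outside [a, b].
-/
theorem integral_lagAlong_le_of_action_le {κ : ℝ} {x y : H1Loop M} {T : Ioi (0 : ℝ)}
    (h : action g θ κ (x, T) ≤ action g θ κ (y, T)) {a b : ℝ} (ha : 0 ≤ a) (hb : b ≤ 1)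
    (hxy : ∀ s ∈ Icc 0 a ∪ Icc b 1, y s = x s) :
    ∫ s in a..b, lagAlong g θ T x.toFun s ≤ ∫ s in a..b, lagAlong g θ T y.toFun s := by
  rw [action_eq, action_eq] at h
  have h1 := le_of_mul_le_mul_left h T.2
  have hi := fun z : H1Loop M ↦ intervalIntegrable_lagAlong g θ z T
  rw [intervalIntegral.integral_add (hi x 0 1) intervalIntegrable_const,
    intervalIntegral.integral_add (hi y 0 1) intervalIntegrable_const] at h1
  have hsplit : ∀ z : H1Loop M, ∫ s in (0 : ℝ)..1, lagAlong g θ T z.toFun s =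
      (∫ s in (0 : ℝ)..a, lagAlong g θ T z.toFun s) + (∫ s in a..b, lagAlong g θ T z.toFun s) +
        ∫ s in b..1, lagAlong g θ T z.toFun s := fun z ↦ by
    rw [intervalIntegral.integral_add_adjacent_intervals (hi z 0 a) (hi z a b),
      intervalIntegral.integral_add_adjacent_intervals (hi z 0 b) (hi z b 1)]
  rw [hsplit x, hsplit y, integral_lagAlong_congr g θ ha fun s hs ↦ hxy s (Or.inl hs),
    integral_lagAlong_congr g θ hb fun s hs ↦ hxy s (Or.inr hs)] at h1
  linarith

/-- The base time 1/2 keeps the varied interval inside (0, 1), away from the point where a loop is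
closed up; other times follow by shift invariance. -/
theorem minimizer_regular_half {κ : ℝ} {x : H1Loop M} {T : Ioi (0 : ℝ)}
    (hmin : IsLocalMin (action g θ κ) (x, T)) :
    ∃ δ > 0, ∃ V : ℝ → Plane,
      (∀ s ∈ Ioo (1 / 2 - δ) (1 / 2 + δ), x s ∈ (chartAt Plane (x (1 / 2))).source) ∧
      ContinuousOn V (Ioo (1 / 2 - δ) (1 / 2 + δ)) ∧
      (∀ s ∈ Ioo (1 / 2 - δ) (1 / 2 + δ),
        HasDerivAt (fun s ↦ chartAt Plane (x (1 / 2)) (x s)) (V s) s) ∧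
      ((∃ s ∈ Ioo (1 / 2 - δ) (1 / 2 + δ), V s = 0) →
        ∀ s ∈ Ioo (1 / 2 - δ) (1 / 2 + δ), V s = 0) := by
  set φ := chartAt Plane (x (1 / 2)) with hφd
  have hφ : φ ∈ IsManifold.maximalAtlas (𝓡 2) ∞ M := IsManifold.chart_mem_maximalAtlas _
  have h0 : x (1 / 2) ∈ φ.source := mem_chart_source Plane (x (1 / 2))
  set c := φ (x (1 / 2)) with hc
  obtain ⟨R, hR, hball⟩ := Metric.nhds_basis_closedBall.mem_iff.1
    (φ.open_target.mem_nhds (φ.map_source h0))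
  obtain ⟨δ₀, hδ₀, hsrc, hu⟩ := x.exists_chart_interval hφ h0
  have hcont : ContinuousAt (fun s ↦ φ (x s)) (1 / 2) :=
    (φ.continuousAt h0).comp (f := x.toFun) x.continuous.continuousAt
  obtain ⟨δ₁, hδ₁, hδ₁'⟩ := Metric.continuousAt_iff.1 hcont (R / 2) (half_pos hR)
  set δ := min (1 / 4) (min δ₀ (δ₁ / 2)) with hδd
  have hδ : 0 < δ := lt_min (by norm_num) (lt_min hδ₀ (half_pos hδ₁))
  have d1 : δ ≤ 1 / 4 := min_le_left _ _
  have d2 : δ ≤ δ₀ := (min_le_right _ _).trans (min_le_left _ _)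
  have d3 : δ ≤ δ₁ / 2 := (min_le_right _ _).trans (min_le_right _ _)
  have hsrc' : ∀ s ∈ Icc (1 / 2 - δ) (1 / 2 + δ), x s ∈ φ.source := fun s hs ↦
    hsrc s ⟨by linarith [hs.1], by linarith [hs.2]⟩
  have hu' : ∀ i, H1On (fun s ↦ φ (x s) i) (1 / 2 - δ) (1 / 2 + δ) := fun i ↦
    (hu i).mono (by linarith) (by linarith) (by linarith)
  have hab : (1 / 2 - δ : ℝ) < 1 / 2 + δ := by linarith
  have hT : (T : ℝ)⁻¹ ≠ 0 := inv_ne_zero (ne_of_gt T.2)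
  have hcd : ContDiffOn ℝ ∞ (fun q ↦ ((T : ℝ)⁻¹ ^ 2) • metricCoeff g φ q) φ.target :=
    contDiffOn_smul_metricCoeff g hφ _
  have hcd' : ContDiffOn ℝ ∞ (fun q ↦ (T : ℝ)⁻¹ • formCoeff θ φ q) φ.target :=
    contDiffOn_smul_formCoeff θ hφ _
  obtain ⟨V, hV1, hV2, hV3⟩ := plane_minimizer_regular (u := fun s ↦ φ (x s)) φ.open_target
    hcd hcd'
    (fun q _ v w ↦ by
      change (T : ℝ)⁻¹ ^ 2 * metricCoeff g φ q v w = (T : ℝ)⁻¹ ^ 2 * metricCoeff g φ q w v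
      rw [metricCoeff_symm])
    (fun q hq v hv ↦ by
      change 0 < (T : ℝ)⁻¹ ^ 2 * metricCoeff g φ q v v
      exact mul_pos (by positivity) (metricCoeff_pos g hφ hq hv))
    hab hu' (fun s hs ↦ φ.map_source (hsrc' s hs)) (fun η hη ha hb ↦ by
      obtain ⟨y, hy, hy'⟩ := exists_variation x hφ (c := c) (half_pos hR)
        (by rwa [mul_div_cancel₀ R two_ne_zero]) (by linarith) hab (by linarith)
        (fun s hs ↦ ⟨hsrc' s hs, by
          refine (hδ₁' ?_).le
          rw [Real.dist_eq]
          have : |s - 1 / 2| ≤ δ := abs_le.2 ⟨by linarith [hs.1], by linarith [hs.2]⟩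
          linarith⟩) hu' hη ha hb
      have hyT : Tendsto (fun ε ↦ (y ε, T)) (𝓝[>] 0) (𝓝 (x, T)) := hy.prodMk_nhds tendsto_const_nhds
      have hm : ∀ᶠ β in 𝓝 (x, T), action g θ κ (x, T) ≤ action g θ κ β := hmin
      filter_upwards [hyT.eventually hm, hy'] with ε hle hε
      have := integral_lagAlong_le_of_action_le g θ hle (by linarith) (by linarith) hε.1
      rw [integral_lagAlong_chart g θ hφ T (u := fun s ↦ φ (x s))
          (v := planeDeriv fun s ↦ φ (x s)) hab.le
          (fun s hs ↦ ⟨φ.map_source (hsrc' s hs), (φ.left_inv (hsrc' s hs)).symm⟩)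
          (H1On.planeDeriv_hasDerivAt hab.le hu'),
        integral_lagAlong_chart g θ hφ T (u := fun s ↦ φ (x s) + ε • η s)
          (v := fun s ↦ planeDeriv (fun s ↦ φ (x s)) s + ε • planeDeriv η s) hab.le hε.2 ?_] at this
      · exact this
      · have e1 : ∀ᵐ s ∂(volume.restrict (Icc (1 / 2 - δ) (1 / 2 + δ))),
            HasDerivAt (fun s ↦ φ (x s)) (planeDeriv (fun s ↦ φ (x s)) s) s :=
          H1On.planeDeriv_hasDerivAt hab.le hu'
        have e2 : ∀ᵐ s ∂(volume.restrict (Icc (1 / 2 - δ) (1 / 2 + δ))),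
            HasDerivAt η (planeDeriv η s) s := H1On.planeDeriv_hasDerivAt hab.le hη
        filter_upwards [e1, e2] with s h1 h2
        exact h1.add (h2.const_smul ε))
  exact ⟨δ, hδ, V, fun s hs ↦ hsrc' s (Ioo_subset_Icc_self hs), hV1, hV2, hV3⟩

/-- In a chart, a local minimizer is of class `C¹`, and its velocity vanishes nowhere or
everywhere. -/
theorem minimizer_regular {κ : ℝ} {x : H1Loop M} {T : Ioi (0 : ℝ)}
    (hmin : IsLocalMin (action g θ κ) (x, T)) (s₀ : ℝ) :
    ∃ δ > 0, ∃ V : ℝ → Plane,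
      (∀ s ∈ Ioo (s₀ - δ) (s₀ + δ), x s ∈ (chartAt Plane (x s₀)).source) ∧
      ContinuousOn V (Ioo (s₀ - δ) (s₀ + δ)) ∧
      (∀ s ∈ Ioo (s₀ - δ) (s₀ + δ), HasDerivAt (fun s ↦ chartAt Plane (x s₀) (x s)) (V s) s) ∧
      ((∃ s ∈ Ioo (s₀ - δ) (s₀ + δ), V s = 0) → ∀ s ∈ Ioo (s₀ - δ) (s₀ + δ), V s = 0) := by
  obtain ⟨δ, hδ, V, h1, h2, h3, h4⟩ :=
    minimizer_regular_half g θ (isLocalMin_shift g θ hmin (s₀ - 1 / 2))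
  simp only [H1Loop.shift_apply, sub_add_cancel] at h1 h3
  have hm : ∀ {s : ℝ}, s ∈ Ioo (s₀ - δ) (s₀ + δ) →
      -(s₀ - 1 / 2) + s ∈ Ioo (1 / 2 - δ) (1 / 2 + δ) := fun hs ↦
    ⟨by linarith [hs.1], by linarith [hs.2]⟩
  have hm' : ∀ {s : ℝ}, s ∈ Ioo (1 / 2 - δ) (1 / 2 + δ) →
      (s₀ - 1 / 2) + s ∈ Ioo (s₀ - δ) (s₀ + δ) := fun hs ↦
    ⟨by linarith [hs.1], by linarith [hs.2]⟩
  refine ⟨δ, hδ, fun s ↦ V (-(s₀ - 1 / 2) + s), fun s hs ↦ ?_, ?_, fun s hs ↦ ?_, ?_⟩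
  · simpa only [add_neg_cancel_left] using h1 _ (hm hs)
  · exact h2.comp (by fun_prop) fun s hs ↦ hm hs
  · have := (h3 _ (hm hs)).comp_const_add (-(s₀ - 1 / 2)) s
    simpa only [add_neg_cancel_left] using this
  · rintro ⟨s, hs, hz⟩ t ht
    exact h4 ⟨_, hm hs, hz⟩ _ (hm ht)

end Minimizers

/-! ### Charts seen through a Euclidean embedding. -/

section Immersion

variable {M : Type*} [TopologicalSpace M] [ChartedSpace Plane M]
  {N : ℕ} {e : M → EuclideanSpace ℝ (Fin N)}

theorem contDiffOn_comp_symm (he : ContMDiff (𝓡 2) 𝓘(ℝ, EuclideanSpace ℝ (Fin N)) ∞ e)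
    {φ : OpenPartialHomeomorph M Plane} (hφ : φ ∈ IsManifold.maximalAtlas (𝓡 2) ∞ M) :
    ContDiffOn ℝ ∞ (fun q ↦ e (φ.symm q)) φ.target :=
  contMDiffOn_iff_contDiffOn.1 (he.comp_contMDiffOn (contMDiffOn_symm_of_mem_maximalAtlas hφ))

theorem fderiv_comp_symm_injective (he : ContMDiff (𝓡 2) 𝓘(ℝ, EuclideanSpace ℝ (Fin N)) ∞ e)
    (himm : ∀ p : M, Function.Injective (mfderiv (𝓡 2) 𝓘(ℝ, EuclideanSpace ℝ (Fin N)) e p))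
    {φ : OpenPartialHomeomorph M Plane} (hφ : φ ∈ IsManifold.maximalAtlas (𝓡 2) ∞ M) {q : Plane}
    (hq : q ∈ φ.target) : Function.Injective (fderiv ℝ (fun q ↦ e (φ.symm q)) q) := by
  have h1 : MDifferentiableAt (𝓡 2) (𝓡 2) φ.symm q :=
    ((contMDiffOn_symm_of_mem_maximalAtlas hφ).contMDiffAt
      (φ.open_target.mem_nhds hq)).mdifferentiableAt (by simp)
  have h2 : MDifferentiableAt (𝓡 2) 𝓘(ℝ, EuclideanSpace ℝ (Fin N)) e (φ.symm q) :=
    he.mdifferentiableAt (by simp)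
  have h3 := mfderiv_comp q h2 h1
  rw [mfderiv_eq_fderiv] at h3
  intro v w hvw
  have h4 : ∀ v, fderiv ℝ (fun q ↦ e (φ.symm q)) q v =
      mfderiv (𝓡 2) 𝓘(ℝ, EuclideanSpace ℝ (Fin N)) e (φ.symm q)
        (mfderiv (𝓡 2) (𝓡 2) φ.symm q v) := fun v ↦
    congrArg (fun A : Plane →L[ℝ] EuclideanSpace ℝ (Fin N) ↦ A v) h3
  have h5 := himm _ (((h4 v).symm.trans hvw).trans (h4 w))
  exact mfderiv_symm_injective hφ hq h5

theorem contDiff_embedding_comp {N : ℕ} {e : M → EuclideanSpace ℝ (Fin N)}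
    (he : ContMDiff (𝓡 2) 𝓘(ℝ, EuclideanSpace ℝ (Fin N)) ∞ e)
    {x : H1Loop M} (hx : ∀ f : SmoothFun M, ContDiff ℝ 1 fun s ↦ f (x s)) : ContDiff ℝ 1 fun s ↦ e (x s) :=
  contDiff_euclidean.2 fun i ↦ hx (smoothComponent he i)

end Immersion

/-! ### Minimizers are not constant. -/

section Minimizers

variable {M : Type*} [TopologicalSpace M] [ChartedSpace Plane M] [IsManifold (𝓡 2) ∞ M]
  (g : SmoothMetric M) (θ : SmoothOneForm M) {κ : ℝ} {x : H1Loop M} {T : Ioi (0 : ℝ)}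

theorem action_const (p : M) (hx : ∀ s, x s = p) : action g θ κ (x, T) = T * κ := by
  have h : ∀ s, lagAlong g θ T x.toFun s = 0 := by
    intro s
    have e : x.toFun = fun _ ↦ p := funext hx
    have hz : (mfderiv 𝓘(ℝ, ℝ) (𝓡 2) x.toFun s : ℝ →L[ℝ] Plane) 1 = 0 := by
      rw [e]
      exact congrArg (fun A : ℝ →L[ℝ] Plane ↦ A 1) (mfderiv_const (c := p) (x := s))
    unfold lagAlong lagrangian
    have hz' : ((T : ℝ)⁻¹ • mfderiv 𝓘(ℝ, ℝ) (𝓡 2) x.toFun s (1 : ℝ) :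
        TangentSpace (𝓡 2) (x.toFun s)) = 0 :=
      (congrArg (fun z : Plane ↦ (T : ℝ)⁻¹ • z) hz).trans (smul_zero (T : ℝ)⁻¹ : (T : ℝ)⁻¹ • (0 : Plane) = 0)
    rw [hz']
    simp
  rw [action_eq]
  simp [h]

/-- A constant loop has action κT, which a slightly smaller period decreases. -/
theorem minimizer_not_const (hκ : 0 < κ) (hmin : IsLocalMin (action g θ κ) (x, T)) (p : M) :
    ¬ ∀ s, x s = p := by
  intro hx
  have hm : ∀ᶠ β in 𝓝 (x, T), action g θ κ (x, T) ≤ action g θ κ β := hmin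
  have hc : Tendsto (fun t : Ioi (0 : ℝ) ↦ (x, t)) (𝓝 T) (𝓝 (x, T)) :=
    tendsto_const_nhds.prodMk_nhds tendsto_id
  have h1 := hc.eventually hm
  rw [nhds_subtype_eq_comap, eventually_comap] at h1
  obtain ⟨ε, hε, hball⟩ := Metric.eventually_nhds_iff.1 h1
  have hT : (0 : ℝ) < T := T.2
  set t : ℝ := T - min (ε / 2) (T / 2) with ht
  have hm1 : 0 < min (ε / 2) ((T : ℝ) / 2) := lt_min (by linarith) (by linarith)
  have hm2 : min (ε / 2) ((T : ℝ) / 2) ≤ T / 2 := min_le_right _ _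
  have hm3 : min (ε / 2) ((T : ℝ) / 2) ≤ ε / 2 := min_le_left _ _
  have htpos : 0 < t := by rw [ht]; linarith
  have h2 := hball (y := t) (by
    rw [Real.dist_eq, ht, sub_sub_cancel_left, abs_neg, abs_of_pos hm1]; linarith) ⟨t, htpos⟩ rfl
  rw [action_const g θ p hx, action_const g θ p hx] at h2
  have := le_of_mul_le_mul_right h2 hκ
  simp only at this
  linarith

end Minimizers

/-! ### Minimizers are C¹ immersions. -/

section Minimizers

variable {M : Type*} [TopologicalSpace M] [ChartedSpace Plane M] [IsManifold (𝓡 2) ∞ M]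
  [T2Space M] [CompactSpace M] (g : SmoothMetric M) (θ : SmoothOneForm M)
  {κ : ℝ} {x : H1Loop M} {T : Ioi (0 : ℝ)}

theorem minimizer_contDiff (hmin : IsLocalMin (action g θ κ) (x, T)) (f : SmoothFun M) :
    ContDiff ℝ 1 fun s ↦ f (x s) := by
  have key : ∀ s₀ : ℝ, DifferentiableAt ℝ (fun s ↦ f (x s)) s₀ ∧
      ContinuousAt (deriv fun s ↦ f (x s)) s₀ := by
    intro s₀
    obtain ⟨δ, hδ, V, h1, h2, h3, -⟩ := minimizer_regular g θ hmin s₀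
    set φ := chartAt Plane (x s₀) with hφd
    have hφ : φ ∈ IsManifold.maximalAtlas (𝓡 2) ∞ M := IsManifold.chart_mem_maximalAtlas _
    have hs₀ : s₀ ∈ Ioo (s₀ - δ) (s₀ + δ) := ⟨by linarith, by linarith⟩
    have hd : ∀ s ∈ Ioo (s₀ - δ) (s₀ + δ),
        HasDerivAt (fun s ↦ f (x s)) (fderiv ℝ (fun q ↦ f (φ.symm q)) (φ (x s)) (V s)) s := by
      intro s hs
      refine (hasDerivAt_smoothFun_symm f hφ (w := fun s ↦ φ (x s)) (φ.map_source (h1 s hs))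
        (h3 s hs)).congr_of_eventuallyEq ?_
      filter_upwards [isOpen_Ioo.mem_nhds hs] with t ht
      rw [φ.left_inv (h1 t ht)]
    refine ⟨(hd s₀ hs₀).differentiableAt, ?_⟩
    have hc : ContinuousOn (fun s ↦ fderiv ℝ (fun q ↦ f (φ.symm q)) (φ (x s)) (V s))
        (Ioo (s₀ - δ) (s₀ + δ)) :=
      (((contDiffOn_smoothFun_symm f hφ).continuousOn_fderiv_of_isOpen φ.open_target
        (by simp)).comp (φ.continuousOn.comp x.continuous.continuousOn h1)
        fun s hs ↦ φ.map_source (h1 s hs)).clm_apply h2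
    refine (hc.continuousAt (isOpen_Ioo.mem_nhds hs₀)).congr ?_
    filter_upwards [isOpen_Ioo.mem_nhds hs₀] with s hs
    exact (hd s hs).deriv.symm
  rw [contDiff_one_iff_deriv]
  exact ⟨fun s ↦ (key s).1, continuous_iff_continuousAt.2 fun s ↦ (key s).2⟩

/-- The zeros of the velocity form a closed set, which is open by the dichotomy in
`minimizer_regular`. If it were nonempty it would be the whole line, and the loop would be constant.
-/
theorem minimizer_deriv_ne_zero (hκ : 0 < κ) (hmin : IsLocalMin (action g θ κ) (x, T)) {N : ℕ}
    {e : M → EuclideanSpace ℝ (Fin N)}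
    (he : ContMDiff (𝓡 2) 𝓘(ℝ, EuclideanSpace ℝ (Fin N)) ∞ e) (hinj : Function.Injective e)
    (himm : ∀ p : M, Function.Injective (mfderiv (𝓡 2) 𝓘(ℝ, EuclideanSpace ℝ (Fin N)) e p)) (s : ℝ) :
    deriv (fun s ↦ e (x s)) s ≠ 0 := by
  have hC := contDiff_embedding_comp he (minimizer_contDiff g θ hmin)
  set Z : Set ℝ := {s | deriv (fun s ↦ e (x s)) s = 0} with hZ
  have hclosed : IsClosed Z := isClosed_eq (hC.continuous_deriv le_rfl) continuous_const
  have hopen : IsOpen Z := by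
    rw [isOpen_iff_mem_nhds]
    intro s₀ hs₀
    obtain ⟨δ, hδ, V, h1, h2, h3, h4⟩ := minimizer_regular g θ hmin s₀
    set φ := chartAt Plane (x s₀) with hφd
    have hφ : φ ∈ IsManifold.maximalAtlas (𝓡 2) ∞ M := IsManifold.chart_mem_maximalAtlas _
    have hmem : s₀ ∈ Ioo (s₀ - δ) (s₀ + δ) := ⟨by linarith, by linarith⟩
    have hd : ∀ s ∈ Ioo (s₀ - δ) (s₀ + δ),
        deriv (fun s ↦ e (x s)) s = fderiv ℝ (fun q ↦ e (φ.symm q)) (φ (x s)) (V s) := by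
      intro s hs
      have hdiff := (((contDiffOn_comp_symm he hφ).contDiffAt
        (φ.open_target.mem_nhds (φ.map_source (h1 s hs)))).differentiableAt (by simp)).hasFDerivAt
      refine ((hdiff.comp_hasDerivAt s (h3 s hs)).congr_of_eventuallyEq ?_).deriv
      filter_upwards [isOpen_Ioo.mem_nhds hs] with t ht
      simp only [Function.comp, φ.left_inv (h1 t ht)]
    have hz : ∀ s ∈ Ioo (s₀ - δ) (s₀ + δ), deriv (fun s ↦ e (x s)) s = 0 ↔ V s = 0 := by
      intro s hs
      rw [hd s hs]
      exact map_eq_zero_iff _ (fderiv_comp_symm_injective he himm hφ (φ.map_source (h1 s hs)))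
    filter_upwards [isOpen_Ioo.mem_nhds hmem] with s hs
    exact (hz s hs).2 (h4 ⟨s₀, hmem, (hz s₀ hmem).1 hs₀⟩ s hs)
  intro hs
  have huniv : Z = univ := IsClopen.eq_univ ⟨hclosed, hopen⟩ ⟨s, hs⟩
  refine minimizer_not_const g θ hκ hmin (x 0) fun t ↦ hinj ?_
  exact is_const_of_deriv_eq_zero (hC.differentiable (by simp))
    (fun r ↦ by have : r ∈ Z := huniv ▸ mem_univ r; exact this) t 0

end Minimizers

/-! ### Determinants of pairs of covectors and change of charts. -/

section Frames

variable {M : Type*} [TopologicalSpace M]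
  {N : ℕ} {e : M → EuclideanSpace ℝ (Fin N)}

/-- The determinant, in the coordinates of the chart `φ` at `p`, of two linear forms on the ambient
space of the map `e`. -/
def frameDet (e : M → EuclideanSpace ℝ (Fin N)) (φ : OpenPartialHomeomorph M Plane) (p : M)
    (P β : EuclideanSpace ℝ (Fin N) →L[ℝ] ℝ) : ℝ :=
  P (fderiv ℝ (fun q ↦ e (φ.symm q)) (φ p) (EuclideanSpace.single 0 1)) *
      β (fderiv ℝ (fun q ↦ e (φ.symm q)) (φ p) (EuclideanSpace.single 1 1)) -
    P (fderiv ℝ (fun q ↦ e (φ.symm q)) (φ p) (EuclideanSpace.single 1 1)) *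
      β (fderiv ℝ (fun q ↦ e (φ.symm q)) (φ p) (EuclideanSpace.single 0 1))

theorem plane_eq_sum (v : Plane) :
    v = v 0 • (EuclideanSpace.single 0 1 : Plane) + v 1 • (EuclideanSpace.single 1 1 : Plane) := by
  ext j; fin_cases j <;> simp

theorem det_plane (J : Plane →L[ℝ] Plane) :
    J.det = J (EuclideanSpace.single 0 1) 0 * J (EuclideanSpace.single 1 1) 1 -
      J (EuclideanSpace.single 1 1) 0 * J (EuclideanSpace.single 0 1) 1 := by
  have h : J.det = LinearMap.det (J : Plane →ₗ[ℝ] Plane) := rfl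
  rw [h, ← LinearMap.det_toMatrix (EuclideanSpace.basisFun (Fin 2) ℝ).toBasis, Matrix.det_fin_two]
  simp [LinearMap.toMatrix_apply]

theorem eq_zero_of_frameDet_ne_zero {φ : OpenPartialHomeomorph M Plane} {p : M}
    {P β : EuclideanSpace ℝ (Fin N) →L[ℝ] ℝ} (h : frameDet e φ p P β ≠ 0) {v : Plane}
    (h1 : P (fderiv ℝ (fun q ↦ e (φ.symm q)) (φ p) v) = 0)
    (h2 : β (fderiv ℝ (fun q ↦ e (φ.symm q)) (φ p) v) = 0) : v = 0 := by
  unfold frameDet at h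
  set B := fderiv ℝ (fun q ↦ e (φ.symm q)) (φ p)
  have hd : ∀ Q : EuclideanSpace ℝ (Fin N) →L[ℝ] ℝ, Q (B v) =
      v 0 * Q (B (EuclideanSpace.single 0 1)) + v 1 * Q (B (EuclideanSpace.single 1 1)) := by
    intro Q
    conv_lhs => rw [plane_eq_sum v]
    simp only [map_add, map_smul, smul_eq_mul]
  rw [hd] at h1 h2
  set p₀ := P (B (EuclideanSpace.single 0 1))
  set p₁ := P (B (EuclideanSpace.single 1 1))
  set q₀ := β (B (EuclideanSpace.single 0 1))
  set q₁ := β (B (EuclideanSpace.single 1 1))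
  have e0 : v 0 * (p₀ * q₁ - p₁ * q₀) = 0 := by linear_combination q₁ * h1 - p₁ * h2
  have e1 : v 1 * (p₀ * q₁ - p₁ * q₀) = 0 := by linear_combination p₀ * h2 - q₀ * h1
  have z0 := (mul_eq_zero.1 e0).resolve_right h
  have z1 := (mul_eq_zero.1 e1).resolve_right h
  rw [plane_eq_sum v, z0, z1]
  simp

variable [ChartedSpace Plane M]

theorem fderiv_comp_symm_trans (he : ContMDiff (𝓡 2) 𝓘(ℝ, EuclideanSpace ℝ (Fin N)) ∞ e)
    {φ φ' : OpenPartialHomeomorph M Plane} (hφ : φ ∈ IsManifold.maximalAtlas (𝓡 2) ∞ M)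
    (hφ' : φ' ∈ IsManifold.maximalAtlas (𝓡 2) ∞ M) {p : M} (hp : p ∈ φ.source)
    (hp' : p ∈ φ'.source) :
    fderiv ℝ (fun q ↦ e (φ.symm q)) (φ p) = (fderiv ℝ (fun q ↦ e (φ'.symm q)) (φ' p)).comp
      (fderiv ℝ (φ.symm.trans φ') (φ p)) := by
  have hq : φ p ∈ φ.target := φ.map_source hp
  have h1 : ContDiffAt ℝ ∞ (φ.symm.trans φ') (φ p) := by
    refine contMDiffAt_iff_contDiffAt.1 ?_
    have a1 := (contMDiffOn_symm_of_mem_maximalAtlas hφ).contMDiffAt (φ.open_target.mem_nhds hq)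
    have a2 : ContMDiffAt (𝓡 2) (𝓡 2) ∞ φ' (φ.symm (φ p)) := by
      rw [φ.left_inv hp]
      exact (contMDiffOn_of_mem_maximalAtlas hφ').contMDiffAt (φ'.open_source.mem_nhds hp')
    exact a2.comp (φ p) a1
  have hpt : (φ.symm.trans φ') (φ p) = φ' p := by
    simp [φ.left_inv hp]
  have h2 : ContDiffAt ℝ ∞ (fun q ↦ e (φ'.symm q)) ((φ.symm.trans φ') (φ p)) := by
    rw [hpt]
    exact (contDiffOn_comp_symm he hφ').contDiffAt (φ'.open_target.mem_nhds (φ'.map_source hp'))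
  have h3 := fderiv_comp (φ p) (h2.differentiableAt (by simp)) (h1.differentiableAt (by simp))
  rw [hpt] at h3
  rw [← h3]
  refine Filter.EventuallyEq.fderiv_eq ?_
  have hev : ∀ᶠ q in 𝓝 (φ p), φ.symm q ∈ φ'.source := by
    refine (φ.continuousAt_symm hq).eventually (φ'.open_source.mem_nhds ?_)
    rwa [φ.left_inv hp]
  filter_upwards [hev] with q hq'
  simp [φ'.left_inv hq']

/-- By the chain rule the determinant transforms with the Jacobian, so its sign does not depend on
the choice among charts with positive transition Jacobians. -/
theorem frameDet_change (he : ContMDiff (𝓡 2) 𝓘(ℝ, EuclideanSpace ℝ (Fin N)) ∞ e)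
    {φ φ' : OpenPartialHomeomorph M Plane} (hφ : φ ∈ IsManifold.maximalAtlas (𝓡 2) ∞ M)
    (hφ' : φ' ∈ IsManifold.maximalAtlas (𝓡 2) ∞ M) {p : M} (hp : p ∈ φ.source)
    (hp' : p ∈ φ'.source) (P β : EuclideanSpace ℝ (Fin N) →L[ℝ] ℝ) :
    frameDet e φ p P β = (fderiv ℝ (φ.symm.trans φ') (φ p)).det * frameDet e φ' p P β := by
  unfold frameDet
  rw [fderiv_comp_symm_trans he hφ hφ' hp hp', det_plane]
  set J := fderiv ℝ (φ.symm.trans φ') (φ p)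
  set B := fderiv ℝ (fun q ↦ e (φ'.symm q)) (φ' p)
  have h : ∀ (Q : EuclideanSpace ℝ (Fin N) →L[ℝ] ℝ) (v : Plane), Q ((B.comp J) v) =
      J v 0 * Q (B (EuclideanSpace.single 0 1)) + J v 1 * Q (B (EuclideanSpace.single 1 1)) := by
    intro Q v
    rw [ContinuousLinearMap.comp_apply]
    conv_lhs => rw [plane_eq_sum (J v)]
    simp only [map_add, map_smul, smul_eq_mul]
  simp only [h]
  ring

end Frames

/-! ### A periodic transverse covector from orientability. -/

section FrameAlongLoop

variable {M : Type*} [TopologicalSpace M] [ChartedSpace Plane M] [IsManifold (𝓡 2) ∞ M]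
  [T2Space M] [CompactSpace M]
  {N : ℕ} {e : M → EuclideanSpace ℝ (Fin N)}

theorem differentiableAt_chart_comp {x : H1Loop M}
    (hx : ∀ f : SmoothFun M, ContDiff ℝ 1 fun s ↦ f (x s)) {φ : OpenPartialHomeomorph M Plane}
    (hφ : φ ∈ IsManifold.maximalAtlas (𝓡 2) ∞ M) {a : ℝ} (ha : x a ∈ φ.source) :
    DifferentiableAt ℝ (fun s ↦ φ (x s)) a := by
  obtain ⟨f, hf⟩ := exists_smooth_coordinates hφ ha
  have hev := x.continuous.continuousAt.eventually hf
  have h : ∀ i, DifferentiableAt ℝ (fun s ↦ φ (x s) i) a := fun i ↦ by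
    refine ((hx (f i)).differentiable (by simp) a).congr_of_eventuallyEq ?_
    filter_upwards [hev] with s hs
    exact (hs i).symm
  exact (hasDerivAt_plane (v := WithLp.toLp 2 fun i ↦ deriv (fun s ↦ φ (x s) i) a)
    fun i ↦ (h i).hasDerivAt).differentiableAt

theorem exists_conormal_at (he : ContMDiff (𝓡 2) 𝓘(ℝ, EuclideanSpace ℝ (Fin N)) ∞ e)
    (himm : ∀ p : M, Function.Injective (mfderiv (𝓡 2) 𝓘(ℝ, EuclideanSpace ℝ (Fin N)) e p))
    {x : H1Loop M} (hx : ∀ f : SmoothFun M, ContDiff ℝ 1 fun s ↦ f (x s)) {a : ℝ}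
    (hc : deriv (fun s ↦ e (x s)) a ≠ 0) {φ : OpenPartialHomeomorph M Plane}
    (hφ : φ ∈ IsManifold.maximalAtlas (𝓡 2) ∞ M) (ha : x a ∈ φ.source) :
    ∃ β : EuclideanSpace ℝ (Fin N) →L[ℝ] ℝ,
      0 < frameDet e φ (x a) (innerSL ℝ (deriv (fun s ↦ e (x s)) a)) β := by
  set c' := deriv (fun s ↦ e (x s)) a with hc'
  set B := fderiv ℝ (fun q ↦ e (φ.symm q)) (φ (x a)) with hB
  have hBinj : Function.Injective B := fderiv_comp_symm_injective he himm hφ (φ.map_source ha)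
  set v := deriv (fun s ↦ φ (x s)) a with hv
  have hBv : B v = c' := by
    have hdiff := (((contDiffOn_comp_symm he hφ).contDiffAt
      (φ.open_target.mem_nhds (φ.map_source ha))).differentiableAt (by simp)).hasFDerivAt
    have h1 := hdiff.comp_hasDerivAt a (differentiableAt_chart_comp hx hφ ha).hasDerivAt
    refine ((h1.congr_of_eventuallyEq ?_).deriv).symm
    filter_upwards [x.continuous.continuousAt.eventually (φ.open_source.mem_nhds ha)] with t ht
    simp only [Function.comp, φ.left_inv ht]
  set p₀ := inner ℝ c' (B (EuclideanSpace.single 0 1)) with hp₀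
  set p₁ := inner ℝ c' (B (EuclideanSpace.single 1 1)) with hp₁
  -- The vector w spans the kernel, in coordinates, of the inner product with c'. Pairing with its
  -- image B w gives a determinant equal to |B w|².
  set w : Plane := (-p₁) • EuclideanSpace.single 0 1 + p₀ • EuclideanSpace.single 1 1 with hw
  refine ⟨innerSL ℝ (B w), ?_⟩
  have hne : B w ≠ 0 := by
    intro h
    have hw0 : w = 0 := hBinj (h.trans (map_zero B).symm)
    have g0 : p₁ = 0 := by
      have := congrArg (fun z : Plane ↦ z 0) hw0
      simpa [hw] using this
    have g1 : p₀ = 0 := by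
      have := congrArg (fun z : Plane ↦ z 1) hw0
      simpa [hw] using this
    have : inner ℝ c' c' = v 0 * p₀ + v 1 * p₁ := by
      conv_lhs => rw [← hBv]
      conv_lhs => arg 3; rw [plane_eq_sum v]
      rw [hBv, map_add, map_smul, map_smul, inner_add_right, inner_smul_right, inner_smul_right]
    rw [g0, g1, mul_zero, mul_zero, add_zero] at this
    exact hc (inner_self_eq_zero.1 this)
  have hpos : 0 < inner ℝ (B w) (B w) := real_inner_self_pos.2 hne
  have hval : frameDet e φ (x a) (innerSL ℝ c') (innerSL ℝ (B w)) = inner ℝ (B w) (B w) := by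
    change p₀ * inner ℝ (B w) (B (EuclideanSpace.single 1 1)) -
      p₁ * inner ℝ (B w) (B (EuclideanSpace.single 0 1)) = _
    conv_rhs => arg 3; rw [hw, map_add, map_smul, map_smul]
    rw [inner_add_right, inner_smul_right, inner_smul_right]
    ring
  rw [hval]
  exact hpos

theorem continuousAt_frameDet (he : ContMDiff (𝓡 2) 𝓘(ℝ, EuclideanSpace ℝ (Fin N)) ∞ e)
    {x : H1Loop M} (hx : ∀ f : SmoothFun M, ContDiff ℝ 1 fun s ↦ f (x s))
    {φ : OpenPartialHomeomorph M Plane} (hφ : φ ∈ IsManifold.maximalAtlas (𝓡 2) ∞ M) {a : ℝ}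
    (ha : x a ∈ φ.source) (β : EuclideanSpace ℝ (Fin N) →L[ℝ] ℝ) :
    ContinuousAt (fun s ↦ frameDet e φ (x s) (innerSL ℝ (deriv (fun s ↦ e (x s)) s)) β) a := by
  have hB : ContinuousAt (fun s ↦ fderiv ℝ (fun q ↦ e (φ.symm q)) (φ (x s))) a := by
    have h1 := ((contDiffOn_comp_symm he hφ).continuousOn_fderiv_of_isOpen φ.open_target
      (by simp)).continuousAt (φ.open_target.mem_nhds (φ.map_source ha))
    have h2 : ContinuousAt (fun s ↦ φ (x s)) a :=
      (φ.continuousAt ha).comp (f := x.toFun) x.continuous.continuousAt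
    exact ContinuousAt.comp (f := fun s ↦ φ (x s)) h1 h2
  have hP : ContinuousAt (fun s ↦ innerSL ℝ (deriv (fun s ↦ e (x s)) s)) a :=
    ((innerSL ℝ).continuous.comp
      ((contDiff_embedding_comp he hx).continuous_deriv le_rfl)).continuousAt
  have hBv : ∀ v : Plane,
      ContinuousAt (fun s ↦ fderiv ℝ (fun q ↦ e (φ.symm q)) (φ (x s)) v) a := fun v ↦
    hB.clm_apply continuousAt_const
  exact ((hP.clm_apply (hBv _)).mul (β.continuous.continuousAt.comp (hBv _))).sub
    ((hP.clm_apply (hBv _)).mul (β.continuous.continuousAt.comp (hBv _)))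

/-- The determinant is linear in β, so the admissible covectors at each point form a convex set; a
covector admissible at one point stays so nearby. A continuous selection over the circle exists, and
working over the circle makes β periodic. Orientability makes positivity independent of the chart,
so that the local choices are compatible. -/
theorem exists_conormal (he : ContMDiff (𝓡 2) 𝓘(ℝ, EuclideanSpace ℝ (Fin N)) ∞ e)
    (himm : ∀ p : M, Function.Injective (mfderiv (𝓡 2) 𝓘(ℝ, EuclideanSpace ℝ (Fin N)) e p))
    {x : H1Loop M} (hx : ∀ f : SmoothFun M, ContDiff ℝ 1 fun s ↦ f (x s))
    (hc : ∀ a, deriv (fun s ↦ e (x s)) a ≠ 0)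
    {𝒜 : Set (OpenPartialHomeomorph M Plane)} (h𝒜 : 𝒜 ⊆ IsManifold.maximalAtlas (𝓡 2) ∞ M)
    (hcov : ∀ p : M, ∃ φ ∈ 𝒜, p ∈ φ.source)
    (hor : ∀ φ ∈ 𝒜, ∀ φ' ∈ 𝒜, ∀ y ∈ (φ.symm.trans φ').source,
      0 < (fderiv ℝ (φ.symm.trans φ') y).det) :
    ∃ β : ℝ → EuclideanSpace ℝ (Fin N) →L[ℝ] ℝ, Continuous β ∧ Function.Periodic β 1 ∧
      ∀ a, ∀ φ ∈ 𝒜, x a ∈ φ.source →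
        0 < frameDet e φ (x a) (innerSL ℝ (deriv (fun s ↦ e (x s)) a)) (β a) := by
  have hper : Function.Periodic (fun a ↦ (x a, deriv (fun s ↦ e (x s)) a)) 1 := fun a ↦
    Prod.ext (x.periodic' a) (periodic_deriv (F := fun s ↦ e (x s))
      (fun s ↦ by simp only [x.periodic' s]) a)
  set t : UnitAddCircle → Set (EuclideanSpace ℝ (Fin N) →L[ℝ] ℝ) := fun ā ↦
    {β | ∀ a : ℝ, (a : UnitAddCircle) = ā → ∀ φ ∈ 𝒜, x a ∈ φ.source →
      0 < frameDet e φ (x a) (innerSL ℝ (deriv (fun s ↦ e (x s)) a)) β} with ht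
  have hconv : ∀ ā, Convex ℝ (t ā) := by
    intro ā β hβ β' hβ' r r' hr hr' hrr a ha φ hφ hxa
    have h1 := hβ a ha φ hφ hxa
    have h2 := hβ' a ha φ hφ hxa
    have e1 : frameDet e φ (x a) (innerSL ℝ (deriv (fun s ↦ e (x s)) a)) (r • β + r' • β') =
        r * frameDet e φ (x a) (innerSL ℝ (deriv (fun s ↦ e (x s)) a)) β +
        r' * frameDet e φ (x a) (innerSL ℝ (deriv (fun s ↦ e (x s)) a)) β' := by
      simp only [frameDet, add_apply, smul_apply, smul_eq_mul]
      ring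
    rw [e1]
    rcases eq_or_lt_of_le hr with h | h
    · have : r' = 1 := by linarith
      rw [← h, this]; linarith
    · have := mul_pos h h1
      have := mul_nonneg hr' h2.le
      linarith
  have hloc : ∀ ā : UnitAddCircle, ∃ β, ∀ᶠ y in 𝓝 ā, β ∈ t y := by
    intro ā
    obtain ⟨a, rfl⟩ := QuotientAddGroup.mk_surjective ā
    obtain ⟨φ, hφ, hxa⟩ := hcov (x a)
    obtain ⟨β, hβ⟩ := exists_conormal_at he himm hx (hc a) (h𝒜 hφ) hxa
    refine ⟨β, ?_⟩
    have hev := ((continuousAt_frameDet he hx (h𝒜 hφ) hxa β).eventually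
      (Ioi_mem_nhds hβ)).and (x.continuous.continuousAt.eventually (φ.open_source.mem_nhds hxa))
    -- The quotient map to the circle is open, and the loop and its derivative descend, so the
    -- neighbourhood found in ℝ serves all representatives of nearby points.
    have himg := (QuotientAddGroup.isOpenMap_coe (N := AddSubgroup.zmultiples (1 : ℝ))).image_mem_nhds
      hev
    refine Filter.mem_of_superset himg ?_
    rintro _ ⟨b, ⟨hb1, hb2⟩, rfl⟩ b' hb' φ' hφ' hxb'
    have heq : (x b', deriv (fun s ↦ e (x s)) b') = (x b, deriv (fun s ↦ e (x s)) b) :=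
      congrArg hper.lift hb'
    have e1 : x b' = x b := congrArg Prod.fst heq
    have e2 : deriv (fun s ↦ e (x s)) b' = deriv (fun s ↦ e (x s)) b := congrArg Prod.snd heq
    have hb2 : x b ∈ φ.source := hb2
    rw [e1] at hxb'
    rw [e1, e2]
    have hb1 : 0 < frameDet e φ (x b) (innerSL ℝ (deriv (fun s ↦ e (x s)) b)) β := hb1
    rw [frameDet_change he (h𝒜 hφ) (h𝒜 hφ') hb2 hxb'] at hb1
    have hdet := hor φ hφ φ' hφ' (φ (x b)) (by
      simp [φ.map_source hb2, φ.left_inv hb2, hxb'])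
    exact pos_of_mul_pos_right hb1 hdet.le
  obtain ⟨G, hG⟩ := exists_continuous_forall_mem_convex_of_local_const hconv hloc
  refine ⟨fun a ↦ G (a : UnitAddCircle), G.continuous.comp (AddCircle.continuous_mk' 1), fun a ↦ ?_,
    fun a φ hφ hxa ↦ hG a a rfl φ hφ hxa⟩
  simp

end FrameAlongLoop

/-! ### Complex frames and local injectivity. -/

section FrameMap

variable {E : Type*} [NormedAddCommGroup E] [NormedSpace ℝ E]

/-- The complex-valued linear map with real part `P` and imaginary part `β`. -/
def frameMap (P β : E →L[ℝ] ℝ) : E →L[ℝ] ℂ :=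
  Complex.ofRealCLM.comp P + (ContinuousLinearMap.toSpanSingleton ℝ Complex.I).comp β

@[simp] theorem frameMap_re (P β : E →L[ℝ] ℝ) (v : E) : (frameMap P β v).re = P v := by
  simp [frameMap]

@[simp] theorem frameMap_im (P β : E →L[ℝ] ℝ) (v : E) : (frameMap P β v).im = β v := by
  simp [frameMap]

theorem continuous_frameMap {X : Type*} [TopologicalSpace X] {P β : X → E →L[ℝ] ℝ}
    (hP : Continuous P) (hβ : Continuous β) : Continuous fun a ↦ frameMap (P a) (β a) :=
  (continuous_const.clm_comp hP).add (continuous_const.clm_comp hβ)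

/-- A continuous family of linear maps that are injective on the tangent space at `q₀` separates the
values of `F` near `q₀`. -/
theorem eventually_eq_of_apply_sub_eq_zero {X : Type*} [TopologicalSpace X] {A : X → E →L[ℝ] ℂ}
    {a₀ : X} (hA : ContinuousAt A a₀) {F : Plane → E} {B : Plane →L[ℝ] E} {q₀ : Plane}
    (hF : HasStrictFDerivAt F B q₀) (hinj : ∀ v, A a₀ (B v) = 0 → v = 0) :
    ∀ᶠ z : X × Plane × Plane in 𝓝 (a₀, q₀, q₀), A z.1 (F z.2.1 - F z.2.2) = 0 → z.2.1 = z.2.2 := by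
  set L := A a₀ with hL
  obtain ⟨K, hK, hanti⟩ := LinearMap.exists_antilipschitzWith ((L.comp B : Plane →L[ℝ] ℂ) : Plane →ₗ[ℝ] ℂ)
    (LinearMap.ker_eq_bot'.2 hinj)
  have hKd : ∀ v : Plane, ‖v‖ ≤ K * ‖L (B v)‖ := fun v ↦ by
    have := hanti.le_mul_dist v 0
    simpa using this
  have hK0 : (0 : ℝ) < K := hK
  -- With K the antilipschitz constant of L ∘ B, the linearization error and the variation of A each
  -- contribute at most ‖d‖/4. Hence ‖d‖ ≤ ‖d‖/2 and d = 0.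
  set ε : ℝ := min 1 (1 / (4 * K * (‖L‖ + 1))) with hε
  have hεpos : 0 < ε := lt_min one_pos (by positivity)
  set δ : ℝ := 1 / (4 * K * (‖B‖ + 1)) with hδ
  have hδpos : 0 < δ := by positivity
  have h1 : ∀ᶠ z : X × Plane × Plane in 𝓝 (a₀, q₀, q₀), ‖A z.1 - L‖ < δ := by
    have : Tendsto (fun z : X × Plane × Plane ↦ A z.1) (𝓝 (a₀, q₀, q₀)) (𝓝 L) :=
      hA.tendsto.comp (continuous_fst.tendsto (a₀, q₀, q₀))
    filter_upwards [Metric.tendsto_nhds.1 this δ hδpos] with z hz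
    rwa [dist_eq_norm] at hz
  have h2 : ∀ᶠ z : X × Plane × Plane in 𝓝 (a₀, q₀, q₀),
      ‖F z.2.1 - F z.2.2 - B (z.2.1 - z.2.2)‖ ≤ ε * ‖z.2.1 - z.2.2‖ := by
    have := (hasStrictFDerivAt_iff_isLittleO.1 hF).def hεpos
    exact (continuous_snd.tendsto (a₀, q₀, q₀)).eventually this
  filter_upwards [h1, h2] with z hz1 hz2 hz
  set d := z.2.1 - z.2.2 with hd
  set D := F z.2.1 - F z.2.2 with hD
  have hDn : ‖D‖ ≤ (‖B‖ + 1) * ‖d‖ := by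
    calc ‖D‖ = ‖(D - B d) + B d‖ := by rw [sub_add_cancel]
      _ ≤ ε * ‖d‖ + ‖B‖ * ‖d‖ := (norm_add_le _ _).trans (add_le_add hz2 (B.le_opNorm d))
      _ ≤ 1 * ‖d‖ + ‖B‖ * ‖d‖ := by gcongr; exact min_le_left _ _
      _ = _ := by ring
  have e : L (B d) = -(L (D - B d)) - (A z.1 - L) D := by
    rw [sub_apply, hz, map_sub L D]; ring
  have h3 : ‖L (B d)‖ ≤ ‖L‖ * (ε * ‖d‖) + δ * ((‖B‖ + 1) * ‖d‖) := by
    rw [e]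
    refine (norm_sub_le _ _).trans ?_
    rw [norm_neg]
    exact add_le_add ((L.le_opNorm _).trans (by gcongr))
      (((A z.1 - L).le_opNorm _).trans (by gcongr))
  have h4 : K * (‖L‖ * ε) ≤ 1 / 4 := by
    have : ε ≤ 1 / (4 * K * (‖L‖ + 1)) := min_le_right _ _
    calc K * (‖L‖ * ε) ≤ K * ((‖L‖ + 1) * (1 / (4 * K * (‖L‖ + 1)))) := by
          gcongr; linarith
      _ = 1 / 4 := by field_simp
  have h5 : K * (δ * (‖B‖ + 1)) = 1 / 4 := by rw [hδ]; field_simp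
  have h6 : ‖d‖ ≤ 1 / 2 * ‖d‖ := by
    have := (hKd d).trans (mul_le_mul_of_nonneg_left h3 hK0.le)
    have g := mul_le_mul_of_nonneg_right h4 (norm_nonneg d)
    have g' := congrArg (fun t ↦ t * ‖d‖) h5
    linarith
  have h7 : ‖d‖ ≤ 0 := by linarith
  exact sub_eq_zero.1 (norm_le_zero_iff.1 h7)

end FrameMap

/-! ### Uniform monotonicity along the tangent direction. -/

section PeriodicCurves

variable {E : Type*} [NormedAddCommGroup E] [InnerProductSpace ℝ E]

/-- By periodicity |c'|² has a positive lower bound 1/K. Uniform continuity of c' costs at most half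
of it near a, so the component along c'(a) has slope at least 1/(2K). -/
theorem exists_inner_monotone {c : ℝ → E} (hc : ContDiff ℝ 1 c) (hp : Function.Periodic c 1)
    (hne : ∀ s, deriv c s ≠ 0) :
    ∃ η > 0, ∃ m > 0, ∀ a s t : ℝ, s ≤ t → |s - a| ≤ η → |t - a| ≤ η →
      m * (t - s) ≤ inner ℝ (deriv c a) (c t - c s) := by
  have hdc : Continuous (deriv c) := hc.continuous_deriv le_rfl
  have hdp := periodic_deriv hp
  obtain ⟨K, hK⟩ := exists_bound_of_periodic (F := fun s ↦ (‖deriv c s‖ ^ 2)⁻¹)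
    ((hdc.norm.pow 2).inv₀ fun s ↦ pow_ne_zero 2 (norm_ne_zero_iff.2 (hne s)))
    (fun s ↦ by simp only [hdp s])
  obtain ⟨K', hK'⟩ := exists_bound_of_periodic hdc hdp
  have hsq : ∀ s, 0 < ‖deriv c s‖ ^ 2 := fun s ↦ by
    have := norm_pos_iff.2 (hne s); positivity
  have hKpos : 0 < K := by
    refine lt_of_lt_of_le ?_ (hK 0)
    rw [norm_pos_iff]
    exact inv_ne_zero (hsq 0).ne'
  have hlow : ∀ s, K⁻¹ ≤ ‖deriv c s‖ ^ 2 := fun s ↦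
    inv_le_of_inv_le₀ (hsq s) ((le_abs_self _).trans (hK s))
  have hK'0 : 0 ≤ K' := (norm_nonneg _).trans (hK' 0)
  obtain ⟨δ, hδ, hunif⟩ := exists_modulus_of_periodic hdc hdp (ε := (2 * K * (K' + 1))⁻¹)
    (by positivity)
  refine ⟨δ / 2, half_pos hδ, (2 * K)⁻¹, by positivity, fun a s t hst hs ht ↦ ?_⟩
  have hdiff := hc.differentiable (by simp)
  have hd : ∀ σ, HasDerivAt (fun σ ↦ inner ℝ (deriv c a) (c σ)) (inner ℝ (deriv c a) (deriv c σ)) σ :=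
    fun σ ↦ ((innerSL ℝ (deriv c a)).hasFDerivAt).comp_hasDerivAt σ (hdiff σ).hasDerivAt
  have hle : ∀ σ ∈ interior (Icc (a - δ / 2) (a + δ / 2)),
      (2 * K)⁻¹ ≤ deriv (fun σ ↦ inner ℝ (deriv c a) (c σ)) σ := by
    intro σ hσ
    have hσ := interior_subset hσ
    rw [(hd σ).deriv]
    have h1 : |σ - a| < δ := by
      rw [abs_lt]; constructor <;> linarith [hσ.1, hσ.2]
    have h2 := (hunif σ a h1).le
    rw [dist_eq_norm] at h2
    have e : inner ℝ (deriv c a) (deriv c σ) =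
        ‖deriv c a‖ ^ 2 + inner ℝ (deriv c a) (deriv c σ - deriv c a) := by
      rw [inner_sub_right, real_inner_self_eq_norm_sq]; ring
    have h3 : -(‖deriv c a‖ * ‖deriv c σ - deriv c a‖) ≤
        inner ℝ (deriv c a) (deriv c σ - deriv c a) :=
      (abs_le.1 (abs_real_inner_le_norm _ _)).1
    have h4 : ‖deriv c a‖ * ‖deriv c σ - deriv c a‖ ≤ (2 * K)⁻¹ := by
      calc _ ≤ (K' + 1) * (2 * K * (K' + 1))⁻¹ := by
            gcongr; linarith [hK' a]
        _ = (2 * K)⁻¹ := by field_simp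
    have h5 : K⁻¹ = (2 * K)⁻¹ + (2 * K)⁻¹ := by field_simp; norm_num
    linarith [hlow a]
  have key := (convex_Icc (a - δ / 2) (a + δ / 2)).mul_sub_le_image_sub_of_le_deriv
    (f := fun σ ↦ inner ℝ (deriv c a) (c σ))
    (fun σ _ ↦ (hd σ).continuousAt.continuousWithinAt)
    (fun σ _ ↦ (hd σ).differentiableAt.differentiableWithinAt) hle s
    ⟨by linarith [(abs_le.1 hs).1], by linarith [(abs_le.1 hs).2]⟩ t
    ⟨by linarith [(abs_le.1 ht).1], by linarith [(abs_le.1 ht).2]⟩ hst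
  rw [inner_sub_right]
  exact key

end PeriodicCurves

/-! ### Self-intersections of loops near an iterate. -/

section Cutting

variable {M : Type*} [TopologicalSpace M] [ChartedSpace Plane M]
  {N : ℕ} {e : M → EuclideanSpace ℝ (Fin N)}

theorem eventually_embedding_close (he : ContMDiff (𝓡 2) 𝓘(ℝ, EuclideanSpace ℝ (Fin N)) ∞ e)
    {ι : Type*} {l : Filter ι} {y : ι → H1Loop M} {x : H1Loop M} (h : Tendsto y l (𝓝 x)) {ε : ℝ}
    (hε : 0 < ε) : ∀ᶠ i in l, ∀ s, ‖e (y i s) - e (x s)‖ ≤ ε := by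
  have hN : (0 : ℝ) < N + 1 := by positivity
  have h1 : ∀ᶠ i in l, ∀ (j : Fin N), ∀ s,
      |smoothComponent he j (y i s) - smoothComponent he j (x s)| ≤ ε / (N + 1) :=
    eventually_all.2 fun j ↦ eventually_uniform_close h _ (div_pos hε hN)
  filter_upwards [h1] with i hi s
  have hsum : ‖e (y i s) - e (x s)‖ ≤ ∑ j, |(e (y i s) - e (x s)) j| := by
    have hb : e (y i s) - e (x s) = ∑ j, EuclideanSpace.single j ((e (y i s) - e (x s)) j) := by
      ext k
      simp
    calc ‖e (y i s) - e (x s)‖ ≤ ∑ j, ‖EuclideanSpace.single j ((e (y i s) - e (x s)) j)‖ := by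
          conv_lhs => rw [hb]
          exact norm_sum_le _ _
      _ = _ := by simp
  refine hsum.trans ((Finset.sum_le_sum fun j _ ↦ hi j s).trans ?_)
  rw [Finset.sum_const, Finset.card_univ, Fintype.card_fin, nsmul_eq_mul]
  rw [mul_div_assoc', div_le_iff₀ hN]
  nlinarith

variable [IsManifold (𝓡 2) ∞ M] [T2Space M] [CompactSpace M]

/-- Strict differentiability gives injectivity near each a; compactness of [0, 1] and periodicity
make the radius uniform. The embedding is needed so that ambient closeness to e(x a) places points
in the chart. -/
theorem exists_uniform_injectivity (he : ContMDiff (𝓡 2) 𝓘(ℝ, EuclideanSpace ℝ (Fin N)) ∞ e)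
    (hemb : IsClosedEmbedding e) (x : H1Loop M) {A : ℝ → EuclideanSpace ℝ (Fin N) →L[ℝ] ℂ}
    (hA : Continuous A) (hAp : Function.Periodic A 1)
    (hinj : ∀ a, ∃ φ ∈ IsManifold.maximalAtlas (𝓡 2) ∞ M, x a ∈ φ.source ∧
      ∀ v, A a (fderiv ℝ (fun q ↦ e (φ.symm q)) (φ (x a)) v) = 0 → v = 0) :
    ∃ ε > 0, ∀ a p q, ‖e p - e (x a)‖ < ε → ‖e q - e (x a)‖ < ε → A a (e p - e q) = 0 → p = q := by
  have hloc : ∀ a₀ : ℝ, ∃ U ∈ 𝓝 a₀, ∃ ε > 0, ∀ a ∈ U, ∀ p q, ‖e p - e (x a)‖ < ε →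
      ‖e q - e (x a)‖ < ε → A a (e p - e q) = 0 → p = q := by
    intro a₀
    obtain ⟨φ, hφ, hsrc, hker⟩ := hinj a₀
    have hstrict : HasStrictFDerivAt (fun q ↦ e (φ.symm q))
        (fderiv ℝ (fun q ↦ e (φ.symm q)) (φ (x a₀))) (φ (x a₀)) :=
      ((contDiffOn_comp_symm he hφ).contDiffAt
        (φ.open_target.mem_nhds (φ.map_source hsrc))).hasStrictFDerivAt (by simp)
    have h1 := eventually_eq_of_apply_sub_eq_zero hA.continuousAt hstrict hker
    rw [nhds_prod_eq, nhds_prod_eq, eventually_prod_iff] at h1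
    obtain ⟨pa, hpa, pb, hpb, h1⟩ := h1
    rw [eventually_prod_iff] at hpb
    obtain ⟨pc, hpc, pd, hpd, h2⟩ := hpb
    have hev : ∀ᶠ p in 𝓝 (x a₀), p ∈ φ.source ∧ pc (φ p) ∧ pd (φ p) := by
      have hsrc' : ∀ᶠ p in 𝓝 (x a₀), p ∈ φ.source := φ.open_source.mem_nhds hsrc
      exact hsrc'.and <| ((φ.continuousAt hsrc).eventually hpc).and ((φ.continuousAt hsrc).eventually hpd)
    rw [hemb.isInducing.nhds_eq_comap, eventually_comap] at hev
    obtain ⟨r, hr, hball⟩ := Metric.eventually_nhds_iff.1 hev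
    have hcx : Continuous fun a ↦ e (x a) := he.continuous.comp x.continuous
    have hnear : ∀ᶠ a in 𝓝 a₀, dist (e (x a)) (e (x a₀)) < r / 2 :=
      Metric.tendsto_nhds.1 hcx.continuousAt (r / 2) (half_pos hr)
    refine ⟨_, hpa.and hnear, r / 2, half_pos hr, ?_⟩
    rintro a ⟨ha1, ha2⟩ p q hp hq h0
    rw [← dist_eq_norm] at hp hq
    have gp := hball (y := e p) ((dist_triangle _ (e (x a)) _).trans_lt (by linarith)) p rfl
    have gq := hball (y := e q) ((dist_triangle _ (e (x a)) _).trans_lt (by linarith)) q rfl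
    have := h1 ha1 (h2 gp.2.1 gq.2.2) (by
      simp only [φ.left_inv gp.1, φ.left_inv gq.1]; exact h0)
    exact φ.injOn gp.1 gq.1 this
  have hcomp : ∃ ε > 0, ∀ a ∈ Icc (0 : ℝ) 1, ∀ p q, ‖e p - e (x a)‖ < ε →
      ‖e q - e (x a)‖ < ε → A a (e p - e q) = 0 → p = q := by
    refine isCompact_Icc.induction_on (p := fun S ↦ ∃ ε > 0, ∀ a ∈ S, ∀ p q, ‖e p - e (x a)‖ < ε →
      ‖e q - e (x a)‖ < ε → A a (e p - e q) = 0 → p = q) ⟨1, one_pos, by simp⟩ ?_ ?_ ?_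
    · rintro S S' hSS' ⟨ε, hε, h⟩
      exact ⟨ε, hε, fun a ha ↦ h a (hSS' ha)⟩
    · rintro S S' ⟨ε, hε, h⟩ ⟨ε', hε', h'⟩
      refine ⟨min ε ε', lt_min hε hε', ?_⟩
      rintro a (ha | ha) p q hp hq
      · exact h a ha p q (hp.trans_le (min_le_left _ _)) (hq.trans_le (min_le_left _ _))
      · exact h' a ha p q (hp.trans_le (min_le_right _ _)) (hq.trans_le (min_le_right _ _))
    · intro a _
      obtain ⟨U, hU, h⟩ := hloc a
      exact ⟨U, mem_nhdsWithin_of_mem_nhds hU, h⟩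
  obtain ⟨ε, hε, h⟩ := hcomp
  refine ⟨ε, hε, fun a p q ↦ ?_⟩
  have hAf : A (Int.fract a) = A a := by
    have := hAp.sub_zsmul_eq (x := a) ⌊a⌋
    rw [← this, zsmul_one]; rfl
  have := h (Int.fract a) ⟨Int.fract_nonneg a, (Int.fract_lt_one a).le⟩ p q
  rwa [x.map_fract, hAf] at this

/-- A loop close to the `n`-th iterate of an immersed loop passes twice through a point, after
about one period. -/
theorem exists_cut (hM : IsOrientable M)
    (he : ContMDiff (𝓡 2) 𝓘(ℝ, EuclideanSpace ℝ (Fin N)) ∞ e) (hemb : IsClosedEmbedding e)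
    (himm : ∀ p : M, Function.Injective (mfderiv (𝓡 2) 𝓘(ℝ, EuclideanSpace ℝ (Fin N)) e p))
    {x : H1Loop M} (hx : ∀ f : SmoothFun M, ContDiff ℝ 1 fun s ↦ f (x s))
    (hne : ∀ a, deriv (fun s ↦ e (x s)) a ≠ 0) {n : ℕ} (hn : 1 ≤ n) {ε : ℝ} (hε : 0 < ε) :
    ∀ᶠ y in 𝓝 (x.iterate n hn), ∃ t ℓ : ℝ, |n * ℓ - 1| ≤ ε ∧ y t = y (t + ℓ) := by
  obtain ⟨𝒜, h𝒜, hcov, hor⟩ := hM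
  set c : ℝ → EuclideanSpace ℝ (Fin N) := fun s ↦ e (x s) with hc
  have hcC : ContDiff ℝ 1 c := contDiff_embedding_comp he hx
  have hcp : Function.Periodic c 1 := fun s ↦ by simp only [hc, x.periodic' s]
  have hdc : Continuous (deriv c) := hcC.continuous_deriv le_rfl
  obtain ⟨β, hβ, hβp, hdet⟩ := exists_conormal he himm hx hne h𝒜 hcov hor
  set A : ℝ → EuclideanSpace ℝ (Fin N) →L[ℝ] ℂ := fun a ↦ frameMap (innerSL ℝ (deriv c a)) (β a)
    with hA
  have hAc : Continuous A := continuous_frameMap ((innerSL ℝ).continuous.comp hdc) hβ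
  have hAp : Function.Periodic A 1 := fun a ↦ by simp only [hA, periodic_deriv hcp a, hβp a]
  have hre : ∀ a v, (A a v).re = inner ℝ (deriv c a) v := fun a v ↦ by simp [hA]
  obtain ⟨ε₀, hε₀, hinj⟩ := exists_uniform_injectivity he hemb x hAc hAp (fun a ↦ by
    obtain ⟨φ, hφ, hsrc⟩ := hcov (x a)
    refine ⟨φ, h𝒜 hφ, hsrc, fun v hv ↦ ?_⟩
    refine eq_zero_of_frameDet_ne_zero (hdet a φ hφ hsrc).ne' ?_ ?_
    · have := congrArg Complex.re hv
      simpa [hA] using this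
    · have := congrArg Complex.im hv
      simpa [hA] using this)
  obtain ⟨η₀, hη₀, m, hm, hmono⟩ := exists_inner_monotone hcC hcp hne
  obtain ⟨δ, hδ, hunif⟩ := exists_modulus_of_periodic hcC.continuous hcp (half_pos hε₀)
  obtain ⟨K, hK⟩ := exists_bound_of_periodic hdc (periodic_deriv hcp)
  have hK0 : 0 ≤ K := (norm_nonneg _).trans (hK 0)
  -- The bound ε/2 controls the final time error 2η; η₀/3 keeps offsets up to 3η in the monotonicity
  -- window; δ/4 keeps them within the modulus of continuity.
  set η : ℝ := min (ε / 2) (min (η₀ / 3) (δ / 4)) with hηd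
  have hη : 0 < η := lt_min (half_pos hε) (lt_min (by linarith) (by linarith))
  have η1 : η ≤ ε / 2 := min_le_left _ _
  have η2 : η ≤ η₀ / 3 := (min_le_right _ _).trans (min_le_left _ _)
  have η3 : η ≤ δ / 4 := (min_le_right _ _).trans (min_le_right _ _)
  -- The distance r between w and c must not spoil injectivity, nor change tangential components by
  -- as much as the gap mη; the `+ 1` covers K = 0.
  set r : ℝ := min (ε₀ / 4) (m * η / (2 * (2 * K + 1))) with hr
  have hrpos : 0 < r := lt_min (by linarith) (by positivity)
  have r1 : r ≤ ε₀ / 4 := min_le_left _ _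
  have r2 : K * (2 * r) < m * η := by
    have h1 : r ≤ m * η / (2 * (2 * K + 1)) := min_le_right _ _
    rw [le_div_iff₀ (by positivity)] at h1
    have := mul_pos hm hη
    nlinarith
  have hnpos : (0 : ℝ) < n := by exact_mod_cast hn
  filter_upwards [eventually_embedding_close he (l := 𝓝 (x.iterate n hn)) tendsto_id hrpos] with y hy
  -- Time is rescaled so that w follows c at unit rate and closes up after n periods.
  set w : ℝ → EuclideanSpace ℝ (Fin N) := fun τ ↦ e (y (τ / n)) with hw
  have hwc : ∀ τ, ‖w τ - c τ‖ ≤ r := fun τ ↦ by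
    have := hy (τ / n)
    rwa [H1Loop.iterate_apply, mul_div_cancel₀ _ hnpos.ne'] at this
  have hwcont : Continuous w :=
    (he.continuous.comp y.continuous).comp (continuous_id.div_const _)
  have hwp : Function.Periodic w n := fun τ ↦ by
    simp only [hw]
    rw [add_div, div_self hnpos.ne', y.periodic']
  have hcint : ∀ (j : ℕ) τ, c (j + τ) = c τ := fun j τ ↦ by
    have := x.map_add_int τ j
    simp only [hc]
    rw [add_comm]
    exact congrArg e (by exact_mod_cast this)
  have hc1 : ∀ τ u, c (τ + 1 + u) = c (τ + u) := fun τ u ↦ by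
    rw [show τ + 1 + u = τ + u + 1 by ring, hcp]
  -- the perturbation of the linear form caused by replacing `c` by `w`
  have hpert : ∀ a v v' : ℝ, ∀ p : EuclideanSpace ℝ (Fin N), ∀ p', ‖p - c v‖ ≤ r → ‖p' - c v'‖ ≤ r →
      |inner ℝ (deriv c a) (p - p') - inner ℝ (deriv c a) (c v - c v')| < m * η := by
    intro a v v' p p' hp hp'
    rw [← inner_sub_right]
    refine (abs_real_inner_le_norm _ _).trans_lt (lt_of_le_of_lt ?_ r2)
    refine mul_le_mul (hK a) ?_ (norm_nonneg _) hK0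
    calc ‖p - p' - (c v - c v')‖ = ‖(p - c v) - (p' - c v')‖ := by congr 1; abel
      _ ≤ 2 * r := (norm_sub_le _ _).trans (by linarith)
  have hcross : ∃ a u : ℝ, |u| ≤ 2 * η ∧ w (a + 1 + u) = w a := by
    refine exists_crossing (c₀ := c 0) hAc hAp hwcont hn hwp hη ?_ ?_ ?_
    · intro a b u hb
      rw [hre]
      have hb' := abs_le.1 hb
      have hp := hpert (a + b) (a + u) a (w (a + 1 + u)) (w a)
        (by rw [← hc1]; exact hwc _) (hwc _)
      have hp' := abs_lt.1 hp
      constructor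
      · intro hueq
        have h1 := hmono (a + b) (a + u) a (by linarith)
          (abs_le.2 ⟨by linarith, by linarith⟩) (abs_le.2 ⟨by linarith, by linarith⟩)
        rw [← neg_sub (c (a + u)) (c a), inner_neg_right] at h1
        have h2 : m * (a - (a + u)) = 2 * (m * η) := by rw [hueq]; ring
        have := mul_pos hm hη
        linarith [hp'.2]
      · intro hueq
        have h1 := hmono (a + b) a (a + u) (by linarith)
          (abs_le.2 ⟨by linarith, by linarith⟩) (abs_le.2 ⟨by linarith, by linarith⟩)
        have h2 : m * (a + u - a) = 2 * (m * η) := by rw [hueq]; ring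
        have := mul_pos hm hη
        linarith [hp'.1]
    · intro j u
      rw [hre]
      have hp := hpert 0 u 0 (w (j + u)) (c 0) (by rw [← hcint j]; exact hwc _) (by simpa using hrpos.le)
      have hp' := abs_lt.1 hp
      constructor
      · intro hI
        have h1 := hmono 0 u 0 (by linarith [hI.2])
          (abs_le.2 ⟨by linarith [hI.1], by linarith [hI.2]⟩) (by simpa using hη₀.le)
        rw [← neg_sub (c u) (c 0), inner_neg_right] at h1
        have h2 : m * η ≤ m * (0 - u) := mul_le_mul_of_nonneg_left (by linarith [hI.2]) hm.le
        linarith [hp'.2]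
      · intro hI
        have h1 := hmono 0 0 u (by linarith [hI.1]) (by simpa using hη₀.le)
          (abs_le.2 ⟨by linarith [hI.1], by linarith [hI.2]⟩)
        have h2 : m * η ≤ m * (u - 0) := mul_le_mul_of_nonneg_left (by linarith [hI.1]) hm.le
        linarith [hp'.1]
    · intro a b u hb hu h0
      have near : ∀ τ τ', ‖w τ - c τ'‖ ≤ r → |τ' - (a + b)| < δ → ‖w τ - c (a + b)‖ < ε₀ := by
        intro τ τ' h1 h2
        have h3 := hunif τ' (a + b) h2
        rw [dist_eq_norm] at h3
        calc ‖w τ - c (a + b)‖ = ‖(w τ - c τ') + (c τ' - c (a + b))‖ := by congr 1; abel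
          _ ≤ ‖w τ - c τ'‖ + ‖c τ' - c (a + b)‖ := norm_add_le _ _
          _ < ε₀ := by linarith
      have hb' := abs_le.1 hb
      have hu' := abs_le.1 hu
      have h1 := near (a + 1 + u) (a + u) (by rw [← hc1]; exact hwc _)
        (abs_lt.2 ⟨by linarith, by linarith⟩)
      have h2 := near a a (hwc _) (abs_lt.2 ⟨by linarith, by linarith⟩)
      exact congrArg e (hinj (a + b) _ _ h1 h2 h0)
  obtain ⟨a, u, hu, hau⟩ := hcross
  refine ⟨a / n, (1 + u) / n, ?_, ?_⟩
  · rw [mul_div_cancel₀ _ hnpos.ne', add_sub_cancel_left]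
    linarith
  · refine hemb.injective ?_
    rw [← add_div, ← add_assoc]
    exact hau.symm

end Cutting

/-! ### Convergence of the two parts of a cut curve. -/

section CutCurves

variable {M : Type*} [TopologicalSpace M] [ChartedSpace Plane M]

variable (M) in
/-- Closed curves with a marked pair of times `t < t + ℓ < t + 1` at which they pass through the same
point. -/
structure CutCurve where
  curve : CurveSpace M
  time : ℝ
  length : ℝ
  length_pos : 0 < length
  length_lt : 0 < 1 - length
  closed : curve.1 time = curve.1 (time + length)

namespace CutCurve

theorem closed' (i : CutCurve M) :
    i.curve.1 (i.time + i.length) = i.curve.1 (i.time + i.length + (1 - i.length)) := by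
  rw [show i.time + i.length + (1 - i.length) = i.time + 1 by ring, i.curve.1.periodic', i.closed]

/-- The first of the two closed curves into which a cut curve decomposes; the starting time is
adapted to curves close to an `n`-th iterate. -/
def first (n : ℕ) (i : CutCurve M) : CurveSpace M :=
  ((i.curve.1.piece i.time i.length i.length_pos i.closed).shift (-(n * i.time) / (1 : ℕ)),
    ⟨i.length * i.curve.2, mul_pos i.length_pos i.curve.2.2⟩)

/-- The second of the two closed curves into which a cut curve decomposes. -/
def second (n k : ℕ) (i : CutCurve M) : CurveSpace M :=
  ((i.curve.1.piece (i.time + i.length) (1 - i.length) i.length_lt i.closed').shift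
      (-(n * (i.time + i.length)) / k),
    ⟨(1 - i.length) * i.curve.2, mul_pos i.length_lt i.curve.2.2⟩)

end CutCurve

/-- Cut curves converging to the `n`-th iterate of `α`, cut after one period. -/
def cutFilter (α : CurveSpace M) (n : ℕ) (hn : 1 ≤ n) : Filter (CutCurve M) :=
  comap (fun i : CutCurve M ↦ (i.curve, (n : ℝ) * i.length)) (𝓝 (iterate α n hn, 1))

variable {α : CurveSpace M} {n : ℕ} {hn : 1 ≤ n}

theorem tendsto_curve_cutFilter :
    Tendsto CutCurve.curve (cutFilter α n hn) (𝓝 (iterate α n hn)) :=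
  (continuous_fst.tendsto (iterate α n hn, (1 : ℝ))).comp tendsto_comap

theorem tendsto_length_cutFilter :
    Tendsto (fun i : CutCurve M ↦ (n : ℝ) * i.length) (cutFilter α n hn) (𝓝 1) :=
  (continuous_snd.tendsto (iterate α n hn, (1 : ℝ))).comp tendsto_comap

theorem tendsto_loop_cutFilter :
    Tendsto (fun i : CutCurve M ↦ i.curve.1) (cutFilter α n hn) (𝓝 (α.1.iterate n hn)) :=
  (continuous_fst.tendsto (iterate α n hn)).comp tendsto_curve_cutFilter

theorem tendsto_period_cutFilter :
    Tendsto (fun i : CutCurve M ↦ (i.curve.2 : ℝ)) (cutFilter α n hn) (𝓝 (n * α.2)) :=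
  ((continuous_subtype_val.comp continuous_snd).tendsto (iterate α n hn)).comp
    tendsto_curve_cutFilter

theorem tendsto_first (hx : ∀ f : SmoothFun M, ContDiff ℝ 1 fun s ↦ f (α.1 s)) :
    Tendsto (CutCurve.first n) (cutFilter α n hn) (𝓝 (iterate α 1 le_rfl)) := by
  have hnpos : (0 : ℝ) < n := by exact_mod_cast hn
  refine Tendsto.prodMk_nhds (tendsto_shift_piece hx hn le_rfl tendsto_loop_cutFilter
    (fun i ↦ i.length_pos) (fun i ↦ by linarith [i.length_lt]) (fun i ↦ i.closed)
    (by simpa using tendsto_length_cutFilter)) ?_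
  rw [tendsto_subtype_rng]
  have h := (tendsto_length_cutFilter (α := α) (hn := hn)).mul
    ((tendsto_period_cutFilter (α := α) (hn := hn)).div_const n)
  have e : (1 : ℝ) * (n * α.2 / n) = (1 : ℕ) * α.2 := by field_simp; simp
  rw [e] at h
  refine h.congr fun i ↦ ?_
  field_simp

theorem tendsto_second (hx : ∀ f : SmoothFun M, ContDiff ℝ 1 fun s ↦ f (α.1 s)) {k : ℕ}
    (hk : 1 ≤ k) {hn : 1 ≤ k + 1} :
    Tendsto (CutCurve.second (k + 1) k) (cutFilter α (k + 1) hn) (𝓝 (iterate α k hk)) := by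
  have hnpos : (0 : ℝ) < ((k + 1 : ℕ) : ℝ) := by positivity
  have hlen : Tendsto (fun i : CutCurve M ↦ ((k + 1 : ℕ) : ℝ) * (1 - i.length))
      (cutFilter α (k + 1) hn) (𝓝 (k : ℝ)) := by
    have h := (tendsto_length_cutFilter (α := α) (hn := hn)).const_sub ((k + 1 : ℕ) : ℝ)
    have e : ((k + 1 : ℕ) : ℝ) - 1 = k := by push_cast; ring
    rw [e] at h
    exact h.congr fun i ↦ by ring
  refine Tendsto.prodMk_nhds (tendsto_shift_piece hx hn hk tendsto_loop_cutFilter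
    (fun i ↦ i.length_lt) (fun i ↦ by linarith [i.length_pos]) (fun i ↦ i.closed') hlen) ?_
  rw [tendsto_subtype_rng]
  have h := hlen.mul ((tendsto_period_cutFilter (α := α) (hn := hn)).div_const ((k + 1 : ℕ) : ℝ))
  have e : (k : ℝ) * (((k + 1 : ℕ) : ℝ) * α.2 / ((k + 1 : ℕ) : ℝ)) = k * α.2 := by field_simp
  rw [e] at h
  refine h.congr fun i ↦ ?_
  field_simp

theorem iterate_one (h : 1 ≤ 1) : iterate α 1 h = α := by
  refine Prod.ext (H1Loop.ext fun s ↦ ?_) (Subtype.ext ?_)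
  · change α.1 (((1 : ℕ) : ℝ) * s) = α.1 s
    rw [Nat.cast_one, one_mul]
  · change ((1 : ℕ) : ℝ) * (α.2 : ℝ) = α.2
    rw [Nat.cast_one, one_mul]

end CutCurves

/-! ### Additivity of the action and the induction for local minimizers. -/

section Action

variable {M : Type*} [TopologicalSpace M] [ChartedSpace Plane M] [IsManifold (𝓡 2) ∞ M]
  [T2Space M] [CompactSpace M] (g : SmoothMetric M) (θ : SmoothOneForm M) (κ : ℝ)

theorem action_cut (n k : ℕ) (i : CutCurve M) :
    action g θ κ i.curve = action g θ κ (i.first n) + action g θ κ (i.second n k) := by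
  rw [CutCurve.first, CutCurve.second, action_shift, action_shift]
  exact action_split g θ κ i.curve.1 i.curve.2 i.length_pos i.length_lt i.closed i.closed'

theorem action_iterate (α : CurveSpace M) (n : ℕ) (hn : 1 ≤ n) :
    action g θ κ (iterate α n hn) = n * action g θ κ α := by
  have hnpos : (0 : ℝ) < n := by exact_mod_cast hn
  obtain ⟨x, T⟩ := α
  have e1 : action g θ κ (iterate (x, T) n hn) = n * T *
      ∫ s in (0 : ℝ)..1, (lagAlong g θ (n * T) (x.iterate n hn).toFun s + κ) := rfl
  have hl : ∀ s, lagAlong g θ (n * T) (x.iterate n hn).toFun s = lagAlong g θ T x.toFun (n * s) := by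
    intro s
    have := lagAlong_affine g θ x.toFun T hnpos.ne' 0 s
    simp only [zero_add] at this
    exact this
  have hp : Function.Periodic (fun s ↦ lagAlong g θ T x.toFun s + κ) 1 := fun s ↦ by
    simp only [lagAlong_periodic g θ x T s]
  have h2 := hp.intervalIntegral_add_zsmul_eq n 0 fun a b ↦
    (intervalIntegrable_lagAlong g θ x T a b).add intervalIntegrable_const
  simp only [zero_add, zsmul_eq_mul, Int.cast_natCast, mul_one] at h2
  rw [e1, action_eq]
  simp only [hl]
  rw [intervalIntegral.integral_comp_mul_left (fun s ↦ lagAlong g θ T x.toFun s + κ) hnpos.ne',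
    mul_zero, mul_one, h2, smul_eq_mul]
  field_simp

variable {g θ κ} {α : CurveSpace M}

/-- A property of the curves near an iterate of an immersed loop may be checked on cut curves. -/
theorem eventually_of_eventually_cut (hM : IsOrientable M) {N : ℕ}
    {e : M → EuclideanSpace ℝ (Fin N)} (he : ContMDiff (𝓡 2) 𝓘(ℝ, EuclideanSpace ℝ (Fin N)) ∞ e)
    (hemb : IsClosedEmbedding e)
    (himm : ∀ p : M, Function.Injective (mfderiv (𝓡 2) 𝓘(ℝ, EuclideanSpace ℝ (Fin N)) e p))
    (hx : ∀ f : SmoothFun M, ContDiff ℝ 1 fun s ↦ f (α.1 s))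
    (hne : ∀ a, deriv (fun s ↦ e (α.1 s)) a ≠ 0) {n : ℕ} (hn : 1 ≤ n) (hn2 : 2 ≤ n)
    {P : CurveSpace M → Prop} (h : ∀ᶠ i in cutFilter α n hn, P i.curve) :
    ∀ᶠ β in 𝓝 (iterate α n hn), P β := by
  rw [cutFilter, eventually_comap, nhds_prod_eq, eventually_prod_iff] at h
  obtain ⟨pa, hpa, pb, hpb, h⟩ := h
  obtain ⟨ε, hε, hball⟩ := Metric.eventually_nhds_iff.1 hpb
  have hn2' : (2 : ℝ) ≤ n := by exact_mod_cast hn2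
  -- The bound 1/2 ensures 1/2 ≤ nℓ ≤ 3/2, hence 0 < ℓ < 1 because n ≥ 2.
  have hcut := exists_cut hM he hemb himm hx hne hn (ε := min (ε / 2) (1 / 2))
    (lt_min (half_pos hε) (by norm_num))
  have hcut' := (continuous_fst.tendsto (iterate α n hn)).eventually hcut
  filter_upwards [hpa, hcut'] with β hβ1 ⟨t, ℓ, hℓ, hy⟩
  have h1 : |n * ℓ - 1| ≤ ε / 2 := hℓ.trans (min_le_left _ _)
  have h2 := abs_le.1 (hℓ.trans (min_le_right _ _))
  have hpos : 0 < ℓ := by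
    by_contra! hneg
    have := mul_nonpos_of_nonneg_of_nonpos (by linarith : (0 : ℝ) ≤ n) hneg
    linarith
  have hlt : 0 < 1 - ℓ := by
    have := mul_le_mul_of_nonneg_right hn2' hpos.le
    linarith
  exact h hβ1 (hball (y := n * ℓ) (by rw [Real.dist_eq]; linarith)) ⟨β, t, ℓ, hpos, hlt, hy⟩ rfl

/-- The induction peels off one copy of α: on a cut curve near the (k+1)-st iterate, minimality of α
bounds the first part and the induction hypothesis the second. -/
theorem isLocalMin_iterate (hM : IsOrientable M) (hκ : 0 < κ)
    (hmin : IsLocalMin (action g θ κ) α) {n : ℕ} (hn : 1 ≤ n) :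
    IsLocalMin (action g θ κ) (iterate α n hn) := by
  obtain ⟨N, e, he, hemb, himm⟩ := exists_smooth_embedding M
  have hx := minimizer_contDiff g θ (x := α.1) (T := α.2) hmin
  have hne := minimizer_deriv_ne_zero g θ hκ (x := α.1) (T := α.2) hmin he hemb.injective himm
  induction n, hn using Nat.le_induction with
  | base => rw [iterate_one]; exact hmin
  | succ k hk ih =>
    change ∀ᶠ β in _, _
    refine eventually_of_eventually_cut hM he hemb himm hx hne _ (by omega) ?_
    have h1 : ∀ᶠ β in 𝓝 (iterate α 1 le_rfl), action g θ κ α ≤ action g θ κ β := by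
      rw [iterate_one]; exact hmin
    have h2 : ∀ᶠ β in 𝓝 (iterate α k hk), action g θ κ (iterate α k hk) ≤ action g θ κ β := ih
    filter_upwards [(tendsto_first hx).eventually h1, (tendsto_second hx hk).eventually h2]
      with i hi1 hi2
    rw [action_cut g θ κ (k + 1) k i, action_iterate]
    rw [action_iterate] at hi2
    push_cast
    linarith

end Action

/-- A shift that moves a periodic curve little is close to a period of the curve. -/
theorem exists_period_near {E : Type*} [NormedAddCommGroup E] {c : ℝ → E} (hc : Continuous c)
    (hp : Function.Periodic c 1) {η : ℝ} (hη : 0 < η) :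
    ∃ ε > 0, ∀ d : ℝ, (∀ s, ‖c (d + s) - c s‖ ≤ ε) → ∃ ϖ, (∀ s, c (ϖ + s) = c s) ∧ |d - ϖ| < η := by
  -- On the compact set of shifts at distance at least η from all periods, each shift moves some
  -- point; compactness gives a uniform displacement ε.
  set S : Set ℝ := Icc 0 1 ∩ {d | ∀ ϖ, (∀ s, c (ϖ + s) = c s) → η ≤ |d - ϖ|} with hS
  have hScl : IsClosed {d : ℝ | ∀ ϖ, (∀ s, c (ϖ + s) = c s) → η ≤ |d - ϖ|} := by
    simp only [ofPred_forall]
    exact isClosed_iInter fun ϖ ↦ isClosed_iInter fun _ ↦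
      isClosed_le continuous_const (continuous_id.sub continuous_const).abs
  have hScomp : IsCompact S := isCompact_Icc.inter_right hScl
  have key : ∃ ε > 0, ∀ d ∈ S, ∃ s, ε < ‖c (d + s) - c s‖ := by
    refine hScomp.induction_on (p := fun A ↦ ∃ ε > 0, ∀ d ∈ A, ∃ s, ε < ‖c (d + s) - c s‖)
      ⟨1, one_pos, by simp⟩ ?_ ?_ ?_
    · rintro A A' hAA' ⟨ε, hε, h⟩
      exact ⟨ε, hε, fun d hd ↦ h d (hAA' hd)⟩
    · rintro A A' ⟨ε, hε, h⟩ ⟨ε', hε', h'⟩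
      refine ⟨min ε ε', lt_min hε hε', ?_⟩
      rintro d (hd | hd)
      · obtain ⟨s, hs⟩ := h d hd
        exact ⟨s, (min_le_left _ _).trans_lt hs⟩
      · obtain ⟨s, hs⟩ := h' d hd
        exact ⟨s, (min_le_right _ _).trans_lt hs⟩
    · intro d hd
      have hne : ¬ ∀ s, c (d + s) = c s := fun h ↦ by
        have := hd.2 d h
        rw [sub_self, abs_zero] at this
        linarith
      push Not at hne
      obtain ⟨s, hs⟩ := hne
      have hpos : 0 < ‖c (d + s) - c s‖ := norm_pos_iff.2 (sub_ne_zero.2 hs)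
      refine ⟨{d' | ‖c (d + s) - c s‖ / 2 < ‖c (d' + s) - c s‖}, mem_nhdsWithin_of_mem_nhds ?_,
        ‖c (d + s) - c s‖ / 2, half_pos hpos, fun d' hd' ↦ ⟨s, hd'⟩⟩
      have hcont : Continuous fun d' ↦ ‖c (d' + s) - c s‖ := by fun_prop
      exact hcont.continuousAt.eventually (Ioi_mem_nhds (half_lt_self hpos))
  obtain ⟨ε, hε, h⟩ := key
  refine ⟨ε, hε, fun d hd ↦ ?_⟩
  by_contra! hno
  have hint : ∀ (m : ℤ) s, c (s + m) = c s := fun m s ↦ by simpa using hp.int_mul m s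
  obtain ⟨s, hs⟩ := h (Int.fract d) ⟨⟨Int.fract_nonneg d, (Int.fract_lt_one d).le⟩, fun ϖ hϖ ↦ by
    have := hno (ϖ + ⌊d⌋) fun s ↦ by
      rw [add_right_comm, hint, hϖ]
    rwa [← sub_sub, sub_right_comm] at this⟩
  have e : c (Int.fract d + s) = c (d + s) := by
    rw [← hint ⌊d⌋, add_right_comm, Int.fract_add_floor]
  rw [e] at hs
  exact absurd (hd s) (not_le.2 hs)

/-! ### Orbits under time shift. -/

section Orbits

variable {M : Type*} [TopologicalSpace M] [ChartedSpace Plane M]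

theorem mem_orbit_self (α : CurveSpace M) : α ∈ orbit α := ⟨rfl, 0, fun s ↦ by rw [zero_add]⟩

theorem shift_mem_orbit_iff {α γ : CurveSpace M} (σ : ℝ) :
    ((γ.1.shift σ, γ.2) : CurveSpace M) ∈ orbit α ↔ γ ∈ orbit α := by
  constructor
  · rintro ⟨h1, τ, h2⟩
    refine ⟨h1, τ - σ, fun s ↦ ?_⟩
    have := h2 (s - σ)
    simp only [H1Loop.shift_apply, add_sub_cancel] at this
    rw [this]
    congr 1
    ring
  · rintro ⟨h1, τ, h2⟩
    refine ⟨h1, τ + σ, fun s ↦ ?_⟩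
    simp only [H1Loop.shift_apply]
    rw [h2]
    congr 1
    ring

theorem eq_shift_of_mem_orbit {α β : CurveSpace M} (h : β ∈ orbit α) :
    ∃ σ, β = (α.1.shift σ, α.2) := by
  obtain ⟨h1, σ, h2⟩ := h
  exact ⟨σ, Prod.ext (H1Loop.ext h2) h1⟩

end Orbits

/-! ### Strict local minimizers. -/

section Strict

variable {M : Type*} [TopologicalSpace M] [ChartedSpace Plane M]

/-- If both parts of a cut curve close to an iterate of an immersed loop are iterates of this loop, up
to time shifts, then so is the cut curve. -/
theorem eventually_mem_orbit_of_cut {α : CurveSpace M} {N : ℕ}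
    {e : M → EuclideanSpace ℝ (Fin N)} (he : ContMDiff (𝓡 2) 𝓘(ℝ, EuclideanSpace ℝ (Fin N)) ∞ e)
    (hinj : Function.Injective e) (hx : ∀ f : SmoothFun M, ContDiff ℝ 1 fun s ↦ f (α.1 s))
    (hne : ∀ a, deriv (fun s ↦ e (α.1 s)) a ≠ 0) {k : ℕ} (hk : 1 ≤ k) {hn : 1 ≤ k + 1} :
    ∀ᶠ i in cutFilter α (k + 1) hn, i.first (k + 1) ∈ orbit α →
      i.second (k + 1) k ∈ orbit (iterate α k hk) → i.curve ∈ orbit (iterate α (k + 1) hn) := by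
  obtain ⟨x, T⟩ := α
  set c : ℝ → EuclideanSpace ℝ (Fin N) := fun s ↦ e (x s) with hc
  have hcC : ContDiff ℝ 1 c := contDiff_embedding_comp he hx
  have hcp : Function.Periodic c 1 := fun s ↦ by simp only [hc, x.periodic' s]
  obtain ⟨η, hη, m, hm, hmono⟩ := exists_inner_monotone hcC hcp hne
  have hloc : ∀ s t : ℝ, |t - s| ≤ η → c s = c t → s = t := by
    have aux : ∀ s t : ℝ, s ≤ t → |t - s| ≤ η → c s = c t → s = t := by
      intro s t hst h heq
      have h1 := hmono s s t hst (by simpa using hη.le) h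
      rw [heq, sub_self, inner_zero_right] at h1
      have h2 : t - s ≤ 0 := by
        by_contra! hlt
        have := mul_pos hm hlt
        linarith
      linarith
    intro s t h heq
    rcases le_total s t with hst | hst
    · exact aux s t hst h heq
    · exact (aux t s hst (by rwa [abs_sub_comm]) heq.symm).symm
  obtain ⟨ε, hε, hper⟩ := exists_period_near hcC.continuous hcp hη
  have hclose := eventually_embedding_close he
    (tendsto_loop_cutFilter (α := (x, T)) (n := k + 1) (hn := hn)) (half_pos hε)
  filter_upwards [hclose] with i hi h1 h2
  obtain ⟨⟨y, T'⟩, t, ℓ, hℓ, hℓ1, hcl⟩ := i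
  obtain ⟨p1, σ₁, q1⟩ := h1
  obtain ⟨p2, σ₂, q2⟩ := h2
  have hkpos : (0 : ℝ) < k := by exact_mod_cast hk
  have hTpos : (0 : ℝ) < T := T.2
  have p1 : ℓ * (T' : ℝ) = T := congrArg Subtype.val p1
  have p2 : (1 - ℓ) * (T' : ℝ) = k * T := congrArg Subtype.val p2
  -- Adding the two period equations fixes the total period, and then the cut time satisfies (k+1)ℓ
  -- = 1 exactly.
  have hT' : (T' : ℝ) = (k + 1) * T := by linarith
  have hnℓ : ((k : ℝ) + 1) * ℓ = 1 := by
    rw [hT'] at p1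
    have : T * (((k : ℝ) + 1) * ℓ - 1) = 0 := by linear_combination p1
    have := (mul_eq_zero.1 this).resolve_left hTpos.ne'
    linarith
  set n : ℝ := (k : ℝ) + 1 with hnd
  have hcast : ((k + 1 : ℕ) : ℝ) = n := by push_cast; rfl
  -- Here a₁ and a₂ are the phases of x at which the first and the second part start.
  set a₁ : ℝ := σ₁ + n * t with ha₁
  set a₂ : ℝ := k * σ₂ + n * (t + ℓ) with ha₂
  have E1 : ∀ r ∈ Icc (0 : ℝ) 1, y (t + ℓ * r) = x (a₁ + r) := by
    intro r hr
    have h := q1 (n * t + r)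
    simp only [CutCurve.first, H1Loop.shift_apply, hcast, Nat.cast_one, div_one,
      neg_add_cancel_left] at h
    rw [H1Loop.piece_apply hr] at h
    rw [h, ha₁, add_assoc]
  have E2 : ∀ r ∈ Icc (0 : ℝ) 1, y (t + ℓ + (1 - ℓ) * r) = x (a₂ + k * r) := by
    intro r hr
    have h := q2 (n * (t + ℓ) / k + r)
    simp only [CutCurve.second, H1Loop.shift_apply, hcast, neg_div, neg_add_cancel_left] at h
    rw [H1Loop.piece_apply hr] at h
    rw [h]
    change x (k * (σ₂ + (n * (t + ℓ) / k + r))) = _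
    congr 1
    rw [ha₂]
    field_simp
    ring
  have hi' : ∀ s, ‖e (y s) - c (n * s)‖ ≤ ε / 2 := fun s ↦ by
    have := hi s
    rwa [H1Loop.iterate_apply, hcast] at this
  -- Both parts follow c(nt + ρ) within ε/2, the second one a period later, so the two phases give
  -- nearly the same parametrized curve.
  have hclose0 : ∀ ρ ∈ Icc (0 : ℝ) 1, ‖c (a₁ + ρ) - c (a₂ + ρ)‖ ≤ ε := by
    intro ρ hρ
    have f1 := hi' (t + ℓ * ρ)
    rw [E1 ρ hρ, show n * (t + ℓ * ρ) = n * t + ρ by linear_combination ρ * hnℓ] at f1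
    have hk1 : (1 : ℝ) ≤ k := by exact_mod_cast hk
    have hρk : ρ / k ∈ Icc (0 : ℝ) 1 :=
      ⟨div_nonneg hρ.1 hkpos.le, (div_le_one hkpos).2 (hρ.2.trans hk1)⟩
    have f2 := hi' (t + ℓ + (1 - ℓ) * (ρ / k))
    rw [E2 _ hρk, mul_div_cancel₀ _ hkpos.ne',
      show n * (t + ℓ + (1 - ℓ) * (ρ / k)) = n * t + ρ + 1 by
        have hkk : ρ / k * k = ρ := div_mul_cancel₀ _ hkpos.ne'
        linear_combination (1 - ρ / k) * hnℓ + hkk + (ρ / k) * hnd, hcp] at f2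
    calc ‖c (a₁ + ρ) - c (a₂ + ρ)‖ = ‖(c (a₁ + ρ) - c (n * t + ρ)) - (c (a₂ + ρ) - c (n * t + ρ))‖ := by
          congr 1; abel
      _ ≤ ε := (norm_sub_le _ _).trans (by linarith)
  have hcint : ∀ (j : ℤ) s, c (s + j) = c s := fun j s ↦ by simpa using hcp.int_mul j s
  obtain ⟨ϖ, hϖ, hdϖ⟩ := hper (a₁ - a₂) fun s ↦ by
    have h := hclose0 (Int.fract (s - a₂)) ⟨Int.fract_nonneg _, (Int.fract_lt_one _).le⟩
    have g1 : c (a₁ + Int.fract (s - a₂)) = c (a₁ - a₂ + s) := by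
      rw [← hcint ⌊s - a₂⌋, add_assoc, Int.fract_add_floor]; congr 1; ring
    have g2 : c (a₂ + Int.fract (s - a₂)) = c s := by
      rw [← hcint ⌊s - a₂⌋, add_assoc, Int.fract_add_floor]; congr 1; ring
    rwa [g1, g2] at h
  -- The first part ends where the second begins, and x has period 1.
  have hmeet : c a₁ = c a₂ := by
    have g1 := E1 1 (right_mem_Icc.2 zero_le_one)
    have g2 := E2 0 (left_mem_Icc.2 zero_le_one)
    rw [mul_one, x.periodic'] at g1
    rw [mul_zero, mul_zero, add_zero, add_zero, g1] at g2
    exact congrArg e g2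
  -- Two times at distance at most η with the same image coincide, so the approximate period is
  -- exact.
  have hd : a₂ = a₁ - ϖ := by
    refine hloc _ _ ?_ ?_
    · rw [show a₁ - ϖ - a₂ = a₁ - a₂ - ϖ by ring]; exact hdϖ.le
    · rw [← hmeet, ← hϖ (a₁ - ϖ)]; congr 1; ring
  have hx12 : ∀ s, x (a₂ + s) = x (a₁ + s) := fun s ↦ hinj (by
    change c (a₂ + s) = c (a₁ + s)
    rw [← hϖ (a₂ + s), hd]; congr 1; ring)
  refine ⟨Subtype.ext ?_, a₁ / n - t, fun s ↦ ?_⟩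
  · change (T' : ℝ) = ((k + 1 : ℕ) : ℝ) * T
    rw [hT', hcast]
  change y s = x (((k + 1 : ℕ) : ℝ) * (a₁ / n - t + s))
  have hnpos : 0 < n := by positivity
  have hxn : ∀ s, x (((k + 1 : ℕ) : ℝ) * (a₁ / n - t + s)) = x (a₁ + n * Int.fract (s - t)) := by
    intro s
    rw [hcast, ← x.map_add_int (a₁ + n * Int.fract (s - t)) ((k + 1 : ℕ) * ⌊s - t⌋)]
    congr 1
    push_cast
    rw [Int.fract]
    field_simp
    rw [hnd]; ring
  rw [hxn, ← y.map_add_int s (-⌊s - t⌋)]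
  set r := Int.fract (s - t) with hr
  have hsr : s + ((-⌊s - t⌋ : ℤ) : ℝ) = t + r := by
    rw [hr, Int.fract]; push_cast; ring
  rw [hsr]
  have hr0 : 0 ≤ r := Int.fract_nonneg _
  have hr1 : r < 1 := Int.fract_lt_one _
  rcases le_total r ℓ with hle | hle
  · have h := E1 (n * r) ⟨by positivity, by
      calc n * r ≤ n * ℓ := by gcongr
        _ = 1 := hnℓ⟩
    rwa [← mul_assoc, mul_comm ℓ n, hnℓ, one_mul] at h
  · have h := E2 ((r - ℓ) / (1 - ℓ)) ⟨div_nonneg (by linarith) hℓ1.le,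
      (div_le_one hℓ1).2 (by linarith)⟩
    rw [mul_div_cancel₀ _ hℓ1.ne', add_assoc, add_sub_cancel] at h
    have hk' : k * ((r - ℓ) / (1 - ℓ)) = n * r - 1 := by
      have : (k : ℝ) = n * (1 - ℓ) := by linear_combination hnℓ - hnd
      rw [this, mul_assoc, mul_div_cancel₀ _ hℓ1.ne']
      linear_combination -hnℓ
    rw [h, hk', hx12]
    have := x.map_add_int (a₁ + (n * r - 1)) 1
    rw [← this]
    congr 1
    push_cast
    ring

variable [IsManifold (𝓡 2) ∞ M] {g : SmoothMetric M} {θ : SmoothOneForm M} {κ : ℝ} {α : CurveSpace M}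

theorem action_eq_of_mem_orbit {β : CurveSpace M} (h : β ∈ orbit α) :
    action g θ κ β = action g θ κ α := by
  obtain ⟨σ, rfl⟩ := eq_shift_of_mem_orbit h
  exact action_shift g θ κ α.1 α.2 σ

/-- Action and orbit are invariant under time shifts, so the condition near α is carried along the
whole orbit. -/
theorem isStrictLocalMinimizer_iff :
    IsStrictLocalMinimizer (action g θ κ) α ↔
      ∀ᶠ γ in 𝓝 α, γ ∉ orbit α → action g θ κ α < action g θ κ γ := by
  constructor
  · rintro ⟨U, hU, h⟩
    filter_upwards [mem_nhdsSet_iff_forall.1 hU α (mem_orbit_self α)] with γ hγ hne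
    exact h γ ⟨hγ, hne⟩
  · intro h
    refine ⟨{γ | γ ∉ orbit α → action g θ κ α < action g θ κ γ}, ?_, fun γ hγ ↦ hγ.1 hγ.2⟩
    rw [mem_nhdsSet_iff_forall]
    intro β hβ
    obtain ⟨σ, rfl⟩ := eq_shift_of_mem_orbit hβ
    filter_upwards [(tendsto_shift_curve α σ).eventually h] with γ hγ hne
    rw [shift_mem_orbit_iff, action_shift] at hγ
    exact hγ hne

theorem isLocalMin_of_strict (h : IsStrictLocalMinimizer (action g θ κ) α) :
    IsLocalMin (action g θ κ) α := by
  filter_upwards [isStrictLocalMinimizer_iff.1 h] with γ hγ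
  by_cases hmem : γ ∈ orbit α
  · exact (action_eq_of_mem_orbit hmem).ge
  · exact (hγ hmem).le

variable [T2Space M] [CompactSpace M]

/-- If the cut curve is off the orbit, then by `eventually_mem_orbit_of_cut` at least one part is
off its own orbit and contributes a strict inequality; a part on its orbit contributes equality. -/
theorem isStrictLocalMinimizer_iterate (hM : IsOrientable M) (hκ : 0 < κ)
    (hmin : IsStrictLocalMinimizer (action g θ κ) α) {n : ℕ} (hn : 1 ≤ n) :
    IsStrictLocalMinimizer (action g θ κ) (iterate α n hn) := by
  obtain ⟨N, e, he, hemb, himm⟩ := exists_smooth_embedding M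
  have hloc := isLocalMin_of_strict hmin
  have hx := minimizer_contDiff g θ (x := α.1) (T := α.2) hloc
  have hne := minimizer_deriv_ne_zero g θ hκ (x := α.1) (T := α.2) hloc he hemb.injective himm
  induction n, hn using Nat.le_induction with
  | base => rw [iterate_one]; exact hmin
  | succ k hk ih =>
    rw [isStrictLocalMinimizer_iff]
    refine eventually_of_eventually_cut hM he hemb himm hx hne _ (by omega) ?_
    have h1 : ∀ᶠ β in 𝓝 (iterate α 1 le_rfl),
        β ∉ orbit α → action g θ κ α < action g θ κ β := by
      rw [iterate_one]; exact isStrictLocalMinimizer_iff.1 hmin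
    filter_upwards [(tendsto_first hx).eventually h1,
      (tendsto_second hx hk).eventually (isStrictLocalMinimizer_iff.1 ih),
      eventually_mem_orbit_of_cut he hemb.injective hx hne hk] with i hi1 hi2 hi3 hnot
    rw [action_cut g θ κ (k + 1) k i, action_iterate]
    rw [action_iterate] at hi2
    push_cast
    by_cases m1 : i.first (k + 1) ∈ orbit α
    · have m2 : i.second (k + 1) k ∉ orbit (iterate α k hk) := fun m2 ↦ hnot (hi3 m1 m2)
      have := action_eq_of_mem_orbit (g := g) (θ := θ) (κ := κ) m1
      linarith [hi2 m2]
    · have l1 := hi1 m1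
      by_cases m2 : i.second (k + 1) k ∈ orbit (iterate α k hk)
      · have := action_eq_of_mem_orbit (g := g) (θ := θ) (κ := κ) m2
        rw [action_iterate] at this
        linarith
      · linarith [hi2 m2]

end Strict

end MagneticFlow

end

theorem lemma3p1 {M : Type*} [TopologicalSpace M] [T2Space M] [CompactSpace M]
    [ChartedSpace MagneticFlow.Plane M] [IsManifold (𝓡 2) ∞ M]
    (hM : MagneticFlow.IsOrientable M)
    (g : MagneticFlow.SmoothMetric M) (θ : MagneticFlow.SmoothOneForm M)
    (κ : ℝ) (hκ : 0 < κ) (α : MagneticFlow.CurveSpace M) (n : ℕ) (hn : 1 ≤ n) :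
    (IsLocalMin (MagneticFlow.action g θ κ) α →
      IsLocalMin (MagneticFlow.action g θ κ) (MagneticFlow.iterate α n hn)) ∧
    (MagneticFlow.IsStrictLocalMinimizer (MagneticFlow.action g θ κ) α →
      MagneticFlow.IsStrictLocalMinimizer (MagneticFlow.action g θ κ)
        (MagneticFlow.iterate α n hn)) := by
  exact ⟨fun h ↦ MagneticFlow.isLocalMin_iterate hM hκ h hn,
    fun h ↦ MagneticFlow.isStrictLocalMinimizer_iterate hM hκ h hn⟩
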